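/- **Setting.** Let $E=\mathbb{Z}_m^d=\{0,\dots,m-1\}^d$ and let $\mathbf D([0,1],E)$ be the space of càdlàg paths, with canonical process $(X_t)$, its natural filtration $(\mathcal F_t)$, and the $\sigma$-algebra generated by the evaluations. A *generator* on $[0,1]$ is a family $(g_t)$ of real matrices on $E$, measurable in $t$, with $g_t(x,y)\ge 0$ for $x\ne y$ and $\sum_y g_t(x,y)=0$, and with exit rates bounded on $[0,T]$ for each $T<1$. A *CTMC with generator $g$* is a probability measure on $\mathbf D([0,1],E)$ under which $\mathbb P(X_t=y\mid\mathcal F_s)=p_{s,t}(X_s,y)$ a.s. for all $s\le t$ and $y$, where $(p_{s,t})_{0\le s\le t\le 1}$ is a family of stochastic matrices satisfying the Chapman–Kolmogorov equation and, with integrable integrands, the forward Kolmogorov equation $p_{s,t}(x,y)=\mathbf 1_{x=y}+\int_s^t\sum_z p_{s,r}(x,z)\,g_r(z,y)\,dr$. Let $q$ be a homogeneous generator on $E$, i.e. a real matrix that is non-negative off the diagonal and has zero row sums (on the finite set $E$ it is automatically stable and non-explosive), and let $p_{t|s}(y|x)=\big(e^{(t-s)q}\big)(x,y)$. Let $\mu_0,\mu_1$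 be probability measures on $E$ and $\pi$ an arbitrary coupling of them such that $p_{1|0}(x_1|x_0)>0$ whenever $\pi(x_0,x_1)>0$. Put $\tilde\pi(x_0,x_1)=\pi(x_0,x_1)/p_{1|0}(x_1|x_0)$ (read as $0$ where $\pi(x_0,x_1)=0$). An *interpolant* $X^{\mathrm I}$ is a càdlàg process with $(X^{\mathrm I}_0,X^{\mathrm I}_1)\sim\pi$ which, conditionally on $(X^{\mathrm I}_0,X^{\mathrm I}_1)=(x_0,x_1)$, for each $(x_0,x_1)$ with $\pi(x_0,x_1)>0$, is a $q$-bridge: it has the law of a CTMC with generator $q$ conditioned to have the endpoints $(x_0,x_1)$, the law of the endpoints of this CTMC charging every $(x_0,x_1)$ with $\pi(x_0,x_1)>0$. A *Markovian projection* of $X^{\mathrm I}$ is a CTMC with the initial law of $X^{\mathrm I}$ and with a generator $g$ such that, for all $t\in[0,1)$, all $x$ with $\mathbb P(X^{\mathrm I}_t=x)>0$ and all $y\neq x$, $$g_t(x,y)=\mathbb E\big[\,q_t^{X^{\mathrm I}_0\to X^{\mathrm I}_1}(x,y)\,\big|\,X^{\mathrm I}_t=x\,\big],$$ where, whenever $\mathbb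 P\big((X^{\mathrm I}_0,X^{\mathrm I}_1)=(x_0,x_1),\,X^{\mathrm I}_t=x\big)>0$, the bridge rate $$q_t^{x_0\to x_1}(x,y)=\lim_{u\downarrow t}\frac{1}{u-t}\,\mathbb P\big(X^{\mathrm I}_u=y\,\big|\,X^{\mathrm I}_t=x,\,(X^{\mathrm I}_0,X^{\mathrm I}_1)=(x_0,x_1)\big)$$ is required to exist. **Theorem.** An interpolant $X^{\mathrm I}$ exists. For every interpolant: 1. its time marginals are, for $t\in[0,1]$ and $x\in E$, $$\mathbb P(X^{\mathrm I}_t=x)=p^{\mathrm I}_t(x):=\sum_{x_0,x_1\in E}p_{t|0}(x|x_0)\,p_{1|t}(x_1|x)\,\tilde\pi(x_0,x_1);$$ 2. $X^{\mathrm I}$ has a Markovian projection; 3. a law on $\mathbf D([0,1],E)$ is a Markovian projection of $X^{\mathrm I}$ if and only if it is a CTMC with initial law $\mu_0$ and generator $q^{\mathrm M}$, where for $t\in[0,1]$ and $x\neq y$ $$q^{\mathrm M}_t(x,y)=q(x,y)\,u^{\mathrm M}_t(x,y),\qquad u^{\mathrm M}_t(x,y)=\frac{\sum_{x_0,x_1\in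 E}p_{1|t}(x_1|y)\,p_{t|0}(x|x_0)\,\tilde\pi(x_0,x_1)}{p^{\mathrm I}_t(x)}$$ (with $u^{\mathrm M}_t(x,y):=0$ where $p^{\mathrm I}_t(x)=0$) and $q^{\mathrm M}_t(x,x)=-\sum_{y\ne x}q^{\mathrm M}_t(x,y)$; 4. the Markovian projection $X^{\mathrm M}$ is unique in law; 5. $X^{\mathrm M}_t$ and $X^{\mathrm I}_t$ have the same law for each $t\in[0,1]$. -/

import Mathlib

open MeasureTheory ProbabilityTheory Filter Topology Set

noncomputable section

namespace MarkovBridge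

/-- The finite state space `ℤ_m^d = {0, …, m-1}^d`. -/
abbrev StateSpace (d m : ℕ) : Type := Fin d → Fin m

section General

variable {E : Type} [Fintype E] [DecidableEq E] [MeasurableSpace E]

/-! ### Càdlàg paths on `[0,1]` and the canonical process -/

/-- Càdlàg paths `[0,1] → E` for the discrete topology on `E`: right-continuity at `t` means that
the path is constant on some interval `[t, t + ε)`, and a left limit at `t` exists when the path is
constant on some interval `(t - ε, t)`. -/
def IsCadlag (w : unitInterval → E) : Prop :=
  (∀ t, ∀ᶠ u in 𝓝[>] t, w u = w t) ∧ (∀ t, ∃ x, ∀ᶠ u in 𝓝[<] t, w u = x)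

variable (E) in
/-- The path space `D([0,1], E)`; as a subtype of a product it carries the σ-algebra generated by
the evaluation maps. -/
abbrev PathSpace : Type := {w : unitInterval → E // IsCadlag w}

/-- The canonical process `X_t`. -/
def eval (t : unitInterval) (w : PathSpace E) : E := w.1 t

/-- The pair of endpoints `(X_0, X_1)`. -/
def endpoints (w : PathSpace E) : E × E := (eval 0 w, eval 1 w)

variable (E) in
/-- The natural filtration `σ(X_u, u ≤ s)` of the canonical process. -/
abbrev past (s : unitInterval) : MeasurableSpace (PathSpace E) :=
  ⨆ u : unitInterval, ⨆ _ : u ≤ s, MeasurableSpace.comap (eval u) inferInstance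

/-! ### Rate matrices, transition functions and continuous-time Markov chains -/

/-- A conservative rate matrix: non-negative off the diagonal, with vanishing row sums. Entries are
real numbers, so it is stable, and on a finite state space it is automatically non-explosive. -/
structure IsRateMatrix (q : Matrix E E ℝ) : Prop where
  nonneg : ∀ x y, x ≠ y → 0 ≤ q x y
  row_sum : ∀ x, ∑ y, q x y = 0

/-- A time-inhomogeneous generator `(g_t)` on `[0,1]`: a measurable family of conservative rate
matrices with exit rates bounded on `[0,T]` for each `T < 1`. -/
structure IsGenerator (g : ℝ → Matrix E E ℝ) : Prop where
  rate : ∀ t ∈ Icc (0 : ℝ) 1, IsRateMatrix (g t)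
  measurable : ∀ x y, Measurable fun t => g t x y
  stable : ∀ T < (1 : ℝ), ∀ x, ∃ C : ℝ, ∀ t ∈ Icc (0 : ℝ) T, - g t x x ≤ C

/-- `p s t x y`, for `0 ≤ s ≤ t ≤ 1`, is a (stochastic, hence non-explosive) transition function
with generator `g`: it satisfies the Chapman-Kolmogorov equation and the forward Kolmogorov
equation `∂_t p_{s,t}(x,y) = ∑_z p_{s,t}(x,z) g_t(z,y)`, `p_{s,s} = 1`, in integrated form. -/
structure IsTransitionFunction (g : ℝ → Matrix E E ℝ) (p : ℝ → ℝ → Matrix E E ℝ) : Prop where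
  nonneg : ∀ s t, 0 ≤ s → s ≤ t → t ≤ 1 → ∀ x y, 0 ≤ p s t x y
  row_sum : ∀ s t, 0 ≤ s → s ≤ t → t ≤ 1 → ∀ x, ∑ y, p s t x y = 1
  chapman_kolmogorov : ∀ s u t, 0 ≤ s → s ≤ u → u ≤ t → t ≤ 1 → p s t = p s u * p u t
  integrable : ∀ s t, 0 ≤ s → s ≤ t → t ≤ 1 → ∀ x z y,
    IntervalIntegrable (fun r => p s r x z * g r z y) volume s t
  forward : ∀ s t, 0 ≤ s → s ≤ t → t ≤ 1 → ∀ x y,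
    p s t x y = (1 : Matrix E E ℝ) x y + ∫ r in s..t, ∑ z, p s r x z * g r z y

/-- Under `P`, the canonical process is a continuous-time Markov chain on `[0,1]` with generator
`g`: it is Markov for its natural filtration, and its transition probabilities are given by a
transition function with generator `g`. -/
structure IsCTMC (g : ℝ → Matrix E E ℝ) (P : Measure (PathSpace E)) : Prop where
  prob : IsProbabilityMeasure P
  generator : IsGenerator g
  markov : ∃ p, IsTransitionFunction g p ∧
    ∀ s t : unitInterval, s ≤ t → ∀ y : E,
      P[({w | eval t w = y} : Set (PathSpace E)).indicator (fun _ => (1 : ℝ)) | past E s]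
        =ᵐ[P] fun w => p s t (eval s w) y

/-! ### Bridges and interpolants -/

/-- `π` is a coupling of `μ₀` and `μ₁`. -/
def IsCoupling (π : Measure (E × E)) (μ₀ μ₁ : Measure E) : Prop :=
  π.map Prod.fst = μ₀ ∧ π.map Prod.snd = μ₁

/-- The bridge of the path measure `Q` from `x₀` to `x₁`: the law of the path conditionally on
`(X_0, X_1) = (x₀, x₁)` (meaningful if this event has positive probability). -/
def bridge (Q : Measure (PathSpace E)) (x₀ x₁ : E) : Measure (PathSpace E) :=
  Q[| {w | endpoints w = (x₀, x₁)}]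

/-- `P` is the law of the interpolant with coupling `π` and reference generator `q`: the endpoints
have law `π`, and conditionally on its endpoints the process is a bridge of a continuous-time
Markov chain with generator `q`. -/
def IsInterpolant (q : Matrix E E ℝ) (π : Measure (E × E)) (P : Measure (PathSpace E)) : Prop :=
  ∃ Q : Measure (PathSpace E), IsCTMC (fun _ => q) Q ∧
    (∀ x₀ x₁, π {(x₀, x₁)} ≠ 0 → Q {w | endpoints w = (x₀, x₁)} ≠ 0) ∧
    P.map endpoints = π ∧
    ∀ x₀ x₁, π {(x₀, x₁)} ≠ 0 → bridge P x₀ x₁ = bridge Q x₀ x₁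

/-! ### Markovian projection -/

/-- Under `P` the process jumps from `x` to `y` at time `t` with rate `r`:
`P(X_u = y | X_t = x) / (u - t) → r` as `u ↓ t`. -/
def HasJumpRate (P : Measure (PathSpace E)) (t : unitInterval) (x y : E) (r : ℝ) : Prop :=
  Tendsto (fun u : unitInterval =>
      (P[| {w | eval t w = x}]).real {w | eval u w = y} / ((u : ℝ) - (t : ℝ)))
    (𝓝[>] t) (𝓝 r)

/-- `PM` is (the law of) a Markovian projection of the process with law `P`: a continuous-time
Markov chain with the same initial law whose generator `g` is the conditional expectation, given
the current state, of the jump rates `b x₀ x₁ t x y` of the process conditioned on its endpoints: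
`g_t(x,y) = E[b X_0 X_1 t x y | X_t = x]`, for `t < 1`, `P(X_t = x) ≠ 0` and `y ≠ x`. -/
def IsMarkovianProjection (P PM : Measure (PathSpace E)) : Prop :=
  PM.map (eval 0) = P.map (eval 0) ∧
  ∃ (g : ℝ → Matrix E E ℝ) (b : E → E → unitInterval → E → E → ℝ),
    IsCTMC g PM ∧
    (∀ x₀ x₁ (t : unitInterval) (x y : E), t < 1 → x ≠ y →
      P {w | endpoints w = (x₀, x₁) ∧ eval t w = x} ≠ 0 →
        HasJumpRate (bridge P x₀ x₁) t x y (b x₀ x₁ t x y)) ∧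
    (∀ (t : unitInterval) (x y : E), t < 1 → x ≠ y → P {w | eval t w = x} ≠ 0 →
      g t x y = ∑ x₀, ∑ x₁,
        (P[| {w | eval t w = x}]).real {w | endpoints w = (x₀, x₁)} * b x₀ x₁ t x y)

/-! ### The explicit formulas -/

/-- The transition probability `p_{t|s}(y|x)` of the homogeneous chain with generator `q`, i.e. the
`(x,y)` entry of the matrix exponential of `(t-s) q`. -/
def transProb (q : Matrix E E ℝ) (s t : ℝ) (y x : E) : ℝ :=
  NormedSpace.exp ((t - s) • q) x y

/-- `π̃(x₀,x₁) = π(x₀,x₁) / p_{1|0}(x₁|x₀)`. -/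
def tildeCoupling (q : Matrix E E ℝ) (π : Measure (E × E)) (x₀ x₁ : E) : ℝ :=
  π.real {(x₀, x₁)} / transProb q 0 1 x₁ x₀

/-- `p^I_t(x) = ∑_{x₀,x₁} p_{t|0}(x|x₀) p_{1|t}(x₁|x) π̃(x₀,x₁)`. -/
def interpolantDensity (q : Matrix E E ℝ) (π : Measure (E × E)) (t : ℝ) (x : E) : ℝ :=
  ∑ x₀, ∑ x₁, transProb q 0 t x x₀ * transProb q t 1 x₁ x * tildeCoupling q π x₀ x₁

/-- The score `u^M_t(x,y)`, with the convention that it is `0` where `p^I_t(x) = 0`. -/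
def score (q : Matrix E E ℝ) (π : Measure (E × E)) (t : ℝ) (x y : E) : ℝ :=
  (∑ x₀, ∑ x₁, transProb q t 1 x₁ y * transProb q 0 t x x₀ * tildeCoupling q π x₀ x₁) /
    interpolantDensity q π t x

/-- The generator `q^M_t`: `q^M_t(x,y) = q(x,y) u^M_t(x,y)` for `x ≠ y`, with the diagonal fixed by
vanishing row sums. -/
def projGenerator (q : Matrix E E ℝ) (π : Measure (E × E)) (t : ℝ) : Matrix E E ℝ :=
  Matrix.of fun x y =>
    if x = y then - ∑ z ∈ Finset.univ.erase x, q x z * score q π t x z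
    else q x y * score q π t x y

end General

end MarkovBridge

end

open MarkovBridge

/-!
The proof rests on three facts about the heat kernel `heat q h = e^{hq}` and the density `p^I`.

*Bridges are Doob transforms.* The transition function of a chain with generator `q` is unique and
equal to the heat kernel, so the joint law of the endpoints and of one or two further states of an
interpolant is explicit (`IsInterpolant.joint_law`). This gives the time marginals, and shows that
the bridge to `x₁` jumps from `x` to `y` at time `t` with rate
`q(x,y) p_{1|t}(x₁|y) / p_{1|t}(x₁|x)` (`IsInterpolant.hasJumpRate_bridge`). Averaging over the
endpoints given the current state yields `q^M` (`IsInterpolant.sum_cond_mul_rate`).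

*The forward equation of `q^M` is well posed up to time `1`.* The rates `q^M_t` are bounded for `t`
away from `1`, because the kernels from `y` and from `x` are comparable whenever `x` jumps to `y`
(`IsRateMatrix.exists_rate_mul_heat_le`), but they may blow up at time `1`. On `[0,T]` with `T < 1`
the Dyson series and Grönwall's inequality give existence, uniqueness and positivity. The density
`p^I` solves the forward equation, so by positivity a solution `v` started from a state `x` with
`p^I_s(x) > 0` satisfies `p^I_s(x) v_t ≤ p^I_t` (`IsRateMatrix.density_mul_le`). Since the flux
`p^I_t(x) q^M_t(x,y)` is continuous on `[0,1]`, the integrands of the forward equation are bounded,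
and the solution extends to time `1`. The same domination shows that the chain never visits states
which the interpolant does not charge; hence the rates out of such states, which the definition of a
Markovian projection leaves free, do not influence the law
(`IsRateMatrix.transition_eq_of_charged`).

*A chain with càdlàg paths exists.* Chains on finitely many times are put together by hand; as the
state space is finite, cylinders are open and compact, and a limit along an ultrafilter of finite
sets of times is a Markov law on all paths (`IsTransitionFunction.exists_pathLaw`). The bounded flux
makes the probability of a change of state between times `s` and `t` at most `C (t - s)`, so the
paths have finite variation along a countable dense set of times, and their right limits form a
càdlàg modification (`exists_cadlag_modification`).

A Markov law is determined by its initial law and its transition function (`IsMarkovWith.ext`).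
Therefore the Markovian projections are exactly the chains with generator `q^M` started from `μ₀`,
and there is one such law, with marginals `p^I`.
-/

set_option linter.unusedSectionVars false

noncomputable section

namespace MarkovBridge

/-! ### The heat kernel of a homogeneous generator -/

section RateMatrix

variable {E : Type} [Fintype E] [DecidableEq E]

attribute [local instance] Matrix.linftyOpNormedAddCommGroup Matrix.linftyOpNormedRing
  Matrix.linftyOpNormedAlgebra

/-- The semigroup `e^{hq}` of a homogeneous generator. -/
def heat (q : Matrix E E ℝ) (h : ℝ) : Matrix E E ℝ := NormedSpace.exp (h • q)

lemma heat_zero (q : Matrix E E ℝ) : heat q 0 = 1 := by simp [heat]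

lemma heat_add (q : Matrix E E ℝ) (a b : ℝ) : heat q (a + b) = heat q a * heat q b := by
  unfold heat
  rw [add_smul, Matrix.exp_add_of_commute]
  exact ((Commute.refl q).smul_left a).smul_right b

lemma heat_add_apply (q : Matrix E E ℝ) (a b : ℝ) (x y : E) :
    heat q (a + b) x y = ∑ z, heat q a x z * heat q b z y := by
  rw [heat_add, Matrix.mul_apply]

lemma hasDerivAt_entry {f : ℝ → Matrix E E ℝ} {f' : Matrix E E ℝ} {t : ℝ}
    (h : HasDerivAt f f' t) (x y : E) : HasDerivAt (fun s => f s x y) (f' x y) t := by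
  let L : Matrix E E ℝ →ₗ[ℝ] ℝ :=
    { toFun := fun M => M x y, map_add' := fun _ _ => rfl, map_smul' := fun _ _ => rfl }
  exact (LinearMap.toContinuousLinearMap L).hasFDerivAt.comp_hasDerivAt t h

lemma hasDerivAt_heat (q : Matrix E E ℝ) (t : ℝ) (x y : E) :
    HasDerivAt (fun s => heat q s x y) (∑ z, heat q t x z * q z y) t := by
  exact (hasDerivAt_entry (hasDerivAt_exp_smul_const (𝕂 := ℝ) q t) x y).congr_deriv
    (Matrix.mul_apply ..)

lemma hasDerivAt_heat' (q : Matrix E E ℝ) (t : ℝ) (x y : E) :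
    HasDerivAt (fun s => heat q s x y) (∑ z, q x z * heat q t z y) t := by
  exact (hasDerivAt_entry (hasDerivAt_exp_smul_const' (𝕂 := ℝ) q t) x y).congr_deriv
    (Matrix.mul_apply ..)

lemma continuous_heat (q : Matrix E E ℝ) (x y : E) : Continuous fun s => heat q s x y :=
  continuous_iff_continuousAt.2 fun t => (hasDerivAt_heat q t x y).continuousAt

lemma hasSum_heat (B : Matrix E E ℝ) (s : ℝ) (x y : E) :
    HasSum (fun n : ℕ => (n.factorial : ℝ)⁻¹ * s ^ n * (B ^ n) x y) (heat B s x y) := by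
  let L : Matrix E E ℝ →ₗ[ℝ] ℝ :=
    { toFun := fun M => M x y, map_add' := fun _ _ => rfl, map_smul' := fun _ _ => rfl }
  have h := (NormedSpace.exp_series_hasSum_exp' (𝕂 := ℝ) (s • B)).mapL
    (LinearMap.toContinuousLinearMap L)
  refine HasSum.congr_fun h fun n => ?_
  change _ = ((n.factorial : ℝ)⁻¹ • (s • B) ^ n) x y
  simp [smul_pow, mul_assoc]

/-- Uniformization: shifting the generator by a multiple of the identity rescales the semigroup. -/
lemma heat_add_smul_one (q : Matrix E E ℝ) (l s : ℝ) (x y : E) :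
    heat q s x y = Real.exp (-(l * s)) * heat (q + l • (1 : Matrix E E ℝ)) s x y := by
  have h1 : s • q = (-(l * s)) • (1 : Matrix E E ℝ) + s • (q + l • (1 : Matrix E E ℝ)) := by
    ext i j
    simp only [Matrix.smul_apply, Matrix.add_apply, smul_eq_mul]
    ring
  have h2 : NormedSpace.exp ((-(l * s)) • (1 : Matrix E E ℝ))
      = Real.exp (-(l * s)) • (1 : Matrix E E ℝ) := by
    rw [Real.exp_eq_exp_ℝ, ← Algebra.algebraMap_eq_smul_one, ← Algebra.algebraMap_eq_smul_one,
      NormedSpace.algebraMap_exp_comm]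
    rfl
  unfold heat
  rw [h1, Matrix.exp_add_of_commute, h2, smul_mul_assoc, one_mul]
  · rfl
  · exact (Commute.one_left _).smul_left _

/-- A constant dominating all exit rates. -/
def rateBound (q : Matrix E E ℝ) : ℝ := ∑ x, |q x x|

lemma rateBound_nonneg (q : Matrix E E ℝ) : 0 ≤ rateBound q :=
  Finset.sum_nonneg fun _ _ => abs_nonneg _

/-- The generator shifted so that all its entries are non-negative. -/
def shifted (q : Matrix E E ℝ) : Matrix E E ℝ := q + rateBound q • (1 : Matrix E E ℝ)

lemma shifted_apply_of_ne (q : Matrix E E ℝ) {x y : E} (h : x ≠ y) : shifted q x y = q x y := by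
  simp [shifted, Matrix.one_apply_ne h]

variable {q : Matrix E E ℝ}

lemma IsRateMatrix.shifted_nonneg (hq : IsRateMatrix q) (x y : E) : 0 ≤ shifted q x y := by
  by_cases h : x = y
  · subst h
    have : |q x x| ≤ rateBound q :=
      Finset.single_le_sum (f := fun x => |q x x|) (fun _ _ => abs_nonneg _) (Finset.mem_univ x)
    simp only [shifted, Matrix.add_apply, Matrix.smul_apply, Matrix.one_apply_eq, smul_eq_mul]
    linarith [neg_abs_le (q x x)]
  · rw [shifted_apply_of_ne q h]
    exact hq.nonneg x y h

lemma IsRateMatrix.shifted_pow_nonneg (hq : IsRateMatrix q) (n : ℕ) (x y : E) :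
    0 ≤ (shifted q ^ n) x y := by
  induction n generalizing x y with
  | zero => by_cases h : x = y <;> simp [h]
  | succ n ih =>
    rw [pow_succ, Matrix.mul_apply]
    exact Finset.sum_nonneg fun z _ => mul_nonneg (ih x z) (hq.shifted_nonneg z y)

lemma heat_eq_shifted (q : Matrix E E ℝ) (s : ℝ) (x y : E) :
    heat q s x y = Real.exp (-(rateBound q * s)) * heat (shifted q) s x y :=
  heat_add_smul_one q (rateBound q) s x y

lemma IsRateMatrix.term_nonneg (hq : IsRateMatrix q) {s : ℝ} (hs : 0 ≤ s) (x y : E) (n : ℕ) :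
    0 ≤ (n.factorial : ℝ)⁻¹ * s ^ n * (shifted q ^ n) x y :=
  mul_nonneg (by positivity) (hq.shifted_pow_nonneg n x y)

lemma IsRateMatrix.heat_nonneg (hq : IsRateMatrix q) {s : ℝ} (hs : 0 ≤ s) (x y : E) :
    0 ≤ heat q s x y := by
  rw [heat_eq_shifted]
  exact mul_nonneg (Real.exp_pos _).le ((hasSum_heat _ s x y).nonneg (hq.term_nonneg hs x y))

lemma IsRateMatrix.heat_row_sum (hq : IsRateMatrix q) (s : ℝ) (x : E) :
    ∑ y, heat q s x y = 1 := by
  have hd : ∀ t, HasDerivAt (fun s => ∑ y, heat q s x y) 0 t := by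
    intro t
    have := HasDerivAt.fun_sum fun y (_ : y ∈ Finset.univ) => hasDerivAt_heat q t x y
    refine this.congr_deriv ?_
    rw [Finset.sum_comm]
    simp [← Finset.mul_sum, hq.row_sum]
  have := is_const_of_deriv_eq_zero (fun t => (hd t).differentiableAt) (fun t => (hd t).deriv) s 0
  simpa [heat_zero, Matrix.one_apply] using this

lemma IsRateMatrix.heat_le_one (hq : IsRateMatrix q) {s : ℝ} (hs : 0 ≤ s) (x y : E) :
    heat q s x y ≤ 1 := by
  rw [← hq.heat_row_sum s x]
  exact Finset.single_le_sum (f := fun y => heat q s x y)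
    (fun y _ => hq.heat_nonneg hs x y) (Finset.mem_univ y)

lemma IsRateMatrix.heat_diag_ge (hq : IsRateMatrix q) {s : ℝ} (hs : 0 ≤ s) (x : E) :
    Real.exp (-(rateBound q * s)) ≤ heat q s x x := by
  rw [heat_eq_shifted]
  refine le_mul_of_one_le_right (Real.exp_pos _).le ?_
  have := (hasSum_heat (shifted q) s x x).summable.sum_le_tsum {0}
    (fun n _ => hq.term_nonneg hs x x n)
  rw [(hasSum_heat (shifted q) s x x).tsum_eq] at this
  simpa using this

/-- `y` is charged from `x` at a positive time exactly if it can be reached along the powers of the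
shifted generator; in particular this does not depend on the time. -/
lemma IsRateMatrix.heat_eq_zero_iff (hq : IsRateMatrix q) {s : ℝ} (hs : 0 < s) (x y : E) :
    heat q s x y = 0 ↔ ∀ n, (shifted q ^ n) x y = 0 := by
  rw [heat_eq_shifted, mul_eq_zero, or_iff_right (Real.exp_pos _).ne']
  have h := hasSum_heat (shifted q) s x y
  constructor
  · intro h0 n
    rw [h0, hasSum_zero_iff_of_nonneg (hq.term_nonneg hs.le x y)] at h
    have := congrFun h n
    rw [Pi.zero_apply, mul_eq_zero] at this
    exact this.resolve_left (by positivity)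
  · intro h0
    simp only [h0, mul_zero] at h
    exact h.unique hasSum_zero

/-- If `x` jumps to `y` at a positive rate and cannot reach `z`, then neither can `y`. -/
lemma IsRateMatrix.rate_mul_heat_eq_zero (hq : IsRateMatrix q) {s : ℝ} (hs : 0 < s) {x y : E}
    (hxy : x ≠ y) {z : E} (h : heat q s x z = 0) : q x y * heat q s y z = 0 := by
  rw [hq.heat_eq_zero_iff hs] at h
  by_cases h0 : q x y = 0
  · simp [h0]
  · rw [mul_eq_zero, or_iff_right h0, hq.heat_eq_zero_iff hs]
    intro n
    have h1 := h (n + 1)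
    rw [pow_succ', Matrix.mul_apply, Finset.sum_eq_zero_iff_of_nonneg
      (fun w _ => mul_nonneg (hq.shifted_nonneg x w) (hq.shifted_pow_nonneg n w z))] at h1
    have h2 := h1 y (Finset.mem_univ y)
    rw [shifted_apply_of_ne q hxy, mul_eq_zero, or_iff_right h0] at h2
    exact h2

/-- A Harnack-type comparison: away from time `0`, the heat kernel from a neighbour `y` of `x` is
dominated by the one from `x`. -/
lemma IsRateMatrix.exists_rate_mul_heat_le (hq : IsRateMatrix q) {S : ℝ} (hS : 0 < S) :
    ∃ C : ℝ, 0 ≤ C ∧ ∀ s ∈ Icc S 1, ∀ x y z : E, x ≠ y →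
      q x y * heat q s y z ≤ C * heat q s x z := by
  -- The kernel from `x` at time `s` is at least the one at time `S` times a lower bound for the
  -- probability of staying in `x`; division by `0` below occurs only if `z` cannot be reached from `x`.
  let c : E → E → E → ℝ := fun x y z => |q x y / (Real.exp (-(rateBound q)) * heat q S x z)|
  have hc : ∀ x y z, 0 ≤ c x y z := fun x y z => abs_nonneg _
  refine ⟨∑ x, ∑ y, ∑ z, c x y z, Finset.sum_nonneg fun x _ => Finset.sum_nonneg fun y _ =>
    Finset.sum_nonneg fun z _ => hc x y z, ?_⟩
  intro s hs x y z hxy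
  have hs0 : 0 < s := hS.trans_le hs.1
  have hle : c x y z ≤ ∑ x, ∑ y, ∑ z, c x y z := by
    calc c x y z ≤ ∑ z, c x y z :=
          Finset.single_le_sum (f := fun z => c x y z) (fun z _ => hc x y z) (Finset.mem_univ z)
      _ ≤ ∑ y, ∑ z, c x y z :=
          Finset.single_le_sum (f := fun y => ∑ z, c x y z)
            (fun y _ => Finset.sum_nonneg fun z _ => hc x y z) (Finset.mem_univ y)
      _ ≤ _ :=
          Finset.single_le_sum (f := fun x => ∑ y, ∑ z, c x y z)
            (fun x _ => Finset.sum_nonneg fun y _ => Finset.sum_nonneg fun z _ => hc x y z)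
            (Finset.mem_univ x)
  refine le_trans ?_ (mul_le_mul_of_nonneg_right hle (hq.heat_nonneg hs0.le x z))
  by_cases h0 : heat q S x z = 0
  · have h1 : heat q s x z = 0 := by
      rw [hq.heat_eq_zero_iff hs0, ← hq.heat_eq_zero_iff hS]; exact h0
    rw [hq.rate_mul_heat_eq_zero hs0 hxy h1, h1, mul_zero]
  · have hpos : 0 < heat q S x z := lt_of_le_of_ne (hq.heat_nonneg hS.le x z) (Ne.symm h0)
    have hlow : Real.exp (-(rateBound q)) * heat q S x z ≤ heat q s x z := by
      have h1 : s = (s - S) + S := by ring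
      rw [h1, heat_add_apply]
      refine le_trans ?_ (Finset.single_le_sum (f := fun w => heat q (s - S) x w * heat q S w z)
        (fun w _ => mul_nonneg (hq.heat_nonneg (by linarith [hs.1]) x w)
          (hq.heat_nonneg hS.le w z)) (Finset.mem_univ x))
      refine mul_le_mul_of_nonneg_right ?_ hpos.le
      refine le_trans (Real.exp_le_exp.2 ?_) (hq.heat_diag_ge (by linarith [hs.1]) x)
      nlinarith [rateBound_nonneg q, hs.1, hs.2]
    have hd : 0 < Real.exp (-(rateBound q)) * heat q S x z := mul_pos (Real.exp_pos _) hpos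
    calc q x y * heat q s y z ≤ q x y * 1 :=
          mul_le_mul_of_nonneg_left (hq.heat_le_one hs0.le y z) (hq.nonneg x y hxy)
      _ = q x y / (Real.exp (-(rateBound q)) * heat q S x z)
            * (Real.exp (-(rateBound q)) * heat q S x z) := by
          rw [mul_one, div_mul_cancel₀ _ hd.ne']
      _ ≤ c x y z * heat q s x z :=
          mul_le_mul (le_abs_self _) hlow hd.le (hc x y z)

/-- The jump rates of the semigroup are the entries of its generator. -/
lemma tendsto_heat_div (q : Matrix E E ℝ) {x y : E} (hxy : x ≠ y) :
    Tendsto (fun h => heat q h x y / h) (𝓝[≠] 0) (𝓝 (q x y)) := by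
  have h := (hasDerivAt_heat q 0 x y).tendsto_slope_zero
  simp only [heat_zero, zero_add, Matrix.one_apply_ne hxy, sub_zero, smul_eq_mul] at h
  simp only [Matrix.one_apply, ite_mul, one_mul, zero_mul, Finset.sum_ite_eq, Finset.mem_univ,
    if_true] at h
  exact h.congr fun u => by rw [div_eq_inv_mul]

end RateMatrix

/-! ### The forward equation with bounded rates -/

section ForwardEquation

variable {E : Type} [Fintype E] [DecidableEq E]

lemma intervalIntegrable_fun_sum {ι : Type} (u : Finset ι) {f : ι → ℝ → ℝ} {a b : ℝ}
    (h : ∀ i ∈ u, IntervalIntegrable (f i) volume a b) :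
    IntervalIntegrable (fun r => ∑ i ∈ u, f i r) volume a b := by
  have h1 : (fun r => ∑ i ∈ u, f i r) = ∑ i ∈ u, f i := by
    ext r
    simp
  rw [h1]
  exact IntervalIntegrable.sum u h

/-- `v` solves, on `[s,T]` and with initial value `c`, the forward equation `v' = v g` in its
integrated form. -/
structure IsForwardSol (g : ℝ → Matrix E E ℝ) (s T : ℝ) (c : E → ℝ) (v : ℝ → E → ℝ) : Prop where
  integrable : ∀ z y, IntervalIntegrable (fun r => v r z * g r z y) volume s T
  eq : ∀ t ∈ Icc s T, ∀ y, v t y = c y + ∫ r in s..t, ∑ z, v r z * g r z y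

namespace IsForwardSol

variable {g : ℝ → Matrix E E ℝ} {s T : ℝ} {c : E → ℝ} {v : ℝ → E → ℝ}

lemma integrable_sum (h : IsForwardSol g s T c v) (y : E) :
    IntervalIntegrable (fun r => ∑ z, v r z * g r z y) volume s T :=
  intervalIntegrable_fun_sum _ fun z _ => h.integrable z y

lemma initial (h : IsForwardSol g s T c v) (hsT : s ≤ T) (y : E) : v s y = c y := by
  simpa using h.eq s ⟨le_rfl, hsT⟩ y

lemma continuousOn (h : IsForwardSol g s T c v) (hsT : s ≤ T) (y : E) :
    ContinuousOn (fun t => v t y) (Icc s T) := by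
  have h1 := intervalIntegral.continuousOn_primitive_interval' (h.integrable_sum y) left_mem_uIcc
  rw [uIcc_of_le hsT] at h1
  exact (continuousOn_const.add h1).congr fun t ht => h.eq t ht y

lemma integrable_on (h : IsForwardSol g s T c v) {a b : ℝ} (ha : a ∈ Icc s T) (hb : b ∈ Icc s T)
    (z y : E) : IntervalIntegrable (fun r => v r z * g r z y) volume a b :=
  (h.integrable z y).mono_set
    (uIcc_subset_uIcc (Icc_subset_uIcc ha) (Icc_subset_uIcc hb))

lemma integrable_sum_on (h : IsForwardSol g s T c v) {a b : ℝ} (ha : a ∈ Icc s T)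
    (hb : b ∈ Icc s T) (y : E) :
    IntervalIntegrable (fun r => ∑ z, v r z * g r z y) volume a b :=
  (h.integrable_sum y).mono_set
    (uIcc_subset_uIcc (Icc_subset_uIcc ha) (Icc_subset_uIcc hb))

lemma restart_eq (h : IsForwardSol g s T c v) {u t : ℝ} (hu : u ∈ Icc s T) (ht : t ∈ Icc s T)
    (y : E) : v t y = v u y + ∫ r in u..t, ∑ z, v r z * g r z y := by
  have hs : s ∈ Icc s T := ⟨le_rfl, hu.1.trans hu.2⟩
  rw [h.eq t ht, h.eq u hu, add_assoc, intervalIntegral.integral_add_adjacent_intervals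
    (h.integrable_sum_on hs hu y) (h.integrable_sum_on hu ht y)]

/-- Restarting a solution at a later time. -/
lemma restart (h : IsForwardSol g s T c v) {u : ℝ} (hu : u ∈ Icc s T) :
    IsForwardSol g u T (v u) v where
  integrable := h.integrable_on hu ⟨hu.1.trans hu.2, le_rfl⟩
  eq _ ht y := h.restart_eq hu ⟨hu.1.trans ht.1, ht.2⟩ y

lemma mono (h : IsForwardSol g s T c v) {T' : ℝ} (hs : s ≤ T') (hT : T' ≤ T) :
    IsForwardSol g s T' c v where
  integrable := h.integrable_on ⟨le_rfl, hs.trans hT⟩ ⟨hs, hT⟩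
  eq t ht y := h.eq t ⟨ht.1, ht.2.trans hT⟩ y

lemma linear_comb {ι : Type} [Fintype ι] {c : ι → E → ℝ} {v : ι → ℝ → E → ℝ} (hsT : s ≤ T)
    (h : ∀ i, IsForwardSol g s T (c i) (v i)) (a : ι → ℝ) :
    IsForwardSol g s T (fun y => ∑ i, a i * c i y) (fun t y => ∑ i, a i * v i t y) where
  integrable z y := by
    simp only [Finset.sum_mul, mul_assoc]
    exact intervalIntegrable_fun_sum _ fun i _ => ((h i).integrable z y).const_mul (a i)
  eq t ht y := by
    have h1 : ∀ r, ∑ z, (∑ i, a i * v i r z) * g r z y = ∑ i, a i * ∑ z, v i r z * g r z y := by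
      intro r
      simp only [Finset.sum_mul, Finset.mul_sum]
      rw [Finset.sum_comm]
      exact Finset.sum_congr rfl fun i _ => Finset.sum_congr rfl fun z _ => by ring
    simp only [h1]
    rw [intervalIntegral.integral_finsetSum fun i _ =>
      ((h i).integrable_sum_on ⟨le_rfl, hsT⟩ ht y).const_mul (a i), ← Finset.sum_add_distrib]
    refine Finset.sum_congr rfl fun i _ => ?_
    rw [(h i).eq t ht y, intervalIntegral.integral_const_mul, mul_add]

lemma sub_smul {c' : E → ℝ} {v' : ℝ → E → ℝ} (hsT : s ≤ T) (h : IsForwardSol g s T c v)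
    (h' : IsForwardSol g s T c' v') (a : ℝ) :
    IsForwardSol g s T (fun y => c y - a * c' y) (fun t y => v t y - a * v' t y) := by
  have h2 := linear_comb (ι := Bool) (c := fun i => cond i c c') (v := fun i => cond i v v') hsT
    (fun i => by cases i <;> assumption) (fun i => cond i 1 (-a))
  simpa [sub_eq_add_neg] using h2

/-- Only the rates out of states charged by the solution matter, and only those before the final
time. -/
lemma congr_gen (h : IsForwardSol g s T c v) (hsT : s ≤ T) {g' : ℝ → Matrix E E ℝ}
    (hg : ∀ r ∈ Ioo s T, ∀ z y, v r z * g r z y = v r z * g' r z y) :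
    IsForwardSol g' s T c v where
  integrable z y := by
    refine (h.integrable z y).congr_uIoo fun r hr => ?_
    rw [uIoo_of_le hsT] at hr
    exact hg r hr z y
  eq t ht y := by
    rw [h.eq t ht y]
    congr 1
    refine intervalIntegral.integral_congr_uIoo fun r hr => ?_
    rw [uIoo_of_le ht.1] at hr
    exact Finset.sum_congr rfl fun z _ => hg r ⟨hr.1, hr.2.trans_le ht.2⟩ z y

end IsForwardSol

/-- Grönwall's inequality with zero initial value, for a continuous function. -/
lemma nonpos_of_le_mul_integral {s T K : ℝ} {n : ℝ → ℝ} (hn : ContinuousOn n (Icc s T))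
    (hK : 0 ≤ K) (h : ∀ t ∈ Icc s T, n t ≤ K * ∫ r in s..t, n r) :
    ∀ t ∈ Icc s T, n t ≤ 0 := by
  intro t ht
  have hsT : s ≤ T := ht.1.trans ht.2
  have hint : IntervalIntegrable n volume s T := by
    apply ContinuousOn.intervalIntegrable
    rwa [uIcc_of_le hsT]
  have hF : ContinuousOn (fun t => ∫ r in s..t, n r) (Icc s T) := by
    have := intervalIntegral.continuousOn_primitive_interval' hint left_mem_uIcc
    rwa [uIcc_of_le hsT] at this
  have hderiv : ∀ t ∈ Ioo s T, HasDerivAt (fun t => Real.exp (-(K * t)) * ∫ r in s..t, n r)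
      (Real.exp (-(K * t)) * (n t - K * ∫ r in s..t, n r)) t := by
    intro t ht
    have h1 : HasDerivAt (fun t => ∫ r in s..t, n r) (n t) t := by
      refine intervalIntegral.integral_hasDerivAt_right ?_ ?_ ?_
      · refine hint.mono_set ?_
        rw [uIcc_of_le hsT, uIcc_of_le ht.1.le]
        exact Icc_subset_Icc le_rfl ht.2.le
      · exact (hn.mono Ioo_subset_Icc_self).stronglyMeasurableAtFilter isOpen_Ioo t ht
      · exact hn.continuousAt (Icc_mem_nhds ht.1 ht.2)
    have h2 : HasDerivAt (fun t => Real.exp (-(K * t))) (Real.exp (-(K * t)) * (-(K * 1))) t :=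
      ((hasDerivAt_id t).const_mul K).neg.exp
    exact (h2.mul h1).congr_deriv (by ring)
  have hanti : AntitoneOn (fun t => Real.exp (-(K * t)) * ∫ r in s..t, n r) (Icc s T) := by
    refine antitoneOn_of_deriv_nonpos (convex_Icc s T) (ContinuousOn.mul (by fun_prop) hF) ?_ ?_
    · rw [interior_Icc]
      exact fun t ht => (hderiv t ht).differentiableAt.differentiableWithinAt
    · rw [interior_Icc]
      intro t ht
      rw [(hderiv t ht).deriv]
      exact mul_nonpos_of_nonneg_of_nonpos (Real.exp_pos _).le
        (by linarith [h t (Ioo_subset_Icc_self ht)])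
  have h3 := hanti ⟨le_rfl, hsT⟩ ht ht.1
  simp only [intervalIntegral.integral_same, mul_zero] at h3
  have h4 : ∫ r in s..t, n r ≤ 0 := nonpos_of_mul_nonpos_right h3 (Real.exp_pos _)
  exact (h t ht).trans (mul_nonpos_of_nonneg_of_nonpos hK h4)

/-- Solutions of the forward equation with bounded rates and zero initial value vanish. -/
lemma IsForwardSol.eq_zero {g : ℝ → Matrix E E ℝ} {s T C : ℝ} {v : ℝ → E → ℝ} (hC : 0 ≤ C)
    (hg : ∀ r ∈ Icc s T, ∀ x y, |g r x y| ≤ C) (h : IsForwardSol g s T 0 v) :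
    ∀ t ∈ Icc s T, ∀ y, v t y = 0 := by
  intro t ht y
  have hsT : s ≤ T := ht.1.trans ht.2
  have hn : ContinuousOn (fun t => ∑ y, |v t y|) (Icc s T) :=
    continuousOn_finsetSum _ fun y _ => (h.continuousOn hsT y).abs
  have hle : ∀ t ∈ Icc s T, ∑ y, |v t y| ≤ (Fintype.card E * C) * ∫ r in s..t, ∑ y, |v r y| := by
    intro t ht
    have hint : IntervalIntegrable (fun r => ∑ y, |v r y|) volume s t := by
      apply ContinuousOn.intervalIntegrable
      rw [uIcc_of_le ht.1]
      exact hn.mono (Icc_subset_Icc le_rfl ht.2)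
    have h1 : ∀ y, |v t y| ≤ C * ∫ r in s..t, ∑ y, |v r y| := by
      intro y
      rw [h.eq t ht y, Pi.zero_apply, zero_add, ← intervalIntegral.integral_const_mul]
      refine (intervalIntegral.abs_integral_le_integral_abs ht.1).trans ?_
      refine intervalIntegral.integral_mono_on ht.1
        (h.integrable_sum_on ⟨le_rfl, hsT⟩ ht y).abs (hint.const_mul C) ?_
      intro r hr
      refine (Finset.abs_sum_le_sum_abs _ _).trans ?_
      rw [Finset.mul_sum]
      refine Finset.sum_le_sum fun z _ => ?_
      rw [abs_mul, mul_comm]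
      exact mul_le_mul_of_nonneg_right (hg r ⟨hr.1, hr.2.trans ht.2⟩ z y) (abs_nonneg _)
    refine (Finset.sum_le_sum fun y _ => h1 y).trans ?_
    rw [Finset.sum_const, Finset.card_univ, nsmul_eq_mul, mul_assoc]
  have h0 := nonpos_of_le_mul_integral hn (by positivity) hle t ht
  have h1 : |v t y| ≤ ∑ y, |v t y| :=
    Finset.single_le_sum (f := fun y => |v t y|) (fun _ _ => abs_nonneg _) (Finset.mem_univ y)
  exact abs_nonpos_iff.1 (h1.trans h0)

/-- Minimum principle: the forward equation of a bounded family of rate matrices preserves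
non-negativity. A negative component is followed back to the last time at which it was
non-negative; since then the diagonal rate only pushed it upwards, so that its negative part is
controlled by the integral of the negative parts, and Grönwall's inequality applies. -/
lemma IsForwardSol.nonneg_of_bounded {g : ℝ → Matrix E E ℝ} {s T C : ℝ} {c : E → ℝ}
    {v : ℝ → E → ℝ} (hC : 0 ≤ C)
    (hg : ∀ r ∈ Icc s T, ∀ x y, |g r x y| ≤ C)
    (hoff : ∀ r ∈ Icc s T, ∀ x y, x ≠ y → 0 ≤ g r x y)
    (hdiag : ∀ r ∈ Icc s T, ∀ x, g r x x ≤ 0)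
    (hc : ∀ y, 0 ≤ c y) (h : IsForwardSol g s T c v) :
    ∀ t ∈ Icc s T, ∀ y, 0 ≤ v t y := by
  intro t ht y
  have hsT : s ≤ T := ht.1.trans ht.2
  have hn : ContinuousOn (fun t => ∑ y, max (-v t y) 0) (Icc s T) :=
    continuousOn_finsetSum _ fun y _ =>
      ContinuousOn.sup (h.continuousOn hsT y).neg continuousOn_const
  have hn0 : ∀ t, 0 ≤ ∑ y, max (-v t y) 0 := fun t =>
    Finset.sum_nonneg fun _ _ => le_max_right _ _
  have hle : ∀ t ∈ Icc s T, ∑ y, max (-v t y) 0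
      ≤ (Fintype.card E * C) * ∫ r in s..t, ∑ y, max (-v r y) 0 := by
    intro t ht
    have hint : ∀ a ∈ Icc s t, IntervalIntegrable (fun r => ∑ y, max (-v r y) 0) volume a t := by
      intro a ha
      apply ContinuousOn.intervalIntegrable
      rw [uIcc_of_le ha.2]
      exact hn.mono (Icc_subset_Icc ha.1 ht.2)
    have h1 : ∀ y, max (-v t y) 0 ≤ C * ∫ r in s..t, ∑ y, max (-v r y) 0 := by
      intro y
      have hI : 0 ≤ ∫ r in s..t, ∑ y, max (-v r y) 0 :=
        intervalIntegral.integral_nonneg ht.1 fun r _ => hn0 r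
      refine max_le ?_ (mul_nonneg hC hI)
      by_cases hpos : 0 ≤ v t y
      · linarith [mul_nonneg hC hI]
      have hcont : ContinuousOn (fun r => v r y) (Icc s t) :=
        (h.continuousOn hsT y).mono (Icc_subset_Icc le_rfl ht.2)
      have hcl : IsCompact (Icc s t ∩ (fun r => v r y) ⁻¹' Ici 0) :=
        isCompact_Icc.of_isClosed_subset
          (hcont.preimage_isClosed_of_isClosed isClosed_Icc isClosed_Ici) inter_subset_left
      have hne : (Icc s t ∩ (fun r => v r y) ⁻¹' Ici 0).Nonempty :=
        ⟨s, ⟨le_rfl, ht.1⟩, by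
          change 0 ≤ v s y
          rw [h.initial hsT]
          exact hc y⟩
      obtain ⟨a, ⟨ha, hva⟩, hmax⟩ := hcl.exists_isGreatest hne
      have haT : a ∈ Icc s T := ⟨ha.1, ha.2.trans ht.2⟩
      have hva' : 0 ≤ v a y := hva
      have hneg : ∀ r ∈ Ioc a t, v r y < 0 := by
        intro r hr
        by_contra hcon
        exact absurd (hmax ⟨⟨ha.1.trans hr.1.le, hr.2⟩, not_lt.1 hcon⟩) (not_le.2 hr.1)
      have h2 : -(C * ∫ r in a..t, ∑ y, max (-v r y) 0) ≤ ∫ r in a..t, ∑ z, v r z * g r z y := by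
        rw [← intervalIntegral.integral_const_mul, ← intervalIntegral.integral_neg]
        refine intervalIntegral.integral_mono_on_of_le_Ioo ha.2 ((hint a ha).const_mul C).neg
          (h.integrable_sum_on haT ht y) ?_
        intro r hr
        rw [Finset.mul_sum, ← Finset.sum_neg_distrib]
        have hrT : r ∈ Icc s T := ⟨ha.1.trans hr.1.le, hr.2.le.trans ht.2⟩
        refine Finset.sum_le_sum fun z _ => ?_
        by_cases hzy : z = y
        · subst hzy
          have h3 : 0 ≤ v r z * g r z z :=
            mul_nonneg_of_nonpos_of_nonpos (hneg r ⟨hr.1, hr.2.le⟩).le (hdiag r hrT z)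
          have h4 : 0 ≤ C * max (-v r z) 0 := mul_nonneg hC (le_max_right _ _)
          linarith
        · have h3 := hoff r hrT z y hzy
          have h4 : g r z y ≤ C := (le_abs_self _).trans (hg r hrT z y)
          nlinarith [le_max_left (-v r z) 0, le_max_right (-v r z) 0]
      have h5 : ∫ r in a..t, ∑ y, max (-v r y) 0 ≤ ∫ r in s..t, ∑ y, max (-v r y) 0 := by
        rw [← intervalIntegral.integral_add_adjacent_intervals (a := s) (b := a) (c := t) _
          (hint a ha)]
        · linarith [intervalIntegral.integral_nonneg (μ := volume) ha.1
            (fun r (_ : r ∈ Icc s a) => hn0 r)]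
        · refine (hint s ⟨le_rfl, ht.1⟩).mono_set ?_
          rw [uIcc_of_le ht.1, uIcc_of_le ha.1]
          exact Icc_subset_Icc le_rfl ha.2
      rw [h.restart_eq haT ht y]
      nlinarith [mul_le_mul_of_nonneg_left h5 hC]
    refine (Finset.sum_le_sum fun y _ => h1 y).trans ?_
    rw [Finset.sum_const, Finset.card_univ, nsmul_eq_mul, mul_assoc]
  have h0 := nonpos_of_le_mul_integral hn (by positivity) hle t ht
  have h1 : max (-v t y) 0 ≤ ∑ y, max (-v t y) 0 :=
    Finset.single_le_sum (f := fun y => max (-v t y) 0) (fun _ _ => le_max_right _ _)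
      (Finset.mem_univ y)
  linarith [le_max_left (-v t y) 0]

/-- The terms of the Dyson series of the forward equation started from `c` at time `s`. -/
def dysonTerm (g : ℝ → Matrix E E ℝ) (s : ℝ) (c : E → ℝ) : ℕ → ℝ → E → ℝ
  | 0 => fun _ => c
  | n + 1 => fun t y => ∫ r in s..t, ∑ z, dysonTerm g s c n r z * g r z y

/-- The Dyson series, whose sum solves the forward equation. -/
def dysonSum (g : ℝ → Matrix E E ℝ) (s : ℝ) (c : E → ℝ) (t : ℝ) (y : E) : ℝ :=
  ∑' n, dysonTerm g s c n t y

section Dyson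

variable {g : ℝ → Matrix E E ℝ} {s T C : ℝ}

lemma intervalIntegrable_mul_of_bounded (hsT : s ≤ T) (hm : ∀ x y, Measurable fun t => g t x y)
    (hg : ∀ r ∈ Icc s T, ∀ x y, |g r x y| ≤ C) {f : ℝ → ℝ} (hf : ContinuousOn f (Icc s T))
    (z y : E) : IntervalIntegrable (fun r => f r * g r z y) volume s T := by
  have h1 : IntervalIntegrable (fun r => g r z y) volume s T := by
    rw [intervalIntegrable_iff_integrableOn_Icc_of_le hsT]
    refine Measure.integrableOn_of_bounded (M := C) (by simp) (hm z y).aestronglyMeasurable ?_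
    exact (ae_restrict_iff' measurableSet_Icc).2 (ae_of_all _ fun r hr => hg r hr z y)
  refine h1.continuousOn_mul ?_
  rwa [uIcc_of_le hsT]

lemma continuousOn_dysonTerm (hsT : s ≤ T) (hm : ∀ x y, Measurable fun t => g t x y)
    (hg : ∀ r ∈ Icc s T, ∀ x y, |g r x y| ≤ C) (c : E → ℝ) (n : ℕ) (y : E) :
    ContinuousOn (fun t => dysonTerm g s c n t y) (Icc s T) := by
  induction n generalizing y with
  | zero => exact continuousOn_const
  | succ n ih =>
    have h1 : IntervalIntegrable (fun r => ∑ z, dysonTerm g s c n r z * g r z y) volume s T :=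
      intervalIntegrable_fun_sum _ fun z _ =>
        intervalIntegrable_mul_of_bounded hsT hm hg (ih z) z y
    have h2 := intervalIntegral.continuousOn_primitive_interval' h1 left_mem_uIcc
    rw [uIcc_of_le hsT] at h2
    exact h2

lemma intervalIntegrable_dysonTerm (hsT : s ≤ T) (hm : ∀ x y, Measurable fun t => g t x y)
    (hg : ∀ r ∈ Icc s T, ∀ x y, |g r x y| ≤ C) (c : E → ℝ) (n : ℕ) (y : E) :
    IntervalIntegrable (fun r => ∑ z, dysonTerm g s c n r z * g r z y) volume s T :=
  intervalIntegrable_fun_sum _ fun z _ =>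
    intervalIntegrable_mul_of_bounded hsT hm hg (continuousOn_dysonTerm hsT hm hg c n z) z y

lemma abs_dysonTerm_le (hm : ∀ x y, Measurable fun t => g t x y)
    (hg : ∀ r ∈ Icc s T, ∀ x y, |g r x y| ≤ C) (c : E → ℝ) (n : ℕ) (y : E) :
    ∀ t ∈ Icc s T, |dysonTerm g s c n t y|
      ≤ (∑ y, |c y|) * ((Fintype.card E * C) ^ n * (t - s) ^ n / n.factorial) := by
  induction n generalizing y with
  | zero =>
    intro t _
    simpa [dysonTerm] using Finset.single_le_sum (f := fun y => |c y|) (fun _ _ => abs_nonneg _)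
      (Finset.mem_univ y)
  | succ n ih =>
    intro t ht
    have hint : IntervalIntegrable (fun r => ∑ z, dysonTerm g s c n r z * g r z y) volume s t :=
      intervalIntegrable_dysonTerm ht.1 hm
        (fun r hr => hg r ⟨hr.1, hr.2.trans ht.2⟩) c n y
    have h1 : ∀ r ∈ Icc s t, |∑ z, dysonTerm g s c n r z * g r z y|
        ≤ ((∑ y, |c y|) * ((Fintype.card E * C) ^ (n + 1) / n.factorial)) * (r - s) ^ n := by
      intro r hr
      have hrT : r ∈ Icc s T := ⟨hr.1, hr.2.trans ht.2⟩
      have h2 : ∀ z, |dysonTerm g s c n r z * g r z y|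
          ≤ (∑ y, |c y|) * ((Fintype.card E * C) ^ n * (r - s) ^ n / n.factorial) * C := by
        intro z
        rw [abs_mul]
        exact mul_le_mul (ih z r hrT) (hg r hrT z y) (abs_nonneg _)
          ((abs_nonneg _).trans (ih z r hrT))
      refine (Finset.abs_sum_le_sum_abs _ _).trans ((Finset.sum_le_sum fun z _ => h2 z).trans ?_)
      rw [Finset.sum_const, Finset.card_univ, nsmul_eq_mul]
      apply le_of_eq
      ring
    have h3 : ∫ r in s..t, (r - s) ^ n = (t - s) ^ (n + 1) / (n + 1) := by
      rw [intervalIntegral.integral_comp_sub_right (fun r => r ^ n) s, integral_pow]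
      simp
    change |∫ r in s..t, ∑ z, dysonTerm g s c n r z * g r z y| ≤ _
    refine (intervalIntegral.abs_integral_le_integral_abs ht.1).trans ?_
    refine (intervalIntegral.integral_mono_on ht.1 hint.abs
      (Continuous.intervalIntegrable (by fun_prop) _ _) h1).trans ?_
    rw [intervalIntegral.integral_const_mul, h3, Nat.factorial_succ]
    apply le_of_eq
    push_cast
    field_simp

/-- The Dyson series solves the forward equation as long as the rates are bounded. -/
lemma isForwardSol_dysonSum (hsT : s ≤ T) (hC : 0 ≤ C) (hm : ∀ x y, Measurable fun t => g t x y)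
    (hg : ∀ r ∈ Icc s T, ∀ x y, |g r x y| ≤ C) (c : E → ℝ) :
    IsForwardSol g s T c (dysonSum g s c) := by
  let b : ℕ → ℝ := fun n =>
    (∑ y, |c y|) * ((Fintype.card E * C) ^ n * (T - s) ^ n / n.factorial)
  have hb : Summable b := by
    have := (Real.summable_pow_div_factorial (Fintype.card E * C * (T - s))).mul_left (∑ y, |c y|)
    refine this.congr fun n => ?_
    simp only [b]
    rw [mul_pow (_ * _)]
  have hle : ∀ n, ∀ t ∈ Icc s T, ∀ y, |dysonTerm g s c n t y| ≤ b n := by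
    intro n t ht y
    refine (abs_dysonTerm_le hm hg c n y t ht).trans ?_
    have h1 : (t - s) ^ n ≤ (T - s) ^ n :=
      pow_le_pow_left₀ (by linarith [ht.1]) (by linarith [ht.2]) n
    have h0 : 0 ≤ ∑ y, |c y| := Finset.sum_nonneg fun _ _ => abs_nonneg _
    simp only [b]
    gcongr
  have hsum : ∀ t ∈ Icc s T, ∀ y, HasSum (fun n => dysonTerm g s c n t y) (dysonSum g s c t y) :=
    fun t ht y => (Summable.of_norm_bounded hb fun n => hle n t ht y).hasSum
  have hcont : ∀ y, ContinuousOn (fun t => dysonSum g s c t y) (Icc s T) := fun y =>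
    continuousOn_tsum (fun n => continuousOn_dysonTerm hsT hm hg c n y) hb
      fun n t ht => hle n t ht y
  refine ⟨fun z y => intervalIntegrable_mul_of_bounded hsT hm hg (hcont z) z y, ?_⟩
  intro t ht y
  have h1 : HasSum (fun n => dysonTerm g s c (n + 1) t y)
      (∫ r in s..t, ∑ z, dysonSum g s c r z * g r z y) := by
    refine intervalIntegral.hasSum_integral_of_dominated_convergence
      (F := fun n r => ∑ z, dysonTerm g s c n r z * g r z y)
      (fun n _ => (Fintype.card E * C) * b n) ?_ ?_ ?_ ?_ ?_
    · intro n
      have := (intervalIntegrable_dysonTerm ht.1 hm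
        (fun r hr => hg r ⟨hr.1, hr.2.trans ht.2⟩) c n y).aestronglyMeasurable
      rwa [uIoc_of_le ht.1]
    · intro n
      refine ae_of_all _ fun r hr => ?_
      rw [uIoc_of_le ht.1] at hr
      have hrT : r ∈ Icc s T := ⟨hr.1.le, hr.2.trans ht.2⟩
      rw [Real.norm_eq_abs]
      refine (Finset.abs_sum_le_sum_abs _ _).trans ?_
      have h2 : ∀ z ∈ Finset.univ, |dysonTerm g s c n r z * g r z y| ≤ b n * C := by
        intro z _
        rw [abs_mul]
        exact mul_le_mul (hle n r hrT z) (hg r hrT z y) (abs_nonneg _)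
          ((abs_nonneg _).trans (hle n r hrT z))
      refine (Finset.sum_le_sum h2).trans (le_of_eq ?_)
      rw [Finset.sum_const, Finset.card_univ, nsmul_eq_mul]
      ring
    · exact ae_of_all _ fun r _ => hb.mul_left _
    · exact intervalIntegrable_const
    · refine ae_of_all _ fun r hr => ?_
      rw [uIoc_of_le ht.1] at hr
      exact hasSum_sum fun z _ => (hsum r ⟨hr.1.le, hr.2.trans ht.2⟩ z).mul_right _
  have h2 := (hasSum_nat_add_iff' 1).2 (hsum t ht y)
  simp only [Finset.range_one, Finset.sum_singleton] at h2
  have h3 := h2.unique h1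
  change dysonSum g s c t y - c y = _ at h3
  linarith

end Dyson

end ForwardEquation

/-! ### Transition functions of generators on `[0,1]` -/

section TransitionFunctions

variable {E : Type} [Fintype E] [DecidableEq E]

lemma IsRateMatrix.diag_eq {q : Matrix E E ℝ} (hq : IsRateMatrix q) (x : E) :
    q x x = -∑ y ∈ Finset.univ.erase x, q x y := by
  have h := hq.row_sum x
  rw [← Finset.add_sum_erase _ _ (Finset.mem_univ x)] at h
  linarith

lemma IsRateMatrix.diag_nonpos {q : Matrix E E ℝ} (hq : IsRateMatrix q) (x : E) : q x x ≤ 0 := by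
  rw [hq.diag_eq, neg_nonpos]
  exact Finset.sum_nonneg fun y hy => hq.nonneg x y (Finset.ne_of_mem_erase hy).symm

lemma IsRateMatrix.abs_le_neg_diag {q : Matrix E E ℝ} (hq : IsRateMatrix q) (x y : E) :
    |q x y| ≤ -q x x := by
  by_cases h : x = y
  · subst h
    rw [abs_of_nonpos (hq.diag_nonpos x)]
  · rw [abs_of_nonneg (hq.nonneg x y h), hq.diag_eq, neg_neg]
    exact Finset.single_le_sum (f := fun y => q x y)
      (fun y hy => hq.nonneg x y (Finset.ne_of_mem_erase hy).symm)
      (Finset.mem_erase.2 ⟨Ne.symm h, Finset.mem_univ y⟩)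

variable {g : ℝ → Matrix E E ℝ}

lemma IsGenerator.exists_bound (hg : IsGenerator g) {T : ℝ} (hT : T < 1) :
    ∃ C : ℝ, 0 ≤ C ∧ ∀ r ∈ Icc 0 T, ∀ x y, |g r x y| ≤ C := by
  choose C hC using fun x => hg.stable T hT x
  refine ⟨∑ x, |C x|, Finset.sum_nonneg fun _ _ => abs_nonneg _, fun r hr x y => ?_⟩
  refine ((hg.rate r ⟨hr.1, hr.2.trans hT.le⟩).abs_le_neg_diag x y).trans
    ((hC x r hr).trans ((le_abs_self _).trans ?_))
  exact Finset.single_le_sum (f := fun x => |C x|) (fun _ _ => abs_nonneg _) (Finset.mem_univ x)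

/-- The forward equation of a generator has at most one solution, up to and including time `1`:
before time `1` the rates are bounded, and the value at time `1` is an integral of earlier
values. -/
lemma IsForwardSol.unique (hg : IsGenerator g) {s T : ℝ} {c : E → ℝ} {v v' : ℝ → E → ℝ}
    (hs : 0 ≤ s) (hT : T ≤ 1) (h : IsForwardSol g s T c v) (h' : IsForwardSol g s T c v') :
    ∀ t ∈ Icc s T, ∀ y, v t y = v' t y := by
  have hlt : ∀ t ∈ Icc s T, t < 1 → ∀ y, v t y = v' t y := by
    intro t ht ht1 y
    obtain ⟨C, hC, hb⟩ := hg.exists_bound ht1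
    have h0 := (h.mono ht.1 ht.2).sub_smul ht.1 (h'.mono ht.1 ht.2) 1
    have h1 : (fun y => c y - 1 * c y) = (0 : E → ℝ) := by
      ext y
      simp
    rw [h1] at h0
    have := h0.eq_zero hC (fun r hr => hb r ⟨hs.trans hr.1, hr.2⟩) t ⟨ht.1, le_rfl⟩ y
    linarith
  intro t ht y
  rw [h.eq t ht y, h'.eq t ht y]
  congr 1
  refine intervalIntegral.integral_congr_uIoo fun r hr => ?_
  rw [uIoo_of_le ht.1] at hr
  refine Finset.sum_congr rfl fun z _ => ?_
  rw [hlt r ⟨hr.1.le, hr.2.le.trans ht.2⟩ (by linarith [hr.2, ht.2]) z]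

lemma IsForwardSol.nonneg (hg : IsGenerator g) {s T : ℝ} {c : E → ℝ} {v : ℝ → E → ℝ}
    (hs : 0 ≤ s) (hT : T ≤ 1) (hc : ∀ y, 0 ≤ c y) (h : IsForwardSol g s T c v) :
    ∀ t ∈ Icc s T, ∀ y, 0 ≤ v t y := by
  have hlt : ∀ t ∈ Icc s T, t < 1 → ∀ y, 0 ≤ v t y := by
    intro t ht ht1 y
    obtain ⟨C, hC, hb⟩ := hg.exists_bound ht1
    have hr1 : ∀ r ∈ Icc s t, IsRateMatrix (g r) :=
      fun r hr => hg.rate r ⟨hs.trans hr.1, hr.2.trans ht1.le⟩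
    exact (h.mono ht.1 ht.2).nonneg_of_bounded hC (fun r hr => hb r ⟨hs.trans hr.1, hr.2⟩)
      (fun r hr => (hr1 r hr).nonneg) (fun r hr => (hr1 r hr).diag_nonpos) hc t ⟨ht.1, le_rfl⟩ y
  intro t ht y
  rcases ht.1.eq_or_lt with rfl | hst
  · rw [h.initial ht.2]
    exact hc y
  · have hcl : IsClosed (Icc s t ∩ (fun r => v r y) ⁻¹' Ici 0) :=
      ((h.mono ht.1 ht.2).continuousOn ht.1 y).preimage_isClosed_of_isClosed isClosed_Icc
        isClosed_Ici
    have hsub : Ico s t ⊆ Icc s t ∩ (fun r => v r y) ⁻¹' Ici 0 := fun r hr =>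
      ⟨⟨hr.1, hr.2.le⟩, hlt r ⟨hr.1, hr.2.le.trans ht.2⟩ (by linarith [hr.2, ht.2]) y⟩
    have := hcl.closure_subset_iff.2 hsub
    rw [closure_Ico hst.ne] at this
    exact (this ⟨ht.1, le_rfl⟩).2

lemma IsForwardSol.sum_eq (hg : IsGenerator g) {s T : ℝ} {c : E → ℝ} {v : ℝ → E → ℝ}
    (hs : 0 ≤ s) (hT : T ≤ 1) (h : IsForwardSol g s T c v) {t : ℝ} (ht : t ∈ Icc s T) :
    ∑ y, v t y = ∑ y, c y := by
  simp only [h.eq t ht]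
  rw [Finset.sum_add_distrib, ← intervalIntegral.integral_finsetSum fun y _ =>
    h.integrable_sum_on ⟨le_rfl, ht.1.trans ht.2⟩ ht y, add_eq_left]
  rw [intervalIntegral.integral_congr (g := fun _ => (0 : ℝ))]
  · simp
  · intro r hr
    rw [uIcc_of_le ht.1] at hr
    simp only
    rw [Finset.sum_comm]
    refine Finset.sum_eq_zero fun z _ => ?_
    rw [← Finset.mul_sum, (hg.rate r ⟨hs.trans hr.1, hr.2.trans (ht.2.trans hT)⟩).row_sum,
      mul_zero]

lemma IsTransitionFunction.isForwardSol {p : ℝ → ℝ → Matrix E E ℝ} (hp : IsTransitionFunction g p)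
    {s : ℝ} (hs : 0 ≤ s) (hs1 : s ≤ 1) (x : E) :
    IsForwardSol g s 1 ((1 : Matrix E E ℝ) x) (fun t => p s t x) where
  integrable z y := hp.integrable s 1 hs hs1 le_rfl x z y
  eq t ht y := hp.forward s t hs ht.1 ht.2 x y

lemma IsTransitionFunction.self_eq_one {p : ℝ → ℝ → Matrix E E ℝ} (hp : IsTransitionFunction g p)
    {s : ℝ} (hs : 0 ≤ s) (hs1 : s ≤ 1) : p s s = 1 := by
  ext x y
  exact (hp.isForwardSol hs hs1 x).initial hs1 y

/-- A solution of the forward equation is obtained by integrating its initial value against the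
transition function. -/
lemma IsTransitionFunction.sum_mul_eq {p : ℝ → ℝ → Matrix E E ℝ} (hg : IsGenerator g)
    (hp : IsTransitionFunction g p) {s T : ℝ} (hs : 0 ≤ s) (hT : T ≤ 1) {c : E → ℝ}
    {v : ℝ → E → ℝ} (h : IsForwardSol g s T c v) {t : ℝ} (ht : t ∈ Icc s T) (y : E) :
    ∑ x, c x * p s t x y = v t y := by
  have hsT := ht.1.trans ht.2
  have h1 := IsForwardSol.linear_comb hsT
    (fun x => (hp.isForwardSol hs (hsT.trans hT) x).mono hsT hT) c
  have h2 : (fun y => ∑ x, c x * (1 : Matrix E E ℝ) x y) = c := by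
    ext y
    simp [Matrix.one_apply]
  rw [h2] at h1
  exact h1.unique hg hs hT h t ht y

lemma isTransitionFunction_of_isForwardSol (hg : IsGenerator g) {p : ℝ → ℝ → Matrix E E ℝ}
    (hp : ∀ s, 0 ≤ s → s ≤ 1 → ∀ x,
      IsForwardSol g s 1 ((1 : Matrix E E ℝ) x) (fun t => p s t x)) :
    IsTransitionFunction g p where
  nonneg s t hs hst ht x y := by
    refine (hp s hs (hst.trans ht) x).nonneg hg hs le_rfl (fun y => ?_) t ⟨hst, ht⟩ y
    by_cases h : x = y <;> simp [Matrix.one_apply, h]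
  row_sum s t hs hst ht x := by
    rw [(hp s hs (hst.trans ht) x).sum_eq hg hs le_rfl ⟨hst, ht⟩]
    simp [Matrix.one_apply]
  chapman_kolmogorov s u t hs hsu hut ht := by
    ext x y
    rw [Matrix.mul_apply]
    have hu : 0 ≤ u := hs.trans hsu
    have h1 := IsForwardSol.linear_comb (hut.trans ht) (fun z => hp u hu (hut.trans ht) z)
      (p s u x)
    have h2 : (fun y => ∑ z, p s u x z * (1 : Matrix E E ℝ) z y) = p s u x := by
      ext y
      simp [Matrix.one_apply]
    rw [h2] at h1
    exact ((hp s hs (hsu.trans (hut.trans ht)) x).restart ⟨hsu, hut.trans ht⟩).unique hg hu le_rfl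
      h1 t ⟨hut, ht⟩ y
  integrable s t hs hst ht x z y :=
    (hp s hs (hst.trans ht) x).integrable_on ⟨le_rfl, hst.trans ht⟩ ⟨hst, ht⟩ z y
  forward s t hs hst ht x y := (hp s hs (hst.trans ht) x).eq t ⟨hst, ht⟩ y

lemma isGenerator_const {q : Matrix E E ℝ} (hq : IsRateMatrix q) : IsGenerator fun _ => q where
  rate _ _ := hq
  measurable _ _ := measurable_const
  stable _ _ x := ⟨-q x x, fun _ _ => le_rfl⟩

lemma isTransitionFunction_heat {q : Matrix E E ℝ} (hq : IsRateMatrix q) :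
    IsTransitionFunction (fun _ => q) (fun s t => heat q (t - s)) := by
  refine isTransitionFunction_of_isForwardSol (isGenerator_const hq) fun s hs hs1 x => ⟨?_, ?_⟩
  · intro z y
    exact (((continuous_heat q x z).comp (continuous_id.sub continuous_const)).mul
      continuous_const).intervalIntegrable _ _
  · intro t ht y
    have h := intervalIntegral.integral_eq_sub_of_hasDerivAt (a := s) (b := t)
      (f := fun r => heat q (r - s) x y) (f' := fun r => ∑ z, heat q (r - s) x z * q z y)
      (fun r _ => by simpa using (hasDerivAt_heat q (r - s) x y).comp_sub_const r s)
      (Continuous.intervalIntegrable (continuous_finsetSum _ fun z _ =>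
        ((continuous_heat q x z).comp (continuous_id.sub continuous_const)).mul
          continuous_const) _ _)
    rw [h]
    simp [heat_zero]

/-- Solutions on consecutive intervals can be concatenated. -/
lemma IsForwardSol.concat {s u T : ℝ} {c : E → ℝ} {v v' : ℝ → E → ℝ} (hsu : s ≤ u) (huT : u ≤ T)
    (h : IsForwardSol g s u c v) (h' : IsForwardSol g u T (v u) v') :
    IsForwardSol g s T c (fun t => if t ≤ u then v t else v' t) := by
  have h1 : ∀ t ∈ Icc s u, ∀ y, IntervalIntegrable
      (fun r => ∑ z, (if r ≤ u then v r else v' r) z * g r z y) volume s t ∧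
      ∫ r in s..t, ∑ z, (if r ≤ u then v r else v' r) z * g r z y
        = ∫ r in s..t, ∑ z, v r z * g r z y := by
    intro t ht y
    have he : EqOn (fun r => ∑ z, v r z * g r z y)
        (fun r => ∑ z, (if r ≤ u then v r else v' r) z * g r z y) (uIoo s t) := by
      intro r hr
      rw [uIoo_of_le ht.1] at hr
      simp only [if_pos (hr.2.le.trans ht.2)]
    exact ⟨(h.integrable_sum_on ⟨le_rfl, hsu⟩ ht y).congr_uIoo he,
      (intervalIntegral.integral_congr_uIoo he).symm⟩
  have h2 : ∀ t ∈ Icc u T, ∀ y, IntervalIntegrable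
      (fun r => ∑ z, (if r ≤ u then v r else v' r) z * g r z y) volume u t ∧
      ∫ r in u..t, ∑ z, (if r ≤ u then v r else v' r) z * g r z y
        = ∫ r in u..t, ∑ z, v' r z * g r z y := by
    intro t ht y
    have he : EqOn (fun r => ∑ z, v' r z * g r z y)
        (fun r => ∑ z, (if r ≤ u then v r else v' r) z * g r z y) (uIoo u t) := by
      intro r hr
      rw [uIoo_of_le ht.1] at hr
      simp only [if_neg (not_le.2 hr.1)]
    exact ⟨(h'.integrable_sum_on ⟨le_rfl, huT⟩ ht y).congr_uIoo he,
      (intervalIntegral.integral_congr_uIoo he).symm⟩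
  refine ⟨fun z y => ?_, fun t ht y => ?_⟩
  · refine IntervalIntegrable.trans (b := u) ?_ ?_
    · refine (h.integrable z y).congr_uIoo fun r hr => ?_
      rw [uIoo_of_le hsu] at hr
      simp only [if_pos hr.2.le]
    · refine (h'.integrable z y).congr_uIoo fun r hr => ?_
      rw [uIoo_of_le huT] at hr
      simp only [if_neg (not_le.2 hr.1)]
  · by_cases htu : t ≤ u
    · rw [(h1 t ⟨ht.1, htu⟩ y).2]
      simp only [if_pos htu]
      exact h.eq t ⟨ht.1, htu⟩ y
    · have htu' : u ≤ t := (not_le.1 htu).le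
      rw [← intervalIntegral.integral_add_adjacent_intervals (h1 u ⟨hsu, le_rfl⟩ y).1
        (h2 t ⟨htu', ht.2⟩ y).1, (h1 u ⟨hsu, le_rfl⟩ y).2, (h2 t ⟨htu', ht.2⟩ y).2]
      simp only [if_neg htu]
      rw [h'.eq t ⟨htu', ht.2⟩ y, h.eq u ⟨hsu, le_rfl⟩ y, add_assoc]

/-- A solution on `[s,1)` whose integrands are integrable up to time `1` extends to `[s,1]`. -/
lemma IsForwardSol.extend_one {s : ℝ} (hs1 : s < 1) {c : E → ℝ} {v : ℝ → E → ℝ}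
    (h : ∀ T ∈ Ico s 1, IsForwardSol g s T c v)
    (hint : ∀ z y, IntervalIntegrable (fun r => v r z * g r z y) volume s 1) :
    ∃ v', IsForwardSol g s 1 c v' := by
  refine ⟨fun t => if t < 1 then v t else fun y => c y + ∫ r in s..1, ∑ z, v r z * g r z y,
    fun z y => ?_, fun t ht y => ?_⟩
  · refine (hint z y).congr_uIoo fun r hr => ?_
    rw [uIoo_of_le hs1.le] at hr
    simp only [if_pos hr.2]
  · have h1 : ∫ r in s..t, ∑ z, (if r < 1 then v r else
        fun y => c y + ∫ r in s..1, ∑ z, v r z * g r z y) z * g r z y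
        = ∫ r in s..t, ∑ z, v r z * g r z y := by
      refine intervalIntegral.integral_congr_uIoo fun r hr => ?_
      rw [uIoo_of_le ht.1] at hr
      simp only [if_pos (hr.2.trans_le ht.2)]
    rw [h1]
    rcases ht.2.eq_or_lt with rfl | ht1
    · simp
    · simp only [if_pos ht1]
      exact (h t ⟨ht.1, ht1⟩).eq t ⟨ht.1, le_rfl⟩ y

end TransitionFunctions

/-! ### The projected generator and its forward equation -/

section ProjectedGenerator

variable {E : Type} [Fintype E] [DecidableEq E] [MeasurableSpace E]

lemma transProb_eq_heat (q : Matrix E E ℝ) (s t : ℝ) (y x : E) :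
    transProb q s t y x = heat q (t - s) x y := rfl

/-- The numerator of the score: `∑_{x₀,x₁} p_{1|t}(x₁|y) p_{t|0}(x|x₀) π̃(x₀,x₁)`. On the diagonal
it is the density of the interpolant. -/
def crossDensity (q : Matrix E E ℝ) (π : Measure (E × E)) (t : ℝ) (x y : E) : ℝ :=
  ∑ x₀, ∑ x₁, heat q (1 - t) y x₁ * heat q t x₀ x * tildeCoupling q π x₀ x₁

/-- The probability flux `p^I_t(x) q^M_t(x,y)`, in the form in which it is continuous in time. -/
def flux (q : Matrix E E ℝ) (π : Measure (E × E)) (x y : E) (t : ℝ) : ℝ :=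
  if x = y then -∑ z ∈ Finset.univ.erase x, q x z * crossDensity q π t x z
  else q x y * crossDensity q π t x y

variable (q : Matrix E E ℝ) (π : Measure (E × E))

lemma crossDensity_self (t : ℝ) (x : E) :
    crossDensity q π t x x = interpolantDensity q π t x := by
  unfold crossDensity interpolantDensity
  simp only [transProb_eq_heat, sub_zero]
  exact Finset.sum_congr rfl fun _ _ => Finset.sum_congr rfl fun _ _ => by ring

lemma score_eq (t : ℝ) (x y : E) :
    score q π t x y = crossDensity q π t x y / interpolantDensity q π t x := by
  unfold crossDensity score
  simp only [transProb_eq_heat, sub_zero]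

lemma continuous_crossDensity (x y : E) : Continuous fun t => crossDensity q π t x y :=
  continuous_finsetSum _ fun x₀ _ => continuous_finsetSum _ fun x₁ _ =>
    (((continuous_heat q y x₁).comp (continuous_const.sub continuous_id)).mul
      (continuous_heat q x₀ x)).mul continuous_const

lemma continuous_flux (x y : E) : Continuous (flux q π x y) := by
  unfold flux
  by_cases h : x = y
  · simp only [if_pos h]
    exact (continuous_finsetSum _ fun z _ =>
      continuous_const.mul (continuous_crossDensity q π x z)).neg
  · simp only [if_neg h]
    exact continuous_const.mul (continuous_crossDensity q π x y)

lemma exists_flux_bound : ∃ C : ℝ, 0 ≤ C ∧ ∀ t ∈ Icc (0 : ℝ) 1, ∀ x y, |flux q π x y t| ≤ C := by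
  choose C hC using fun p : E × E => isCompact_Icc.exists_bound_of_continuousOn
    (continuous_flux q π p.1 p.2).continuousOn (s := Icc (0 : ℝ) 1)
  refine ⟨∑ p, |C p|, Finset.sum_nonneg fun _ _ => abs_nonneg _, fun t ht x y => ?_⟩
  refine (hC (x, y) t ht).trans ((le_abs_self _).trans ?_)
  exact Finset.single_le_sum (f := fun p => |C p|) (fun _ _ => abs_nonneg _)
    (Finset.mem_univ (x, y))

/-- The Kolmogorov equation of the density, written with the flux. -/
lemma hasDerivAt_interpolantDensity (y : E) (t : ℝ) :
    HasDerivAt (fun t => interpolantDensity q π t y) (∑ z, flux q π z y t) t := by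
  have h1 : ∀ x₀ x₁, HasDerivAt
      (fun t => heat q (1 - t) y x₁ * heat q t x₀ y * tildeCoupling q π x₀ x₁)
      (∑ z, (q z y * (heat q (1 - t) y x₁ * heat q t x₀ z * tildeCoupling q π x₀ x₁)
        - q y z * (heat q (1 - t) z x₁ * heat q t x₀ y * tildeCoupling q π x₀ x₁))) t := by
    intro x₀ x₁
    have h2 : HasDerivAt (fun t => heat q (1 - t) y x₁)
        (-∑ z, q y z * heat q (1 - t) z x₁) t := by
      simpa using (hasDerivAt_heat' q (1 - t) y x₁).comp_const_sub 1 t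
    refine ((h2.mul (hasDerivAt_heat q t x₀ y)).mul_const _).congr_deriv ?_
    rw [Finset.sum_sub_distrib, neg_mul, Finset.sum_mul, Finset.mul_sum, add_mul, neg_mul,
      Finset.sum_mul, Finset.sum_mul, neg_add_eq_sub]
    congr 1 <;> exact Finset.sum_congr rfl fun z _ => by ring
  have h2 := HasDerivAt.fun_sum fun x₀ (_ : x₀ ∈ Finset.univ) =>
    HasDerivAt.fun_sum fun x₁ (_ : x₁ ∈ Finset.univ) => h1 x₀ x₁
  have h3 : (fun t => interpolantDensity q π t y) = fun t => ∑ x₀, ∑ x₁,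
      heat q (1 - t) y x₁ * heat q t x₀ y * tildeCoupling q π x₀ x₁ := by
    ext t
    rw [← crossDensity_self]
    rfl
  rw [h3]
  refine h2.congr_deriv ?_
  have h4 : ∑ x₀, ∑ x₁, ∑ z,
      (q z y * (heat q (1 - t) y x₁ * heat q t x₀ z * tildeCoupling q π x₀ x₁)
        - q y z * (heat q (1 - t) z x₁ * heat q t x₀ y * tildeCoupling q π x₀ x₁))
      = ∑ z, (q z y * crossDensity q π t z y - q y z * crossDensity q π t y z) := by
    simp only [crossDensity, Finset.mul_sum, ← Finset.sum_sub_distrib]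
    symm
    rw [Finset.sum_comm]
    refine Finset.sum_congr rfl fun x₀ _ => ?_
    rw [Finset.sum_comm]
  rw [h4, ← Finset.add_sum_erase _ _ (Finset.mem_univ y), sub_self, zero_add,
    ← Finset.add_sum_erase _ (fun z => flux q π z y t) (Finset.mem_univ y)]
  have h5 : ∀ z ∈ Finset.univ.erase y, flux q π z y t = q z y * crossDensity q π t z y :=
    fun z hz => if_neg (Finset.ne_of_mem_erase hz)
  rw [Finset.sum_congr rfl h5, Finset.sum_sub_distrib, flux, if_pos rfl]
  ring

variable {q}

lemma IsRateMatrix.tildeCoupling_nonneg (hq : IsRateMatrix q) (x₀ x₁ : E) :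
    0 ≤ tildeCoupling q π x₀ x₁ :=
  div_nonneg measureReal_nonneg (hq.heat_nonneg (by norm_num) x₀ x₁)

lemma IsRateMatrix.crossDensity_term_nonneg (hq : IsRateMatrix q) {t : ℝ} (ht : t ∈ Icc (0 : ℝ) 1)
    (x y x₀ x₁ : E) :
    0 ≤ heat q (1 - t) y x₁ * heat q t x₀ x * tildeCoupling q π x₀ x₁ :=
  mul_nonneg (mul_nonneg (hq.heat_nonneg (by linarith [ht.2]) _ _) (hq.heat_nonneg ht.1 _ _))
    (hq.tildeCoupling_nonneg π _ _)

lemma IsRateMatrix.crossDensity_nonneg (hq : IsRateMatrix q) {t : ℝ} (ht : t ∈ Icc (0 : ℝ) 1)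
    (x y : E) : 0 ≤ crossDensity q π t x y :=
  Finset.sum_nonneg fun _ _ => Finset.sum_nonneg fun _ _ => hq.crossDensity_term_nonneg π ht _ _ _ _

lemma IsRateMatrix.interpolantDensity_nonneg (hq : IsRateMatrix q) {t : ℝ}
    (ht : t ∈ Icc (0 : ℝ) 1) (x : E) : 0 ≤ interpolantDensity q π t x := by
  rw [← crossDensity_self]
  exact hq.crossDensity_nonneg π ht x x

lemma IsRateMatrix.interpolantDensity_eq_zero_iff (hq : IsRateMatrix q) {t : ℝ}
    (ht : t ∈ Icc (0 : ℝ) 1) (x : E) : interpolantDensity q π t x = 0 ↔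
      ∀ x₀ x₁, heat q (1 - t) x x₁ * heat q t x₀ x * tildeCoupling q π x₀ x₁ = 0 := by
  rw [← crossDensity_self, crossDensity, Finset.sum_eq_zero_iff_of_nonneg fun _ _ =>
    Finset.sum_nonneg fun _ _ => hq.crossDensity_term_nonneg π ht _ _ _ _]
  simp only [Finset.mem_univ, true_imp_iff]
  refine forall_congr' fun x₀ => ?_
  rw [Finset.sum_eq_zero_iff_of_nonneg fun _ _ => hq.crossDensity_term_nonneg π ht _ _ _ _]
  simp

/-- The set of states charged by the interpolant is the same at all times in `(0,1)`. -/
lemma IsRateMatrix.interpolantDensity_eq_zero_of (hq : IsRateMatrix q) {s t : ℝ}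
    (hs : s ∈ Ioo (0 : ℝ) 1) (ht : t ∈ Ioo (0 : ℝ) 1) {x : E}
    (h : interpolantDensity q π s x = 0) : interpolantDensity q π t x = 0 := by
  rw [hq.interpolantDensity_eq_zero_iff π (Ioo_subset_Icc_self hs)] at h
  rw [hq.interpolantDensity_eq_zero_iff π (Ioo_subset_Icc_self ht)]
  intro x₀ x₁
  have h1 := h x₀ x₁
  have e1 := (hq.heat_eq_zero_iff (sub_pos.2 hs.2) x x₁).trans
    (hq.heat_eq_zero_iff (sub_pos.2 ht.2) x x₁).symm
  have e2 := (hq.heat_eq_zero_iff hs.1 x₀ x).trans (hq.heat_eq_zero_iff ht.1 x₀ x).symm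
  rw [mul_eq_zero, mul_eq_zero] at h1 ⊢
  rwa [← e1, ← e2]

/-- The projected rates are bounded away from time `1`. -/
lemma IsRateMatrix.exists_rate_mul_crossDensity_le (hq : IsRateMatrix q) {T : ℝ} (hT : T < 1) :
    ∃ C : ℝ, 0 ≤ C ∧ ∀ t ∈ Icc 0 T, ∀ x y, x ≠ y →
      q x y * crossDensity q π t x y ≤ C * interpolantDensity q π t x := by
  obtain ⟨C, hC, h⟩ := hq.exists_rate_mul_heat_le (sub_pos.2 hT)
  refine ⟨C, hC, fun t ht x y hxy => ?_⟩
  rw [← crossDensity_self, crossDensity, crossDensity, Finset.mul_sum, Finset.mul_sum]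
  refine Finset.sum_le_sum fun x₀ _ => ?_
  rw [Finset.mul_sum, Finset.mul_sum]
  refine Finset.sum_le_sum fun x₁ _ => ?_
  have hs : 1 - t ∈ Icc (1 - T) 1 := ⟨by linarith [ht.2], by linarith [ht.1]⟩
  have h1 := mul_le_mul_of_nonneg_right (h (1 - t) hs x y x₁ hxy)
    (mul_nonneg (hq.heat_nonneg ht.1 x₀ x) (hq.tildeCoupling_nonneg π x₀ x₁))
  linarith

/-- No flux leaves a state that is not charged. -/
lemma IsRateMatrix.rate_mul_crossDensity_eq_zero (hq : IsRateMatrix q) {t : ℝ}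
    (ht : t ∈ Ico (0 : ℝ) 1) {x y : E} (hxy : x ≠ y) (h : interpolantDensity q π t x = 0) :
    q x y * crossDensity q π t x y = 0 := by
  obtain ⟨C, -, hC⟩ := hq.exists_rate_mul_crossDensity_le π ht.2
  have h1 := hC t ⟨ht.1, le_rfl⟩ x y hxy
  rw [h, mul_zero] at h1
  exact le_antisymm h1 (mul_nonneg (hq.nonneg x y hxy)
    (hq.crossDensity_nonneg π (Ico_subset_Icc_self ht) x y))

lemma projGenerator_of_ne (q : Matrix E E ℝ) (t : ℝ) {x y : E} (h : x ≠ y) :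
    projGenerator q π t x y = q x y * score q π t x y := by
  simp [projGenerator, h]

lemma projGenerator_self (q : Matrix E E ℝ) (t : ℝ) (x : E) :
    projGenerator q π t x x = -∑ z ∈ Finset.univ.erase x, q x z * score q π t x z := by
  simp [projGenerator]

/-- The flux is the density times the projected rate, also where the density vanishes: there the
projected rate is `0` by convention, and the flux vanishes as well. -/
lemma IsRateMatrix.density_mul_projGenerator (hq : IsRateMatrix q) {t : ℝ}
    (ht : t ∈ Ico (0 : ℝ) 1) (x y : E) :
    interpolantDensity q π t x * projGenerator q π t x y = flux q π x y t := by
  have h1 : ∀ y, x ≠ y → interpolantDensity q π t x * (q x y * score q π t x y)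
      = q x y * crossDensity q π t x y := by
    intro y hxy
    rw [score_eq]
    by_cases h0 : interpolantDensity q π t x = 0
    · rw [h0, zero_mul, hq.rate_mul_crossDensity_eq_zero π ht hxy h0]
    · field_simp
  unfold flux
  split_ifs with h
  · subst h
    rw [projGenerator_self, mul_neg, Finset.mul_sum]
    congr 1
    exact Finset.sum_congr rfl fun z hz => h1 z (Finset.ne_of_mem_erase hz).symm
  · rw [projGenerator_of_ne π q t h, h1 y h]

lemma IsRateMatrix.isRateMatrix_projGenerator (hq : IsRateMatrix q) {t : ℝ}
    (ht : t ∈ Icc (0 : ℝ) 1) : IsRateMatrix (projGenerator q π t) where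
  nonneg x y h := by
    rw [projGenerator_of_ne π q t h, score_eq]
    exact mul_nonneg (hq.nonneg x y h)
      (div_nonneg (hq.crossDensity_nonneg π ht x y) (hq.interpolantDensity_nonneg π ht x))
  row_sum x := by
    rw [← Finset.add_sum_erase _ _ (Finset.mem_univ x), projGenerator_self, neg_add_eq_zero]
    exact Finset.sum_congr rfl fun z hz =>
      (projGenerator_of_ne π q t (Finset.ne_of_mem_erase hz).symm).symm

lemma measurable_score (q : Matrix E E ℝ) (x y : E) : Measurable fun t => score q π t x y := by
  simp only [score_eq, ← crossDensity_self]
  exact (continuous_crossDensity q π x y).measurable.div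
    (continuous_crossDensity q π x x).measurable

lemma IsRateMatrix.isGenerator_projGenerator (hq : IsRateMatrix q) :
    IsGenerator (projGenerator q π) where
  rate _ ht := hq.isRateMatrix_projGenerator π ht
  measurable x y := by
    by_cases h : x = y
    · subst h
      simp only [projGenerator_self]
      exact (Finset.measurable_fun_sum _ fun z _ => (measurable_score π q x z).const_mul _).neg
    · simp only [projGenerator_of_ne π q _ h]
      exact (measurable_score π q x y).const_mul _
  stable T hT x := by
    obtain ⟨C, hC, h⟩ := hq.exists_rate_mul_crossDensity_le π hT
    refine ⟨Fintype.card E * C, fun t ht => ?_⟩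
    have ht1 : t ∈ Icc (0 : ℝ) 1 := ⟨ht.1, ht.2.trans hT.le⟩
    have h1 : ∀ z ∈ Finset.univ.erase x, q x z * score q π t x z ≤ C := by
      intro z hz
      rw [score_eq, ← mul_div_assoc]
      exact div_le_of_le_mul₀ (hq.interpolantDensity_nonneg π ht1 x) hC
        (h t ht x z (Finset.ne_of_mem_erase hz).symm)
    rw [projGenerator_self, neg_neg]
    refine (Finset.sum_le_sum h1).trans ?_
    rw [Finset.sum_const, nsmul_eq_mul]
    gcongr
    exact Finset.card_le_univ _

/-- The density of the interpolant solves the forward equation of the projected generator. -/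
lemma IsRateMatrix.isForwardSol_interpolantDensity (hq : IsRateMatrix q) :
    IsForwardSol (projGenerator q π) 0 1 (interpolantDensity q π 0) (interpolantDensity q π) where
  integrable z y := by
    refine ((continuous_flux q π z y).intervalIntegrable 0 1).congr_uIoo fun r hr => ?_
    rw [uIoo_of_le zero_le_one] at hr
    exact (hq.density_mul_projGenerator π (Ioo_subset_Ico_self hr) z y).symm
  eq t ht y := by
    have h1 := intervalIntegral.integral_eq_sub_of_hasDerivAt (a := 0) (b := t)
      (fun r _ => hasDerivAt_interpolantDensity q π y r)
      (Continuous.intervalIntegrable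
        (continuous_finsetSum _ fun z _ => continuous_flux q π z y) _ _)
    rw [intervalIntegral.integral_congr_uIoo (g := fun r => ∑ z, flux q π z y r), h1]
    · ring
    · intro r hr
      rw [uIoo_of_le ht.1] at hr
      exact Finset.sum_congr rfl fun z _ =>
        hq.density_mul_projGenerator π ⟨hr.1.le, hr.2.trans_le ht.2⟩ z y

/-- A chain started from a charged state is dominated by the interpolant. -/
lemma IsRateMatrix.density_mul_le (hq : IsRateMatrix q) {s T : ℝ} (hs : 0 ≤ s) (hT : T ≤ 1)
    {x : E} {v : ℝ → E → ℝ}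
    (hv : IsForwardSol (projGenerator q π) s T ((1 : Matrix E E ℝ) x) v) {t : ℝ}
    (ht : t ∈ Icc s T) (y : E) :
    interpolantDensity q π s x * v t y ≤ interpolantDensity q π t y := by
  have hsT := ht.1.trans ht.2
  have h1 := (((hq.isForwardSol_interpolantDensity π).restart
    ⟨hs, hsT.trans hT⟩).mono hsT hT).sub_smul hsT hv (interpolantDensity q π s x)
  have h2 := h1.nonneg (hq.isGenerator_projGenerator π) hs hT (fun y => ?_) t ht y
  · linarith
  · by_cases h : x = y
    · rw [h, Matrix.one_apply_eq, mul_one, sub_self]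
    · simpa [Matrix.one_apply, h] using hq.interpolantDensity_nonneg π ⟨hs, hsT.trans hT⟩ y

/-- The chain with the projected generator does not explode at time `1`, although its rates may be
unbounded there: started from a charged state it is dominated by the interpolant, whose flux is
bounded, and all other states are absorbing. -/
lemma IsRateMatrix.exists_isForwardSol_one (hq : IsRateMatrix q) {s : ℝ} (hs : s ∈ Ioo (0 : ℝ) 1)
    (x : E) : ∃ v, IsForwardSol (projGenerator q π) s 1 ((1 : Matrix E E ℝ) x) v := by
  have hg := hq.isGenerator_projGenerator π
  by_cases h0 : interpolantDensity q π s x = 0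
  · have hz : ∀ r ∈ Ioo s 1, ∀ z y, (1 : Matrix E E ℝ) x z * projGenerator q π r z y = 0 := by
      intro r hr z y
      by_cases hxz : x = z
      · subst hxz
        have hr0 := hq.interpolantDensity_eq_zero_of π hs ⟨hs.1.trans hr.1, hr.2⟩ h0
        have hsc : ∀ w, score q π r x w = 0 := fun w => by rw [score_eq, hr0, div_zero]
        by_cases hxy : x = y
        · subst hxy
          simp [projGenerator_self, hsc]
        · simp [projGenerator_of_ne π q r hxy, hsc]
      · simp [hxz]
    refine ⟨fun _ => (1 : Matrix E E ℝ) x, fun z y => ?_, fun t ht y => ?_⟩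
    · refine (intervalIntegrable_const (c := (0 : ℝ))).congr_uIoo fun r hr => ?_
      rw [uIoo_of_le hs.2.le] at hr
      exact (hz r hr z y).symm
    · rw [intervalIntegral.integral_congr_uIoo (g := fun _ => (0 : ℝ))]
      · simp
      · intro r hr
        rw [uIoo_of_le ht.1] at hr
        exact Finset.sum_eq_zero fun z _ => hz r ⟨hr.1, hr.2.trans_le ht.2⟩ z y
  · have hpos : 0 < interpolantDensity q π s x := lt_of_le_of_ne
      (hq.interpolantDensity_nonneg π (Ioo_subset_Icc_self hs) x) (Ne.symm h0)
    have hsol : ∀ T ∈ Ico s 1, IsForwardSol (projGenerator q π) s T ((1 : Matrix E E ℝ) x)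
        (dysonSum (projGenerator q π) s ((1 : Matrix E E ℝ) x)) := by
      intro T hT
      obtain ⟨C, hC, hb⟩ := hg.exists_bound hT.2
      exact isForwardSol_dysonSum hT.1 hC hg.measurable
        (fun r hr => hb r ⟨hs.1.le.trans hr.1, hr.2⟩) _
    refine IsForwardSol.extend_one hs.2 hsol fun z y => ?_
    obtain ⟨C, hC, hb⟩ := exists_flux_bound q π
    rw [intervalIntegrable_iff_integrableOn_Ioo_of_le hs.2.le]
    refine Integrable.of_bound ?_ (C / interpolantDensity q π s x) ?_
    · have hc : ContinuousOn
          (fun t => dysonSum (projGenerator q π) s ((1 : Matrix E E ℝ) x) t z) (Ioo s 1) := by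
        intro t ht
        have hT : (t + 1) / 2 ∈ Ico s 1 := ⟨by linarith [ht.1, ht.2], by linarith [ht.2]⟩
        have h1 := (hsol _ hT).continuousOn hT.1 z
        exact (h1.continuousAt (Icc_mem_nhds ht.1 (by linarith [ht.2]))).continuousWithinAt
      exact (hc.aestronglyMeasurable measurableSet_Ioo).mul (hg.measurable z y).aestronglyMeasurable
    · refine (ae_restrict_iff' measurableSet_Ioo).2 (ae_of_all _ fun r hr => ?_)
      have h1 := hsol r ⟨hr.1.le, hr.2⟩
      have h2 := hq.density_mul_le π hs.1.le hr.2.le h1 ⟨hr.1.le, le_rfl⟩ z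
      have h3 := h1.nonneg hg hs.1.le hr.2.le
        (fun y => by by_cases h : x = y <;> simp [Matrix.one_apply, h]) r ⟨hr.1.le, le_rfl⟩ z
      have hr0 : r ∈ Ico (0 : ℝ) 1 := ⟨hs.1.le.trans hr.1.le, hr.2⟩
      have h4 := hb r (Ico_subset_Icc_self hr0) z y
      rw [← hq.density_mul_projGenerator π hr0, abs_mul,
        abs_of_nonneg (hq.interpolantDensity_nonneg π (Ico_subset_Icc_self hr0) z)] at h4
      rw [Real.norm_eq_abs, abs_mul, abs_of_nonneg h3, le_div_iff₀ hpos]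
      refine le_trans ?_ h4
      rw [mul_right_comm]
      refine mul_le_mul_of_nonneg_right ?_ (abs_nonneg _)
      rwa [mul_comm]

lemma IsRateMatrix.exists_isForwardSol (hq : IsRateMatrix q) {s : ℝ} (hs : 0 ≤ s) (hs1 : s ≤ 1)
    (x : E) : ∃ v, IsForwardSol (projGenerator q π) s 1 ((1 : Matrix E E ℝ) x) v := by
  have hg := hq.isGenerator_projGenerator π
  rcases hs1.eq_or_lt with rfl | hs1
  · refine ⟨fun _ => (1 : Matrix E E ℝ) x, fun z y => IntervalIntegrable.refl, fun t ht y => ?_⟩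
    rw [le_antisymm ht.2 ht.1]
    simp
  rcases hs.eq_or_lt with rfl | hs0
  -- A state not charged at time `0` may be charged later, so that domination is of no use there.
  -- The chain is run up to time `1 / 2`, where the rates are bounded, and restarted.
  · obtain ⟨C, hC, hb⟩ := hg.exists_bound (T := 1 / 2) (by norm_num)
    have h1 := isForwardSol_dysonSum (s := 0) (T := 1 / 2) (by norm_num) hC hg.measurable hb
      ((1 : Matrix E E ℝ) x)
    choose w hw using fun z => hq.exists_isForwardSol_one π (s := 1 / 2) (by norm_num) z
    have h2 := IsForwardSol.linear_comb (by norm_num) hw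
      (dysonSum (projGenerator q π) 0 ((1 : Matrix E E ℝ) x) (1 / 2))
    refine ⟨_, h1.concat (by norm_num) (by norm_num) (v' := fun t y =>
      ∑ z, dysonSum (projGenerator q π) 0 ((1 : Matrix E E ℝ) x) (1 / 2) z * w z t y) ?_⟩
    convert h2 using 1
    ext y
    simp [Matrix.one_apply]
  · exact hq.exists_isForwardSol_one π ⟨hs0, hs1⟩ x

lemma IsRateMatrix.exists_isTransitionFunction (hq : IsRateMatrix q) :
    ∃ p, IsTransitionFunction (projGenerator q π) p := by
  choose! v hv using fun (s : ℝ) (hs : 0 ≤ s ∧ s ≤ 1) (x : E) =>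
    hq.exists_isForwardSol π hs.1 hs.2 x
  exact ⟨fun s t => Matrix.of fun x y => v s x t y,
    isTransitionFunction_of_isForwardSol (hq.isGenerator_projGenerator π)
      fun s hs hs1 x => hv s ⟨hs, hs1⟩ x⟩

/-- Under the marginals of the interpolant, the chain leaves its state within time `t - s` with
probability `O(t - s)`, uniformly up to time `1`. -/
lemma IsRateMatrix.exists_density_mul_one_sub_le (hq : IsRateMatrix q)
    {p : ℝ → ℝ → Matrix E E ℝ} (hp : IsTransitionFunction (projGenerator q π) p) :
    ∃ C : ℝ, 0 ≤ C ∧ ∀ s t, 0 ≤ s → s ≤ t → t ≤ 1 → ∀ x,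
      interpolantDensity q π s x * (1 - p s t x x) ≤ C * (t - s) := by
  obtain ⟨C, hC, hb⟩ := exists_flux_bound q π
  have hg := hq.isGenerator_projGenerator π
  refine ⟨C, hC, fun s t hs hst ht x => ?_⟩
  have hint := (hp.isForwardSol hs (hst.trans ht) x).integrable_sum_on ⟨le_rfl, hst.trans ht⟩
    ⟨hst, ht⟩ x
  have h1 : ∫ r in s..t, -C ≤ ∫ r in s..t, interpolantDensity q π s x *
      ∑ z, p s r x z * projGenerator q π r z x := by
    refine intervalIntegral.integral_mono_on_of_le_Ioo hst intervalIntegrable_const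
      (hint.const_mul _) fun r hr => ?_
    have hr1 : r < 1 := hr.2.trans_le ht
    have hr0 : r ∈ Ico (0 : ℝ) 1 := ⟨hs.trans hr.1.le, hr1⟩
    have hrate := hg.rate r (Ico_subset_Icc_self hr0)
    have hd : 0 ≤ interpolantDensity q π s x :=
      hq.interpolantDensity_nonneg π ⟨hs, hst.trans ht⟩ x
    have h2 := hq.density_mul_le π hs le_rfl (hp.isForwardSol hs (hst.trans ht) x)
      ⟨hr.1.le, hr1.le⟩ x
    have h3 : p s r x x * projGenerator q π r x x ≤ ∑ z, p s r x z * projGenerator q π r z x := by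
      rw [← Finset.add_sum_erase _ _ (Finset.mem_univ x)]
      refine le_add_of_nonneg_right (Finset.sum_nonneg fun z hz => mul_nonneg
        (hp.nonneg s r hs hr.1.le hr1.le x z) (hrate.nonneg z x (Finset.ne_of_mem_erase hz)))
    -- Up to time `r` the chain is dominated by the interpolant, so the mass leaving `x` is at most
    -- the flux of the interpolant out of `x`.
    have h4 := (abs_le.1 (hb r (Ico_subset_Icc_self hr0) x x)).1
    rw [← hq.density_mul_projGenerator π hr0] at h4
    have h5 := mul_le_mul_of_nonpos_right h2 (hrate.diag_nonpos x)
    have h6 := mul_le_mul_of_nonneg_left h3 hd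
    change -C ≤ interpolantDensity q π s x * ∑ z, p s r x z * projGenerator q π r z x
    linarith [mul_assoc (interpolantDensity q π s x) (p s r x x) (projGenerator q π r x x)]
  rw [intervalIntegral.integral_const_mul, intervalIntegral.integral_const, smul_eq_mul] at h1
  rw [hp.forward s t hs hst ht x x, Matrix.one_apply_eq]
  linarith

end ProjectedGenerator

/-! ### Markov laws on the space of all paths -/

section FiniteTimes

variable {E : Type} [Fintype E] [DecidableEq E] [MeasurableSpace E] [MeasurableSingletonClass E]

/-- The event `S` depends on the path up to time `s` only. -/
def DependsUpTo (s : unitInterval) (S : Set (unitInterval → E)) : Prop :=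
  ∀ w w' : unitInterval → E, (∀ u ≤ s, w u = w' u) → (w ∈ S ↔ w' ∈ S)

lemma DependsUpTo.mono {s t : unitInterval} (hst : s ≤ t) {S : Set (unitInterval → E)}
    (h : DependsUpTo s S) : DependsUpTo t S :=
  fun w w' hw => h w w' fun u hu => hw u (hu.trans hst)

lemma DependsUpTo.inter {s : unitInterval} {S S' : Set (unitInterval → E)}
    (h : DependsUpTo s S) (h' : DependsUpTo s S') : DependsUpTo s (S ∩ S') :=
  fun w w' hw => and_congr (h w w' hw) (h' w w' hw)

lemma dependsUpTo_eval {s t : unitInterval} (hst : s ≤ t) (x : E) :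
    DependsUpTo t {w : unitInterval → E | w s = x} := by
  intro w w' hw
  simp only [mem_ofPred_eq, hw s hst]

/-- The path `w` switched to the constant state `y` from time `a` on. -/
def switch (a : unitInterval) (y : E) (w : unitInterval → E) : unitInterval → E :=
  fun u => if u < a then w u else y

lemma measurable_switch (a : unitInterval) (y : E) : Measurable (switch a y) := by
  refine measurable_pi_lambda _ fun u => ?_
  unfold switch
  by_cases h : u < a
  · simpa only [if_pos h] using measurable_pi_apply u
  · simpa only [if_neg h] using measurable_const

lemma switch_preimage {s a : unitInterval} (hsa : s < a) (y : E) {S : Set (unitInterval → E)}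
    (hS : DependsUpTo s S) : switch a y ⁻¹' S = S := by
  ext w
  refine hS _ _ fun u hu => ?_
  simp [switch, hu.trans_lt hsa]

lemma measurableSet_eval (s : unitInterval) (x : E) :
    MeasurableSet {w : unitInterval → E | w s = x} :=
  (measurableSet_singleton x).preimage (measurable_pi_apply s)

/-- Partitioning an event according to the state at time `s`. -/
lemma sum_measure_inter_eval (P : Measure (unitInterval → E)) (S : Set (unitInterval → E))
    (s : unitInterval) : ∑ x, P (S ∩ {w | w s = x}) = P S := by
  have h := MeasureTheory.sum_measure_preimage_singleton (μ := P.restrict S) Finset.univ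
    (f := fun w : unitInterval → E => w s) fun x _ => measurableSet_eval s x
  rw [Finset.coe_univ, preimage_univ, Measure.restrict_apply_univ] at h
  rw [← h]
  refine Finset.sum_congr rfl fun x _ => ?_
  rw [inter_comm]
  exact (Measure.restrict_apply (measurableSet_eval s x)).symm

/-- The law `P` of a path, continued from its state at time `m` by a jump at time `a` with
transition matrix `k`. -/
def continueLaw (P : Measure (unitInterval → E)) (m a : unitInterval) (k : Matrix E E ℝ) :
    Measure (unitInterval → E) :=
  ∑ x, ∑ y, ENNReal.ofReal (k x y) • (P.restrict {w | w m = x}).map (switch a y)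

lemma continueLaw_apply (P : Measure (unitInterval → E)) (m a : unitInterval) (k : Matrix E E ℝ)
    {S : Set (unitInterval → E)} (hS : MeasurableSet S) :
    continueLaw P m a k S
      = ∑ x, ∑ y, ENNReal.ofReal (k x y) * P (switch a y ⁻¹' S ∩ {w | w m = x}) := by
  simp only [continueLaw, Measure.finsetSum_apply, Measure.smul_apply, smul_eq_mul]
  refine Finset.sum_congr rfl fun x _ => Finset.sum_congr rfl fun y _ => ?_
  rw [Measure.map_apply (measurable_switch a y) hS,
    Measure.restrict_apply (measurable_switch a y hS)]

lemma continueLaw_apply_of_dependsUpTo (P : Measure (unitInterval → E)) {m a s : unitInterval}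
    {k : Matrix E E ℝ} (hk : ∀ x y, 0 ≤ k x y) (hk1 : ∀ x, ∑ y, k x y = 1) (hsa : s < a)
    {S : Set (unitInterval → E)} (hS : MeasurableSet S) (hd : DependsUpTo s S) :
    continueLaw P m a k S = P S := by
  rw [continueLaw_apply P m a k hS, ← sum_measure_inter_eval P S m]
  refine Finset.sum_congr rfl fun x _ => ?_
  simp only [switch_preimage hsa _ hd]
  rw [← Finset.sum_mul, ← ENNReal.ofReal_sum_of_nonneg fun y _ => hk x y, hk1, ENNReal.ofReal_one,
    one_mul]

lemma continueLaw_apply_inter_eval (P : Measure (unitInterval → E)) {m a s : unitInterval}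
    (k : Matrix E E ℝ) (hsa : s < a) {S : Set (unitInterval → E)} (hS : MeasurableSet S)
    (hd : DependsUpTo s S) (y : E) :
    continueLaw P m a k (S ∩ {w | w a = y})
      = ∑ x, ENNReal.ofReal (k x y) * P (S ∩ {w | w m = x}) := by
  rw [continueLaw_apply P m a k (hS.inter (measurableSet_eval a y))]
  refine Finset.sum_congr rfl fun x _ => ?_
  rw [Finset.sum_eq_single y]
  · rw [preimage_inter, switch_preimage hsa _ hd]
    congr 2
    ext w
    simp [switch]
  · intro z _ hz
    have : switch a z ⁻¹' (S ∩ {w | w a = y}) = ∅ := by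
      ext w
      simp [switch, hz]
    simp [this]
  · simp

/-- The Markov property for the transition function `p`, restricted to times in `F`. The past of `s`
is described by the events which depend on the path up to time `s` only. -/
def IsMarkovAt (p : ℝ → ℝ → Matrix E E ℝ) (F : Set unitInterval)
    (P : Measure (unitInterval → E)) : Prop :=
  ∀ s ∈ F, ∀ t ∈ F, s ≤ t → ∀ S : Set (unitInterval → E), MeasurableSet S → DependsUpTo s S →
    ∀ x y, P (S ∩ {w | w s = x} ∩ {w | w t = y})
      = P (S ∩ {w | w s = x}) * ENNReal.ofReal (p s t x y)

lemma inter_eval_self (P : Measure (unitInterval → E)) (S : Set (unitInterval → E))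
    (s : unitInterval) (x y : E) : P (S ∩ {w | w s = x} ∩ {w | w s = y})
      = P (S ∩ {w | w s = x}) * ENNReal.ofReal ((1 : Matrix E E ℝ) x y) := by
  by_cases h : x = y
  · subst h
    rw [inter_assoc, inter_self]
    simp
  · have : S ∩ {w | w s = x} ∩ {w | w s = y} = ∅ := by
      ext w
      simp only [mem_inter_iff, mem_ofPred_eq, mem_empty_iff_false, iff_false, not_and]
      rintro ⟨-, rfl⟩
      exact h
    rw [this]
    simp [Matrix.one_apply_ne h]

/-- A Markov chain on finitely many times. -/
lemma IsTransitionFunction.exists_isMarkovAt_finset {g : ℝ → Matrix E E ℝ}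
    {p : ℝ → ℝ → Matrix E E ℝ} (hp : IsTransitionFunction g p) (μ : Measure E)
    [IsProbabilityMeasure μ] (F : Finset unitInterval) :
    ∃ P : Measure (unitInterval → E), IsProbabilityMeasure P ∧ (∀ x, P {w | w 0 = x} = μ {x}) ∧
      IsMarkovAt p F P := by
  induction F using Finset.induction_on_max with
  | empty =>
    have hm : Measurable fun (x : E) (_ : unitInterval) => x :=
      measurable_pi_lambda _ fun _ => measurable_id
    refine ⟨μ.map fun x _ => x, Measure.isProbabilityMeasure_map hm.aemeasurable, fun x => ?_,
      fun s hs => by simp at hs⟩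
    rw [Measure.map_apply hm (measurableSet_eval 0 x)]
    rfl
  | insert a F ha ih =>
    obtain ⟨P, hP, h0, hM⟩ := ih
    rcases F.eq_empty_or_nonempty with rfl | hF
    · refine ⟨P, hP, h0, ?_⟩
      intro s hs t ht _ S _ _ x y
      simp only [insert_empty_eq, Finset.coe_singleton, mem_singleton_iff] at hs ht
      obtain rfl : s = t := hs.trans ht.symm
      rw [hp.self_eq_one s.2.1 s.2.2]
      exact inter_eval_self P S s x y
    -- A new last time `a` is added by a jump out of the state at the previous last time `m`.
    · set m := F.max' hF with hm
      have hmF : m ∈ F := F.max'_mem hF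
      have hma : m < a := ha m hmF
      have hk : ∀ x y, 0 ≤ p m a x y := hp.nonneg m a m.2.1 hma.le a.2.2
      have hk1 : ∀ x, ∑ y, p m a x y = 1 := hp.row_sum m a m.2.1 hma.le a.2.2
      have h0a : (0 : unitInterval) < a := lt_of_le_of_lt m.2.1 hma
      refine ⟨continueLaw P m a (p m a), ⟨?_⟩, fun x => ?_, ?_⟩
      · rw [continueLaw_apply_of_dependsUpTo P hk hk1 h0a MeasurableSet.univ fun _ _ _ => by simp]
        exact measure_univ
      · rw [continueLaw_apply_of_dependsUpTo P hk hk1 h0a (measurableSet_eval 0 x)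
          (dependsUpTo_eval le_rfl x), h0]
      · intro s hs t ht hst S hS hd x y
        have hSx := hd.inter (dependsUpTo_eval (le_refl s) x)
        have hSm := hS.inter (measurableSet_eval s x)
        rcases Finset.mem_insert.1 ht with rfl | htF
        · rcases Finset.mem_insert.1 hs with rfl | hsF
          · rw [hp.self_eq_one s.2.1 s.2.2]
            exact inter_eval_self _ S s x y
          · have hsm : s ≤ m := F.le_max' s hsF
            rw [continueLaw_apply_inter_eval P _ (ha s hsF) hSm hSx,
              continueLaw_apply_of_dependsUpTo P hk hk1 (ha s hsF) hSm hSx,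
              hp.chapman_kolmogorov s m t s.2.1 hsm hma.le t.2.2, Matrix.mul_apply,
              ENNReal.ofReal_sum_of_nonneg fun z _ =>
                mul_nonneg (hp.nonneg s m s.2.1 hsm m.2.2 x z) (hk z y), Finset.mul_sum]
            refine Finset.sum_congr rfl fun z _ => ?_
            rw [hM s hsF m hmF hsm S hS hd x z,
              ENNReal.ofReal_mul (hp.nonneg s m s.2.1 hsm m.2.2 x z)]
            ring
        · have hta := ha t htF
          have hsF : s ∈ F := by
            rcases Finset.mem_insert.1 hs with rfl | hsF
            · exact absurd hst (not_le.2 hta)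
            · exact hsF
          rw [continueLaw_apply_of_dependsUpTo P hk hk1 hta (hSm.inter (measurableSet_eval t y))
              ((hSx.mono hst).inter (dependsUpTo_eval le_rfl y)),
            continueLaw_apply_of_dependsUpTo P hk hk1 (ha s hsF) hSm hSx]
          exact hM s hsF t htF hst S hS hd x y

end FiniteTimes

section Limit

variable {E : Type} [Fintype E] [MeasurableSpace E] [MeasurableSingletonClass E]

/-- For finite state spaces, laws of paths can be passed to the limit along an ultrafilter: the
limits on cylinders are additive, hence countably additive since cylinders are open and compact. -/
lemma exists_measure_tendsto_cylinders {ι I : Type} (U : Ultrafilter ι)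
    (P : ι → Measure (I → E)) : ∃ Q : Measure (I → E), ∀ S ∈ measurableCylinders fun _ : I => E,
      Tendsto (fun i => P i S) U (𝓝 (Q S)) := by
  let m : Set (I → E) → ENNReal := fun S => (U.map fun i => P i S).lim
  have hm : ∀ S, Tendsto (fun i => P i S) U (𝓝 (m S)) := fun S =>
    (U.map fun i => P i S).le_nhds_lim
  have hadd : ∀ {S S' : Set (I → E)}, S ∈ measurableCylinders (fun _ : I => E) →
      S' ∈ measurableCylinders (fun _ : I => E) → Disjoint S S' → m (S ∪ S') = m S + m S' := by
    intro S S' _ hS' hd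
    refine tendsto_nhds_unique (hm (S ∪ S')) (((hm S).add (hm S')).congr fun i => ?_)
    exact (measure_union hd (MeasurableSet.of_mem_measurableCylinders hS')).symm
  let M : AddContent ENNReal (measurableCylinders fun _ : I => E) :=
    isSetRing_measurableCylinders.addContent_of_union m
      (tendsto_nhds_unique (hm ∅) (by simp)) hadd
  have hsub : M.IsSigmaSubadditive := by
    let _ : TopologicalSpace E := ⊥
    have : DiscreteTopology E := ⟨rfl⟩
    intro f hf hU
    have hopen : ∀ S ∈ measurableCylinders (fun _ : I => E), IsOpen S := by
      intro S hS
      obtain ⟨J, B, -, rfl⟩ := (mem_measurableCylinders S).1 hS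
      exact (isOpen_discrete B).preimage (by fun_prop)
    have hclosed : IsClosed (⋃ i, f i) :=
      ⟨hopen _ (compl_mem_measurableCylinders hU)⟩
    obtain ⟨K, hK⟩ := hclosed.isCompact.elim_finite_subcover f (fun i => hopen _ (hf i)) subset_rfl
    calc M (⋃ i, f i) ≤ M (⋃ i ∈ K, f i) :=
          addContent_mono isSetSemiring_measurableCylinders hU
            (isSetRing_measurableCylinders.biUnion_mem K fun i _ => hf i) hK
      _ ≤ ∑ i ∈ K, M (f i) :=
          addContent_biUnion_le isSetRing_measurableCylinders fun i _ => hf i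
      _ ≤ ∑' i, M (f i) := ENNReal.sum_le_tsum K
  refine ⟨M.measure isSetSemiring_measurableCylinders
    generateFrom_measurableCylinders.symm.le hsub, fun S hS => ?_⟩
  rw [M.measure_eq isSetSemiring_measurableCylinders generateFrom_measurableCylinders.symm hsub hS]
  exact hm S

end Limit

section AllTimes

variable {E : Type} [Fintype E] [DecidableEq E] [MeasurableSpace E] [MeasurableSingletonClass E]

lemma forall_mem_measurableCylinders {I : Type} (J : Finset I) (B : I → Set E) :
    {w : I → E | ∀ u ∈ J, w u ∈ B u} ∈ measurableCylinders fun _ : I => E := by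
  rw [mem_measurableCylinders]
  refine ⟨J, {w | ∀ u : J, w u ∈ B u}, (Set.toFinite _).measurableSet, ?_⟩
  ext w
  simp [cylinder]

lemma eval_mem_measurableCylinders {I : Type} (s : I) (x : E) :
    {w : I → E | w s = x} ∈ measurableCylinders fun _ : I => E := by
  have h := forall_mem_measurableCylinders {s} fun _ => ({x} : Set E)
  simpa using h

/-- A law on all (not necessarily càdlàg) paths with given initial law and transition function. -/
lemma IsTransitionFunction.exists_pathLaw {g : ℝ → Matrix E E ℝ}
    {p : ℝ → ℝ → Matrix E E ℝ} (hp : IsTransitionFunction g p) (μ : Measure E)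
    [IsProbabilityMeasure μ] :
    ∃ P : Measure (unitInterval → E), IsProbabilityMeasure P ∧ (∀ x, P {w | w 0 = x} = μ {x}) ∧
      ∀ s t : unitInterval, s ≤ t → ∀ (J : Finset unitInterval) (B : unitInterval → Set E),
        (∀ u ∈ J, u ≤ s) → ∀ x y,
        P ({w | ∀ u ∈ J, w u ∈ B u} ∩ {w | w s = x} ∩ {w | w t = y})
          = P ({w | ∀ u ∈ J, w u ∈ B u} ∩ {w | w s = x}) * ENNReal.ofReal (p s t x y) := by
  choose P hP h0 hM using hp.exists_isMarkovAt_finset μ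
  let U : Ultrafilter (Finset unitInterval) := Ultrafilter.of atTop
  obtain ⟨Q, hQ⟩ := exists_measure_tendsto_cylinders U P
  refine ⟨Q, ⟨?_⟩, fun x => ?_, ?_⟩
  · refine tendsto_nhds_unique (hQ univ (univ_mem_measurableCylinders _)) ?_
    exact tendsto_const_nhds.congr fun F => ((hP F).measure_univ).symm
  · refine tendsto_nhds_unique (hQ _ (eval_mem_measurableCylinders 0 x)) ?_
    exact tendsto_const_nhds.congr fun F => (h0 F x).symm
  · intro s t hst J B hJ x y
    have hc := inter_mem_measurableCylinders (forall_mem_measurableCylinders J B)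
      (eval_mem_measurableCylinders s x)
    have h1 := hQ _ (inter_mem_measurableCylinders hc (eval_mem_measurableCylinders t y))
    have h2 := ENNReal.Tendsto.mul_const (b := ENNReal.ofReal (p s t x y)) (hQ _ hc)
      (Or.inr ENNReal.ofReal_ne_top)
    refine tendsto_nhds_unique (h1.congr' ?_) h2
    have hev : ∀ᶠ F in (U : Filter (Finset unitInterval)), {s, t} ⊆ F :=
      (eventually_ge_atTop {s, t}).filter_mono (Ultrafilter.of_le atTop)
    filter_upwards [hev] with F hF
    refine hM F s (hF (by simp)) t (hF (by simp)) hst _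
      (MeasurableSet.of_mem_measurableCylinders (forall_mem_measurableCylinders J B)) ?_ x y
    intro w w' hw
    simp only [mem_ofPred_eq]
    exact forall₂_congr fun u hu => by rw [hw u (hJ u hu)]

end AllTimes

/-! ### Càdlàg modifications -/

section Regularization

variable {E : Type} [Fintype E]

/-- A numbering of the states, through which real-valued variation applies to paths in `E`. -/
def code (x : E) : ℝ := ((Fintype.equivFin E x : ℕ) : ℝ)

lemma eq_of_abs_code_sub_lt {x y : E} (h : |code x - code y| < 1) : x = y := by
  unfold code at h
  have h1 : |(((Fintype.equivFin E x : ℕ) : ℤ) - ((Fintype.equivFin E y : ℕ) : ℤ) : ℤ)| < 1 := by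
    exact_mod_cast h
  rw [Int.abs_lt_one_iff, sub_eq_zero] at h1
  exact (Fintype.equivFin E).injective (Fin.ext (by exact_mod_cast h1))

lemma edist_code_le (x y : E) : edist (code x) (code y) ≤ (Fintype.card E : ENNReal) := by
  have h1 := (Fintype.equivFin E x).2
  have h2 := (Fintype.equivFin E y).2
  rw [edist_dist, Real.dist_eq, ← ENNReal.ofReal_natCast]
  refine ENNReal.ofReal_le_ofReal (abs_le.2 ⟨?_, ?_⟩)
  · have : ((Fintype.equivFin E y : ℕ) : ℝ) ≤ Fintype.card E := by exact_mod_cast h2.le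
    unfold code
    linarith [Nat.cast_nonneg (α := ℝ) (Fintype.equivFin E x : ℕ)]
  · have : ((Fintype.equivFin E x : ℕ) : ℝ) ≤ Fintype.card E := by exact_mod_cast h1.le
    unfold code
    linarith [Nat.cast_nonneg (α := ℝ) (Fintype.equivFin E y : ℕ)]

/-- The total variation of the path `w` along the set of times `D`. It depends on the numbering of
the states, but whether it is finite does not. -/
def pathVariation (D : Set unitInterval) (w : unitInterval → E) : ENNReal :=
  eVariationOn (fun t => code (w t)) D

lemma pathVariation_range (D : ℕ → unitInterval) (w : unitInterval → E) :
    pathVariation (range D) w = ⨆ n, pathVariation ((Finset.range n).image D) w := by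
  refine le_antisymm ?_ (iSup_le fun n => eVariationOn.mono _ ?_)
  · unfold pathVariation
    rw [eVariationOn]
    refine iSup_le ?_
    rintro ⟨k, u, hu, hmem⟩
    choose i hi using fun j => hmem j
    obtain ⟨n, hn⟩ : ∃ n, ∀ j ∈ Finset.range (k + 1), i j < n := by
      refine ⟨(Finset.range (k + 1)).sup i + 1, fun j hj => ?_⟩
      exact Nat.lt_succ_of_le (Finset.le_sup (f := i) hj)
    refine le_trans ?_ (le_iSup _ n)
    refine eVariationOn.sum_le_of_monotoneOn_Iic (hu.monotoneOn _) fun j hj => ?_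
    change u j ∈ _
    rw [← hi j, Finset.coe_image]
    exact mem_image_of_mem D (by
      simpa using hn j (Finset.mem_range.2 (Nat.lt_succ_of_le hj)))
  · intro t ht
    simp only [Finset.coe_image] at ht
    obtain ⟨i, -, rfl⟩ := ht
    exact mem_range_self i

variable [MeasurableSpace E] [MeasurableSingletonClass E]

lemma measurable_code : Measurable (code : E → ℝ) := measurable_of_finite _

/-- If the path changes its state between times `s ≤ t` with probability at most `C (t - s)`, then
its expected variation along any finite set of times is bounded. -/
lemma measurable_and_lintegral_pathVariation_le {P : Measure (unitInterval → E)} {C : ℝ}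
    (hC : 0 ≤ C)
    (h : ∀ s t : unitInterval, s ≤ t → P {w | w s ≠ w t} ≤ ENNReal.ofReal (C * (t - s)))
    (F : Finset unitInterval) :
    Measurable (fun w : unitInterval → E => pathVariation F w) ∧
      ∀ a : unitInterval, (∀ x ∈ F, x ≤ a) →
        ∫⁻ w, pathVariation F w ∂P ≤ Fintype.card E * ENNReal.ofReal (C * a) := by
  have hsingle : ∀ (a : unitInterval) (w : unitInterval → E), pathVariation {a} w = 0 :=
    fun a w => eVariationOn.subsingleton _ subsingleton_singleton
  induction F using Finset.induction_on_max with
  | empty =>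
    have h0 : ∀ w : unitInterval → E, pathVariation (∅ : Finset unitInterval) w = 0 :=
      fun w => eVariationOn.subsingleton _ (by simp)
    simp only [h0]
    exact ⟨measurable_const, fun _ _ => by simp⟩
  | insert a F ha ih =>
    rcases F.eq_empty_or_nonempty with rfl | hF
    · simp only [insert_empty_eq, Finset.coe_singleton, hsingle]
      exact ⟨measurable_const, fun _ _ => by simp⟩
    · set m := F.max' hF with hm
      have hma : m < a := ha m (F.max'_mem hF)
      have heq : ∀ w : unitInterval → E, pathVariation (insert a F : Finset unitInterval) w
          = pathVariation F w + edist (code (w m)) (code (w a)) := by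
        intro w
        have h1 := eVariationOn.union' (fun t => code (w t)) (F.isGreatest_max' hF)
          (isLeast_singleton (a := a)) hma.le
        have h2 := hsingle a w
        unfold pathVariation at h2 ⊢
        rw [Finset.coe_insert, insert_eq, union_comm, h1, h2, add_zero]
      have hme : Measurable fun w : unitInterval → E => edist (code (w m)) (code (w a)) :=
        (measurable_code.comp (measurable_pi_apply m)).edist
          (measurable_code.comp (measurable_pi_apply a))
      simp only [heq]
      refine ⟨ih.1.add hme, fun b hb => ?_⟩
      have hab : a ≤ b := hb a (Finset.mem_insert_self a F)
      have hne : MeasurableSet {w : unitInterval → E | w m ≠ w a} :=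
        (measurableSet_eq_fun (measurable_pi_apply m) (measurable_pi_apply a)).compl
      have h1 : ∫⁻ w, edist (code (w m)) (code (w a)) ∂P
          ≤ Fintype.card E * ENNReal.ofReal (C * (a - m)) := by
        calc ∫⁻ w, edist (code (w m)) (code (w a)) ∂P
            ≤ ∫⁻ w, {w : unitInterval → E | w m ≠ w a}.indicator
                (fun _ => (Fintype.card E : ENNReal)) w ∂P := by
              refine lintegral_mono fun w => ?_
              by_cases hw : w m = w a
              · simp [hw]
              · rw [indicator_of_mem (by exact hw)]
                exact edist_code_le _ _
          _ = Fintype.card E * P {w | w m ≠ w a} := by rw [lintegral_indicator_const hne]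
          _ ≤ _ := by gcongr; exact h m a hma.le
      rw [lintegral_add_left ih.1]
      calc _ ≤ Fintype.card E * ENNReal.ofReal (C * m)
            + Fintype.card E * ENNReal.ofReal (C * (a - m)) :=
            add_le_add (ih.2 m fun x hx => F.le_max' x hx) h1
        _ = Fintype.card E * ENNReal.ofReal (C * a) := by
            rw [← mul_add, ← ENNReal.ofReal_add (mul_nonneg hC m.2.1)
              (mul_nonneg hC (sub_nonneg.2 hma.le))]
            congr 2
            ring
        _ ≤ _ := by
            gcongr

lemma measurable_pathVariation (D : ℕ → unitInterval) :
    Measurable (fun w : unitInterval → E => pathVariation (range D) w) := by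
  simp only [pathVariation_range]
  refine Measurable.iSup fun n => ?_
  exact (measurable_and_lintegral_pathVariation_le (P := 0) (C := 0) le_rfl (by simp)
    ((Finset.range n).image D)).1

lemma ae_pathVariation_lt_top {P : Measure (unitInterval → E)} {C : ℝ}
    (hC : 0 ≤ C)
    (h : ∀ s t : unitInterval, s ≤ t → P {w | w s ≠ w t} ≤ ENNReal.ofReal (C * (t - s)))
    (D : ℕ → unitInterval) : ∀ᵐ w ∂P, pathVariation (range D) w < ⊤ := by
  refine ae_lt_top (measurable_pathVariation D) ?_
  simp only [pathVariation_range]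
  rw [lintegral_iSup fun n =>
    (measurable_and_lintegral_pathVariation_le hC h ((Finset.range n).image D)).1]
  · refine ne_top_of_le_ne_top (b := Fintype.card E * ENNReal.ofReal (C * (1 : unitInterval)))
      (ENNReal.mul_ne_top (by simp) (by simp)) (iSup_le fun n => ?_)
    exact (measurable_and_lintegral_pathVariation_le hC h _).2 1 fun x _ => x.2.2
  · intro i j hij w
    refine eVariationOn.mono _ ?_
    exact_mod_cast Finset.image_subset_image (Finset.range_mono hij)

/-- A filter along which the code of a path converges is one along which the path is eventually
constant. -/
lemma exists_eventually_eq_of_tendsto_code {w : unitInterval → E} {L : Filter unitInterval} {l : ℝ}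
    (h : Tendsto (fun t => code (w t)) L (𝓝 l)) : ∃ x, ∀ᶠ u in L, w u = x := by
  rcases L.eq_or_neBot with rfl | hL
  · exact ⟨w 0, by simp⟩
  · have h1 : ∀ᶠ u in L, |code (w u) - l| < 1 / 2 := by
      have := Metric.tendsto_nhds.1 h (1 / 2) (by norm_num)
      simpa [Real.dist_eq] using this
    obtain ⟨u₀, hu₀⟩ := h1.exists
    refine ⟨w u₀, h1.mono fun u hu => eq_of_abs_code_sub_lt ?_⟩
    rw [abs_lt] at hu hu₀ ⊢
    constructor <;> linarith [hu.1, hu.2, hu₀.1, hu₀.2]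

/-- The right limits of `w` along `D`; at time `1`, and where there is no right limit, the value of
`w` itself. -/
def rightLimits (D : Set unitInterval) (w : unitInterval → E) (t : unitInterval) : E :=
  open Classical in
  if h : t < 1 ∧ ∃ x, ∀ᶠ u in 𝓝[D ∩ Ioi t] t, w u = x then h.2.choose else w t

lemma nhdsWithin_inter_Ioi_neBot {D : Set unitInterval} (hD : Dense D) {t : unitInterval}
    (ht : t < 1) : (𝓝[D ∩ Ioi t] t).NeBot := by
  rw [← mem_closure_iff_nhdsWithin_neBot]
  have h1 : Ioi t ⊆ closure (Ioi t ∩ D) := hD.open_subset_closure_inter isOpen_Ioi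
  have h2 : closure (Ioi t) = Ici t := closure_Ioi' ⟨1, ht⟩
  have h3 := closure_minimal h1 isClosed_closure
  rw [h2, inter_comm] at h3
  exact h3 self_mem_Ici

variable {D : Set unitInterval} {w : unitInterval → E}

lemma rightLimits_eq (hD : Dense D) {t : unitInterval} (ht : t < 1) {x : E}
    (h : ∀ᶠ u in 𝓝[D ∩ Ioi t] t, w u = x) : rightLimits D w t = x := by
  have h' : t < 1 ∧ ∃ x, ∀ᶠ u in 𝓝[D ∩ Ioi t] t, w u = x := ⟨ht, x, h⟩
  have := nhdsWithin_inter_Ioi_neBot hD ht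
  rw [rightLimits, dif_pos h']
  obtain ⟨u, hu, hu'⟩ := (h.and h'.2.choose_spec).exists
  exact hu'.symm.trans hu

lemma eventually_eq_rightLimits (hD : Dense D) (hw : pathVariation D w < ⊤) {t : unitInterval}
    (ht : t < 1) : ∀ᶠ u in 𝓝[D ∩ Ioi t] t, w u = rightLimits D w t := by
  have hbv : BoundedVariationOn (fun t => code (w t)) D := hw.ne
  obtain ⟨l, hl⟩ := hbv.exists_tendsto_right t
  obtain ⟨x, hx⟩ := exists_eventually_eq_of_tendsto_code hl
  rwa [rightLimits_eq hD ht hx]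

lemma rightLimits_eq_of_forall_Ioo (hD : Dense D) {a b t : unitInterval} {x : E}
    (h : ∀ u ∈ D, u ∈ Ioo a b → w u = x) (hat : a ≤ t) (htb : t < b) :
    rightLimits D w t = x := by
  refine rightLimits_eq hD (htb.trans_le b.2.2) ?_
  filter_upwards [self_mem_nhdsWithin, mem_nhdsWithin_of_mem_nhds (Iio_mem_nhds htb)] with u hu hub
  exact h u hu.1 ⟨hat.trans_lt hu.2, hub⟩

/-- The right limits of a path with finite variation form a càdlàg path. -/
lemma isCadlag_rightLimits (hD : Dense D) (hw : pathVariation D w < ⊤) :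
    IsCadlag (rightLimits D w) := by
  refine ⟨fun t => ?_, fun t => ?_⟩
  · rcases (show t ≤ 1 from t.2.2).eq_or_lt with rfl | ht
    · have : (Ioi (1 : unitInterval)) = ∅ := by
        ext u
        simpa using (show u ≤ 1 from u.2.2)
      rw [this, nhdsWithin_empty]
      exact eventually_bot
    · have h := eventually_nhdsWithin_iff.1 (eventually_eq_rightLimits hD hw ht)
      obtain ⟨b, hb, hsub⟩ := exists_Ico_subset_of_mem_nhds h ⟨1, ht⟩
      filter_upwards [Ioo_mem_nhdsGT hb] with u hu
      refine rightLimits_eq_of_forall_Ioo hD (a := t) (b := b) ?_ hu.1.le hu.2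
      exact fun v hv hvI => hsub ⟨hvI.1.le, hvI.2⟩ ⟨hv, hvI.1⟩
  · rcases (show 0 ≤ t from t.2.1).eq_or_lt with rfl | ht
    · have : (Iio (0 : unitInterval)) = ∅ := by
        ext u
        simp
      rw [this, nhdsWithin_empty]
      exact ⟨w 0, eventually_bot⟩
    · have hbv : BoundedVariationOn (fun t => code (w t)) D := hw.ne
      obtain ⟨l, hl⟩ := hbv.exists_tendsto_left t
      obtain ⟨x, hx⟩ := exists_eventually_eq_of_tendsto_code hl
      obtain ⟨a, ha, hsub⟩ :=
        exists_Ioc_subset_of_mem_nhds (eventually_nhdsWithin_iff.1 hx) ⟨0, ht⟩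
      refine ⟨x, ?_⟩
      filter_upwards [Ioo_mem_nhdsLT ha] with u hu
      refine rightLimits_eq_of_forall_Ioo hD (a := a) (b := t) ?_ hu.1.le hu.2
      exact fun v hv hvI => hsub ⟨hvI.1, hvI.2.le⟩ ⟨hv, hvI.2⟩

/-- A random path that changes its state between times `s ≤ t` with probability at most `C (t - s)`
has a càdlàg modification. -/
lemma exists_cadlag_modification {P : Measure (unitInterval → E)} [IsProbabilityMeasure P] {C : ℝ}
    (hC : 0 ≤ C)
    (h : ∀ s t : unitInterval, s ≤ t → P {w | w s ≠ w t} ≤ ENNReal.ofReal (C * (t - s))) :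
    ∃ Y : (unitInterval → E) → PathSpace E, Measurable Y ∧
      ∀ t, ∀ᵐ w ∂P, eval t (Y w) = w t := by
  classical
  let d : ℕ → unitInterval := TopologicalSpace.denseSeq unitInterval
  have hD : Dense (range d) := TopologicalSpace.denseRange_denseSeq unitInterval
  obtain ⟨w₀⟩ : Nonempty (unitInterval → E) := nonempty_of_isProbabilityMeasure P
  let Y : (unitInterval → E) → PathSpace E := fun w =>
    if hw : pathVariation (range d) w < ⊤ then ⟨rightLimits (range d) w, isCadlag_rightLimits hD hw⟩
    -- On the null set of paths of infinite variation, an arbitrary constant path.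
    else ⟨fun _ => w₀ 0, fun _ => Eventually.of_forall fun _ => rfl,
      fun _ => ⟨w₀ 0, Eventually.of_forall fun _ => rfl⟩⟩
  have hG : MeasurableSet {w : unitInterval → E | pathVariation (range d) w < ⊤} :=
    measurableSet_lt (measurable_pathVariation d) measurable_const
  have hY : ∀ w, pathVariation (range d) w < ⊤ → ∀ t, (Y w).1 t = rightLimits (range d) w t := by
    intro w hw t
    simp only [Y, dif_pos hw]
  have hY' : ∀ w, ¬ pathVariation (range d) w < ⊤ → ∀ t, (Y w).1 t = w₀ 0 := by
    intro w hw t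
    simp only [Y, dif_neg hw]
  have hseq : ∀ t : unitInterval, t < 1 → ∃ u : ℕ → unitInterval, (∀ n, t ≤ u n) ∧
      Tendsto u atTop (𝓝 t) ∧ ∀ w : unitInterval → E, pathVariation (range d) w < ⊤ →
        ∀ᶠ n in atTop, w (u n) = rightLimits (range d) w t := by
    intro t ht
    have := nhdsWithin_inter_Ioi_neBot hD ht
    obtain ⟨u, hu⟩ := exists_seq_forall_of_frequently
      (p := fun u : unitInterval => u ∈ range d ∩ Ioi t) (l := 𝓝[range d ∩ Ioi t] t)
      (Eventually.frequently self_mem_nhdsWithin)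
    exact ⟨u, fun n => (hu.2 n).2.le, hu.1.mono_right nhdsWithin_le_nhds,
      fun w hw => hu.1.eventually (eventually_eq_rightLimits hD hw ht)⟩
  refine ⟨Y, ?_, fun t => ?_⟩
  · refine Measurable.subtype_mk (measurable_pi_lambda _ fun t => ?_) (h := fun w => (Y w).2)
    refine measurable_to_countable' fun x => ?_
    rcases (show t ≤ 1 from t.2.2).eq_or_lt with rfl | ht
    · have hset : (fun w => (Y w).1 1) ⁻¹' {x}
          = {w | pathVariation (range d) w < ⊤}.ite {w | w 1 = x} {_w | w₀ 0 = x} := by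
        ext w
        by_cases hw : pathVariation (range d) w < ⊤
        · simp [Set.ite, hw, hY w hw, rightLimits]
        · simp [Set.ite, hw, hY' w hw]
      rw [hset]
      exact hG.ite ((measurableSet_singleton x).preimage (measurable_pi_apply 1))
        (MeasurableSet.const _)
    · obtain ⟨u, -, -, hu⟩ := hseq t ht
      have hset : (fun w => (Y w).1 t) ⁻¹' {x}
          = {w | pathVariation (range d) w < ⊤}.ite (⋃ n, ⋂ k, {w | w (u (n + k)) = x})
              {_w | w₀ 0 = x} := by
        ext w
        by_cases hw : pathVariation (range d) w < ⊤
        · have h1 := hu w hw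
          obtain ⟨n, hn⟩ := eventually_atTop.1 h1
          have : rightLimits (range d) w t = x ↔ ∃ n, ∀ k, w (u (n + k)) = x := by
            constructor
            · rintro rfl
              exact ⟨n, fun k => hn _ (Nat.le_add_right n k)⟩
            · rintro ⟨n', hn'⟩
              rw [← hn (n' + n) (Nat.le_add_left n n'), hn']
          simp [Set.ite, hw, hY w hw, this]
        · simp [Set.ite, hw, hY' w hw]
      rw [hset]
      exact hG.ite (MeasurableSet.iUnion fun n => MeasurableSet.iInter fun k =>
        (measurableSet_singleton x).preimage (measurable_pi_apply _)) (MeasurableSet.const _)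
  -- Along times of `D` decreasing to `t`, the path is eventually constant with the right limit as
  -- value, but it differs from `w t` with probability tending to `0`.
  · have hae := ae_pathVariation_lt_top hC h d
    rcases (show t ≤ 1 from t.2.2).eq_or_lt with rfl | ht
    · filter_upwards [hae] with w hw
      simp [eval, hY w hw, rightLimits]
    · obtain ⟨u, hut, hlim, hu⟩ := hseq t ht
      have hnull : ∀ n, P (⋂ k, {w | w t ≠ w (u (n + k))}) = 0 := by
        intro n
        have h1 : Tendsto (fun k => ENNReal.ofReal (C * (u (n + k) - t))) atTop (𝓝 0) := by
          have h2 : Tendsto (fun k => C * ((u (n + k) : ℝ) - t)) atTop (𝓝 (C * ((t : ℝ) - t))) := by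
            have h3 : Tendsto (fun k => (u (n + k) : ℝ)) atTop (𝓝 (t : ℝ)) := by
              have := (continuous_subtype_val.tendsto t).comp
                (hlim.comp (tendsto_add_atTop_nat n))
              refine this.congr fun k => ?_
              simp [add_comm]
            exact (h3.sub_const _).const_mul C
          rw [sub_self, mul_zero] at h2
          simpa using ENNReal.tendsto_ofReal h2
        refine le_antisymm (ge_of_tendsto' h1 fun k => ?_) zero_le
        exact (measure_mono (iInter_subset _ k)).trans (h t _ (hut _))
      have hae2 : ∀ᵐ w ∂P, w ∉ ⋃ n, ⋂ k, {w | w t ≠ w (u (n + k))} :=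
        measure_eq_zero_iff_ae_notMem.1 (measure_iUnion_null hnull)
      filter_upwards [hae, hae2] with w hw hw2
      rw [eval, hY w hw]
      by_contra hne
      obtain ⟨n, hn⟩ := eventually_atTop.1 (hu w hw)
      refine hw2 (mem_iUnion.2 ⟨n, mem_iInter.2 fun k => ?_⟩)
      change w t ≠ w (u (n + k))
      rw [hn _ (Nat.le_add_right n k)]
      exact Ne.symm hne

end Regularization

/-! ### The Markov property on càdlàg paths -/

section MarkovProperty

variable {E : Type} [Fintype E] [DecidableEq E] [MeasurableSpace E] [MeasurableSingletonClass E]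

lemma measurable_eval (t : unitInterval) : Measurable (eval (E := E) t) :=
  (measurable_pi_apply t).comp measurable_subtype_coe

lemma measurable_endpoints : Measurable (endpoints (E := E)) :=
  (measurable_eval 0).prodMk (measurable_eval 1)

lemma measurableSet_eval_eq (t : unitInterval) (x : E) :
    MeasurableSet {w : PathSpace E | eval t w = x} :=
  (measurableSet_singleton x).preimage (measurable_eval t)

lemma past_le (s : unitInterval) : past E s ≤ (inferInstance : MeasurableSpace (PathSpace E)) :=
  iSup₂_le fun u _ => (measurable_eval u).comap_le

lemma measurableSet_past_eval_eq {s t : unitInterval} (hst : s ≤ t) (x : E) :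
    MeasurableSet[past E t] {w : PathSpace E | eval s w = x} := by
  have h : MeasurableSpace.comap (eval s) inferInstance ≤ past E t :=
    le_iSup₂_of_le (f := fun (u : unitInterval) (_ : u ≤ t) =>
      MeasurableSpace.comap (eval (E := E) u) inferInstance) s hst le_rfl
  exact h _ ⟨{x}, measurableSet_singleton x, rfl⟩

/-- The Markov property of the canonical process with transition function `p`, for events of the
past instead of conditional expectations. -/
def IsMarkovWith (p : ℝ → ℝ → Matrix E E ℝ) (P : Measure (PathSpace E)) : Prop :=
  ∀ s t : unitInterval, s ≤ t → ∀ A, MeasurableSet[past E s] A → ∀ x y,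
    P (A ∩ {w | eval s w = x} ∩ {w | eval t w = y})
      = P (A ∩ {w | eval s w = x}) * ENNReal.ofReal (p s t x y)

lemma sum_measure_inter_eval_eq (P : Measure (PathSpace E)) (S : Set (PathSpace E))
    (s : unitInterval) : ∑ x, P (S ∩ {w | eval s w = x}) = P S := by
  have h := MeasureTheory.sum_measure_preimage_singleton (μ := P.restrict S) Finset.univ
    (f := fun w : PathSpace E => eval s w) fun x _ => measurableSet_eval_eq s x
  rw [Finset.coe_univ, preimage_univ, Measure.restrict_apply_univ] at h
  rw [← h]
  refine Finset.sum_congr rfl fun x _ => ?_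
  rw [inter_comm]
  exact (Measure.restrict_apply (measurableSet_eval_eq s x)).symm

lemma sum_measureReal_inter_eval_eq (P : Measure (PathSpace E)) [IsFiniteMeasure P]
    (S : Set (PathSpace E)) (s : unitInterval) :
    ∑ x, P.real (S ∩ {w | eval s w = x}) = P.real S := by
  simp only [measureReal_def]
  rw [← ENNReal.toReal_sum fun x _ => measure_ne_top P _, sum_measure_inter_eval_eq]

/-- It suffices to check the Markov property on cylinders. -/
lemma isMarkovWith_of_cylinders {p : ℝ → ℝ → Matrix E E ℝ} {P : Measure (PathSpace E)}
    [IsFiniteMeasure P]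
    (h : ∀ s t : unitInterval, s ≤ t → ∀ (J : Finset unitInterval) (B : unitInterval → Set E),
      (∀ u ∈ J, u ≤ s) → ∀ x y,
        P ({w | ∀ u ∈ J, eval u w ∈ B u} ∩ {w | eval s w = x} ∩ {w | eval t w = y})
          = P ({w | ∀ u ∈ J, eval u w ∈ B u} ∩ {w | eval s w = x})
            * ENNReal.ofReal (p s t x y)) : IsMarkovWith p P := by
  intro s t hst A hA x y
  let μ₁ : @Measure (PathSpace E) (past E s) :=
    (P.restrict ({w | eval s w = x} ∩ {w | eval t w = y})).trim (past_le s)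
  let μ₂ : @Measure (PathSpace E) (past E s) :=
    (ENNReal.ofReal (p s t x y) • P.restrict {w | eval s w = x}).trim (past_le s)
  have h1 : ∀ A, MeasurableSet[past E s] A →
      μ₁ A = P (A ∩ {w | eval s w = x} ∩ {w | eval t w = y}) := by
    intro A hA
    rw [trim_measurableSet_eq _ hA, Measure.restrict_apply (past_le s A hA), inter_assoc]
  have h2 : ∀ A, MeasurableSet[past E s] A →
      μ₂ A = P (A ∩ {w | eval s w = x}) * ENNReal.ofReal (p s t x y) := by
    intro A hA
    rw [trim_measurableSet_eq _ hA, Measure.smul_apply, Measure.restrict_apply (past_le s A hA),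
      smul_eq_mul, mul_comm]
  have hgen : past E s = MeasurableSpace.generateFrom (piiUnionInter
      (fun u => {A | MeasurableSet[MeasurableSpace.comap (eval (E := E) u) inferInstance] A})
      (Iic s)) := (generateFrom_piiUnionInter_measurableSet _ (Iic s)).symm
  have hcyl : ∀ A ∈ piiUnionInter
      (fun u => {A | MeasurableSet[MeasurableSpace.comap (eval (E := E) u) inferInstance] A})
      (Iic s), μ₁ A = μ₂ A := by
    intro A hA
    have hA' : MeasurableSet[past E s] A := by
      rw [hgen]
      exact MeasurableSpace.measurableSet_generateFrom hA
    obtain ⟨J, hJ, f, hf, rfl⟩ := hA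
    choose! B hB hBf using hf
    rw [h1 _ hA', h2 _ hA']
    have he : ⋂ u ∈ J, f u = {w | ∀ u ∈ J, eval u w ∈ B u} := by
      ext w
      simp only [mem_iInter, mem_ofPred_eq]
      refine forall₂_congr fun u hu => ?_
      rw [← hBf u hu]
      rfl
    rw [he]
    exact h s t hst J B (fun u hu => hJ hu) x y
  have huniv : μ₁ univ = μ₂ univ := by
    rw [h1 _ MeasurableSet.univ, h2 _ MeasurableSet.univ]
    simpa using h s t hst ∅ (fun _ => univ) (by simp) x y
  have hfin : IsFiniteMeasure μ₁ := isFiniteMeasure_trim (past_le s)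
  have heq : μ₁ = μ₂ := ext_of_generate_finite _ hgen
    (isPiSystem_piiUnionInter _ (fun u => @MeasurableSpace.isPiSystem_measurableSet _
      (MeasurableSpace.comap (eval (E := E) u) inferInstance)) _) hcyl huniv
  rw [← h1 A hA, ← h2 A hA, heq]

variable {p : ℝ → ℝ → Matrix E E ℝ} {P : Measure (PathSpace E)}

lemma setIntegral_fun_eval [IsFiniteMeasure P] {A : Set (PathSpace E)} (s : unitInterval)
    (f : E → ℝ) : ∫ w in A, f (eval s w) ∂P = ∑ x, f x * P.real (A ∩ {w | eval s w = x}) := by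
  have h1 : ∀ w : PathSpace E, f (eval s w)
      = ∑ x, ({w | eval s w = x} : Set (PathSpace E)).indicator (fun _ => f x) w := by
    intro w
    rw [Finset.sum_eq_single (eval s w)]
    · simp
    · intro x _ hx
      exact indicator_of_notMem (fun h : eval s w = x => hx h.symm) _
    · simp
  simp only [h1]
  rw [integral_finsetSum _ fun x _ =>
    (integrable_const (f x)).indicator (measurableSet_eval_eq s x)]
  refine Finset.sum_congr rfl fun x _ => ?_
  rw [integral_indicator_const _ (measurableSet_eval_eq s x),
    measureReal_restrict_apply (measurableSet_eval_eq s x), smul_eq_mul, mul_comm, inter_comm]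

/-- The two formulations of the Markov property agree. -/
lemma isMarkovWith_iff_condExp [IsProbabilityMeasure P]
    (hp : ∀ s t : unitInterval, s ≤ t → ∀ x y, 0 ≤ p s t x y) :
    IsMarkovWith p P ↔ ∀ s t : unitInterval, s ≤ t → ∀ y : E,
      P[({w | eval t w = y} : Set (PathSpace E)).indicator (fun _ => (1 : ℝ)) | past E s]
        =ᵐ[P] fun w => p s t (eval s w) y := by
  have hint : ∀ (t : unitInterval) (y : E), Integrable
      (({w | eval t w = y} : Set (PathSpace E)).indicator (fun _ => (1 : ℝ))) P := fun t y =>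
    (integrable_const 1).indicator (measurableSet_eval_eq t y)
  have hset : ∀ (A : Set (PathSpace E)) (t : unitInterval) (y : E),
      ∫ w in A, ({w | eval t w = y} : Set (PathSpace E)).indicator (fun _ => (1 : ℝ)) w ∂P
        = P.real (A ∩ {w | eval t w = y}) := by
    intro A t y
    rw [integral_indicator_const _ (measurableSet_eval_eq t y),
      measureReal_restrict_apply (measurableSet_eval_eq t y), smul_eq_mul, mul_one, inter_comm]
  have hmeas : ∀ (s : unitInterval) (f : E → ℝ), StronglyMeasurable[past E s]
      fun w : PathSpace E => f (eval s w) := by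
    intro s f
    have h1 : Measurable[past E s] (eval (E := E) s) := by
      refine @measurable_to_countable' _ _ _ _ (past E s) _ fun x => ?_
      exact measurableSet_past_eval_eq le_rfl x
    exact (Measurable.comp (measurable_of_finite f) h1).stronglyMeasurable
  constructor
  · intro h s t hst y
    refine (ae_eq_condExp_of_forall_setIntegral_eq (past_le s) (hint t y) ?_ ?_ ?_).symm
    · intro A _ _
      have : ∀ w : PathSpace E, ‖p s t (eval s w) y‖ ≤ ∑ x, ‖p s t x y‖ := fun w =>
        Finset.single_le_sum (f := fun x => ‖p s t x y‖) (fun _ _ => norm_nonneg _)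
          (Finset.mem_univ _)
      refine Integrable.of_bound ?_ _ (ae_of_all _ this)
      exact ((hmeas s fun x => p s t x y).mono (past_le s)).aestronglyMeasurable
    · intro A hA _
      rw [hset, setIntegral_fun_eval s fun x => p s t x y,
        ← sum_measureReal_inter_eval_eq P _ s]
      refine Finset.sum_congr rfl fun x _ => ?_
      rw [inter_right_comm, measureReal_def, measureReal_def, h s t hst A hA x y,
        ENNReal.toReal_mul, ENNReal.toReal_ofReal (hp s t hst x y), mul_comm]
    · exact (hmeas s fun x => p s t x y).aestronglyMeasurable
  · intro h s t hst A hA x y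
    have hA' : MeasurableSet[past E s] (A ∩ {w | eval s w = x}) :=
      MeasurableSet.inter hA (measurableSet_past_eval_eq le_rfl x)
    have h1 := setIntegral_condExp (past_le s) (hint t y) hA'
    rw [hset, setIntegral_congr_ae (g := fun w => p s t (eval s w) y) (past_le s _ hA')
      ((h s t hst y).mono fun w hw _ => hw), setIntegral_fun_eval s fun x => p s t x y,
      Finset.sum_eq_single x] at h1
    · rw [inter_assoc A, inter_self] at h1
      rw [← ENNReal.toReal_eq_toReal_iff' (measure_ne_top P _)
        (ENNReal.mul_ne_top (measure_ne_top P _) ENNReal.ofReal_ne_top), ENNReal.toReal_mul,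
        ENNReal.toReal_ofReal (hp s t hst x y)]
      rw [measureReal_def, measureReal_def] at h1
      rw [← h1, mul_comm]
    · intro z _ hz
      have : A ∩ {w | eval s w = x} ∩ {w | eval s w = z} = ∅ := by
        ext w
        simp only [mem_inter_iff, mem_ofPred_eq, mem_empty_iff_false, iff_false, not_and]
        rintro ⟨-, rfl⟩
        exact Ne.symm hz
      simp [this]
    · simp

lemma IsMarkovWith.measure_eval (h : IsMarkovWith p P) (t : unitInterval) (y : E) :
    P {w | eval t w = y} = ∑ x, P {w | eval 0 w = x} * ENNReal.ofReal (p 0 t x y) := by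
  rw [← sum_measure_inter_eval_eq P _ 0]
  refine Finset.sum_congr rfl fun x _ => ?_
  have := h 0 t t.2.1 univ MeasurableSet.univ x y
  rw [univ_inter] at this
  rw [inter_comm, this]
  rfl

/-- A Markov law is determined by its initial law and its transition function. -/
lemma IsMarkovWith.ext {P' : Measure (PathSpace E)} [IsProbabilityMeasure P]
    [IsProbabilityMeasure P'] (h : IsMarkovWith p P) (h' : IsMarkovWith p P')
    (h0 : ∀ x, P {w | eval 0 w = x} = P' {w | eval 0 w = x}) : P = P' := by
  have hfdd : ∀ (J : Finset unitInterval) (a : unitInterval → E),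
      P {w | ∀ u ∈ J, eval u w = a u} = P' {w | ∀ u ∈ J, eval u w = a u} := by
    intro J a
    induction J using Finset.induction_on_max with
    | empty => simp
    | insert t J ht ih =>
      rcases J.eq_empty_or_nonempty with rfl | hJ
      · simp only [insert_empty_eq, Finset.mem_singleton, forall_eq]
        rw [h.measure_eval, h'.measure_eval]
        simp only [h0]
      · set s := J.max' hJ with hs
        have hsJ : s ∈ J := J.max'_mem hJ
        have hJs : {w : PathSpace E | ∀ u ∈ J, eval u w = a u} ∩ {w | eval s w = a s}
            = {w | ∀ u ∈ J, eval u w = a u} := by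
          refine inter_eq_left.2 fun w hw => hw s hsJ
        have hins : {w : PathSpace E | ∀ u ∈ insert t J, eval u w = a u}
            = {w | ∀ u ∈ J, eval u w = a u} ∩ {w | eval s w = a s} ∩ {w | eval t w = a t} := by
          rw [hJs]
          ext w
          simp only [Finset.mem_insert, forall_eq_or_imp, mem_ofPred_eq, mem_inter_iff]
          exact and_comm
        have hmeas : MeasurableSet[past E s] {w : PathSpace E | ∀ u ∈ J, eval u w = a u} := by
          have : {w : PathSpace E | ∀ u ∈ J, eval u w = a u}
              = ⋂ u ∈ J, {w | eval u w = a u} := by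
            ext w
            simp
          rw [this]
          exact Finset.measurableSet_biInter (m := past E s) J fun u hu =>
            measurableSet_past_eval_eq (J.le_max' u hu) (a u)
        rw [hins, h s t (ht s hsJ).le _ hmeas, h' s t (ht s hsJ).le _ hmeas, hJs, ih]
  have hval : Measurable (Subtype.val : PathSpace E → unitInterval → E) := measurable_subtype_coe
  obtain ⟨w₀⟩ : Nonempty (PathSpace E) := nonempty_of_isProbabilityMeasure P
  have hproj : P.map Subtype.val = P'.map Subtype.val := by
    have hP : IsProbabilityMeasure (P.map Subtype.val) :=
      Measure.isProbabilityMeasure_map hval.aemeasurable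
    refine IsProjectiveLimit.unique
      (P := fun J : Finset unitInterval => (P.map Subtype.val).map J.restrict)
      (fun J => rfl) fun J => ?_
    refine Measure.ext_of_singleton fun v => ?_
    let a : unitInterval → E := fun u => if hu : u ∈ J then v ⟨u, hu⟩ else w₀.1 u
    have hpre : Subtype.val ⁻¹' (J.restrict (π := fun _ => E) ⁻¹' {v})
        = {w : PathSpace E | ∀ u ∈ J, eval u w = a u} := by
      ext w
      constructor
      · intro hw u hu
        have := congrFun (show J.restrict w.1 = v from hw) ⟨u, hu⟩
        simp only [a, dif_pos hu]
        exact this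
      · intro hw
        refine funext fun u => ?_
        have := hw u.1 u.2
        simp only [a, dif_pos u.2] at this
        exact this
    have hr : Measurable (J.restrict (π := fun _ => E)) := Finset.measurable_restrict J
    have hm : MeasurableSet (J.restrict (π := fun _ => E) ⁻¹' {v}) :=
      hr (Set.toFinite _).measurableSet
    rw [Measure.map_apply hr (Set.toFinite _).measurableSet,
      Measure.map_apply hr (Set.toFinite _).measurableSet, Measure.map_apply hval hm,
      Measure.map_apply hval hm, hpre, hfdd]
  refine Measure.ext fun S hS => ?_
  obtain ⟨B, hB, rfl⟩ := hS
  rw [← Measure.map_apply hval hB, hproj, Measure.map_apply hval hB]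

/-- Existence of the càdlàg Markov chain with a given transition function, when it leaves its state
between times `s ≤ t` with probability at most `C (t - s)`. -/
lemma IsTransitionFunction.exists_isMarkovWith {g : ℝ → Matrix E E ℝ}
    (hp : IsTransitionFunction g p) (μ : Measure E) [IsProbabilityMeasure μ] {C : ℝ} (hC : 0 ≤ C)
    (h : ∀ s t, 0 ≤ s → s ≤ t → t ≤ 1 →
      ∑ x, (∑ z, μ.real {z} * p 0 s z x) * (1 - p s t x x) ≤ C * (t - s)) :
    ∃ P : Measure (PathSpace E), IsProbabilityMeasure P ∧ (∀ x, P {w | eval 0 w = x} = μ {x}) ∧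
      IsMarkovWith p P := by
  obtain ⟨Q, hQ, h0, hM⟩ := hp.exists_pathLaw μ
  have hM' : ∀ s t : unitInterval, s ≤ t → ∀ x y, Q.real ({w | w s = x} ∩ {w | w t = y})
      = Q.real {w | w s = x} * p s t x y := by
    intro s t hst x y
    have h1 := hM s t hst ∅ (fun _ => univ) (by simp) x y
    have h2 : {w : unitInterval → E | ∀ u ∈ (∅ : Finset unitInterval), w u ∈ (univ : Set E)}
        = univ := by
      ext w
      simp
    rw [h2, univ_inter] at h1
    rw [measureReal_def, h1, ENNReal.toReal_mul,
      ENNReal.toReal_ofReal (hp.nonneg s t s.2.1 hst t.2.2 x y), measureReal_def]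
  have hsum : ∀ (S : Set (unitInterval → E)) (s : unitInterval),
      ∑ x, Q.real (S ∩ {w | w s = x}) = Q.real S := by
    intro S s
    simp only [measureReal_def]
    rw [← ENNReal.toReal_sum fun x _ => measure_ne_top Q _, sum_measure_inter_eval]
  have hmarg : ∀ (s : unitInterval) x, Q.real {w | w s = x} = ∑ z, μ.real {z} * p 0 s z x := by
    intro s x
    rw [← hsum _ 0]
    refine Finset.sum_congr rfl fun z _ => ?_
    rw [inter_comm, hM' 0 s s.2.1, measureReal_def, h0, measureReal_def]
    rfl
  have hne : ∀ s t : unitInterval, s ≤ t →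
      Q {w | w s ≠ w t} ≤ ENNReal.ofReal (C * (t - s)) := by
    intro s t hst
    rw [← ofReal_measureReal]
    refine ENNReal.ofReal_le_ofReal (le_trans (le_of_eq ?_) (h s t s.2.1 hst t.2.2))
    rw [← hsum _ s]
    refine Finset.sum_congr rfl fun x _ => ?_
    have h1 : {w : unitInterval → E | w s ≠ w t} ∩ {w | w s = x}
        = {w | w s = x} \ ({w | w s = x} ∩ {w | w t = x}) := by
      ext w
      simp only [mem_inter_iff, mem_ofPred_eq, Set.mem_sdiff, not_and]
      constructor
      · rintro ⟨h1, rfl⟩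
        exact ⟨rfl, fun _ h2 => h1 h2.symm⟩
      · rintro ⟨rfl, h2⟩
        exact ⟨fun h1 => h2 rfl h1.symm, rfl⟩
    rw [h1, measureReal_sdiff inter_subset_left
      ((measurableSet_eval s x).inter (measurableSet_eval t x)), hM' s t hst, ← hmarg s x]
    ring
  obtain ⟨Y, hY, hYt⟩ := exists_cadlag_modification hC hne
  have hcongr : ∀ (J : Finset unitInterval) (S : Set (PathSpace E)) (S' : Set (unitInterval → E)),
      MeasurableSet S → (∀ w : unitInterval → E, (∀ u ∈ J, eval u (Y w) = w u) →
        (Y w ∈ S ↔ w ∈ S')) → Q.map Y S = Q S' := by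
    intro J S S' hS hSS
    rw [Measure.map_apply hY hS]
    refine measure_congr ?_
    have hall : ∀ᵐ w ∂Q, ∀ u ∈ J, eval u (Y w) = w u :=
      (Finset.eventually_all J).2 fun u _ => hYt u
    filter_upwards [hall] with w hw
    exact propext (hSS w hw)
  have hprob : IsProbabilityMeasure (Q.map Y) := Measure.isProbabilityMeasure_map hY.aemeasurable
  refine ⟨Q.map Y, hprob, fun x => ?_, isMarkovWith_of_cylinders ?_⟩
  · rw [← h0]
    refine hcongr {0} _ _ (measurableSet_eval_eq 0 x) fun w hw => ?_
    simp only [mem_ofPred_eq, hw 0 (by simp)]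
  · intro s t hst J B hJ x y
    have hcyl : MeasurableSet {w : PathSpace E | ∀ u ∈ J, eval u w ∈ B u} := by
      have : {w : PathSpace E | ∀ u ∈ J, eval u w ∈ B u} = ⋂ u ∈ J, eval u ⁻¹' B u := by
        ext w
        simp
      rw [this]
      exact Finset.measurableSet_biInter J fun u _ =>
        (Set.toFinite (B u)).measurableSet.preimage (measurable_eval u)
    have hiff : ∀ w : unitInterval → E, (∀ u ∈ insert s (insert t J), eval u (Y w) = w u) →
        ((∀ u ∈ J, eval u (Y w) ∈ B u) ↔ ∀ u ∈ J, w u ∈ B u) := fun w hw =>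
      forall₂_congr fun u hu => by rw [hw u (by simp [hu])]
    rw [hcongr (insert s (insert t J)) _
        ({w | ∀ u ∈ J, w u ∈ B u} ∩ {w | w s = x} ∩ {w | w t = y})
        ((hcyl.inter (measurableSet_eval_eq s x)).inter (measurableSet_eval_eq t y)) ?_,
      hcongr (insert s (insert t J)) _ ({w | ∀ u ∈ J, w u ∈ B u} ∩ {w | w s = x})
        (hcyl.inter (measurableSet_eval_eq s x)) ?_]
    · exact hM s t hst J B hJ x y
    · intro w hw
      simp only [mem_inter_iff, mem_ofPred_eq, hiff w hw, hw s (by simp)]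
    · intro w hw
      simp only [mem_inter_iff, mem_ofPred_eq, hiff w hw, hw s (by simp), hw t (by simp)]

end MarkovProperty

/-! ### Markov chains and the endpoints of their paths -/

section Chains

variable {E : Type} [Fintype E] [DecidableEq E] [MeasurableSpace E] [MeasurableSingletonClass E]

/-- The chains with a given generator are the Markov laws for any of its transition functions. -/
lemma isCTMC_iff {g : ℝ → Matrix E E ℝ} {p : ℝ → ℝ → Matrix E E ℝ} (hg : IsGenerator g)
    (hp : IsTransitionFunction g p) (P : Measure (PathSpace E)) :
    IsCTMC g P ↔ IsProbabilityMeasure P ∧ IsMarkovWith p P := by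
  have hp0 : ∀ s t : unitInterval, s ≤ t → ∀ x y, 0 ≤ p s t x y :=
    fun s t hst => hp.nonneg s t s.2.1 hst t.2.2
  constructor
  · intro h
    have hP := h.prob
    refine ⟨hP, (isMarkovWith_iff_condExp hp0).2 ?_⟩
    obtain ⟨p', hp', hM⟩ := h.markov
    intro s t hst y
    have he : ∀ x, p' s t x y = p s t x y := fun x =>
      (hp'.isForwardSol s.2.1 s.2.2 x).unique hg s.2.1 le_rfl (hp.isForwardSol s.2.1 s.2.2 x) t
        ⟨hst, t.2.2⟩ y
    simpa only [he] using hM s t hst y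
  · rintro ⟨hP, hM⟩
    exact ⟨hP, hg, p, hp, (isMarkovWith_iff_condExp hp0).1 hM⟩

variable {q : Matrix E E ℝ}

lemma IsMarkovWith.measureReal_inter {p : ℝ → ℝ → Matrix E E ℝ} {P : Measure (PathSpace E)}
    (h : IsMarkovWith p P) {s t : unitInterval} (hst : s ≤ t) {A : Set (PathSpace E)}
    (hA : MeasurableSet[past E s] A) {x y : E} (hp : 0 ≤ p s t x y) :
    P.real (A ∩ {w | eval s w = x} ∩ {w | eval t w = y})
      = P.real (A ∩ {w | eval s w = x}) * p s t x y := by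
  rw [measureReal_def, h s t hst A hA, ENNReal.toReal_mul, ENNReal.toReal_ofReal hp,
    measureReal_def]

/-- The event that the path starts in `x₀` and ends in `x₁`. -/
def endpointEvent (x₀ x₁ : E) : Set (PathSpace E) := {w | endpoints w = (x₀, x₁)}

lemma measurableSet_endpointEvent (x₀ x₁ : E) : MeasurableSet (endpointEvent x₀ x₁) :=
  (measurableSet_singleton (x₀, x₁)).preimage measurable_endpoints

lemma endpointEvent_eq (x₀ x₁ : E) :
    endpointEvent x₀ x₁ = {w | eval 0 w = x₀} ∩ {w | eval 1 w = x₁} := by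
  ext w
  simp [endpointEvent, endpoints]

/-- Partitioning an event according to the endpoints of the path. -/
lemma sum_measureReal_endpointEvent_inter (P : Measure (PathSpace E)) [IsFiniteMeasure P]
    (S : Set (PathSpace E)) : ∑ x₀, ∑ x₁, P.real (endpointEvent x₀ x₁ ∩ S) = P.real S := by
  have h1 : ∀ x₀ x₁, endpointEvent x₀ x₁ ∩ S
      = S ∩ {w | eval 0 w = x₀} ∩ {w | eval 1 w = x₁} := by
    intro x₀ x₁
    rw [endpointEvent_eq, inter_comm, inter_assoc]
  simp only [h1, sum_measureReal_inter_eval_eq]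

section Homogeneous

variable {Q : Measure (PathSpace E)}

/-- The joint law of the endpoints and of two further states of a homogeneous chain. -/
lemma IsMarkovWith.measureReal_endpointEvent_inter_inter (hq : IsRateMatrix q)
    (h : IsMarkovWith (fun s t => heat q (t - s)) Q) {t u : unitInterval} (htu : t ≤ u)
    (x₀ x₁ x y : E) :
    Q.real (endpointEvent x₀ x₁ ∩ ({w | eval t w = x} ∩ {w | eval u w = y}))
      = Q.real {w | eval 0 w = x₀} * heat q t x₀ x * heat q (u - t) x y
          * heat q (1 - u) y x₁ := by
  have h0 := h.measureReal_inter (s := 0) (t := t) t.2.1 (@MeasurableSet.univ _ (past E 0))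
    (x := x₀) (y := x) (hq.heat_nonneg (by simpa using t.2.1) _ _)
  have h1 := h.measureReal_inter htu
    (measurableSet_past_eval_eq (show (0 : unitInterval) ≤ t from t.2.1) x₀) (x := x) (y := y)
    (hq.heat_nonneg (sub_nonneg.2 htu) _ _)
  have h2 := h.measureReal_inter (s := u) (t := 1) u.2.2
    (A := {w | eval 0 w = x₀} ∩ {w | eval t w = x})
    (MeasurableSet.inter
      (measurableSet_past_eval_eq (show (0 : unitInterval) ≤ u from u.2.1) x₀)
      (measurableSet_past_eval_eq htu x))
    (x := y) (y := x₁) (hq.heat_nonneg (by simpa using u.2.2) _ _)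
  have he : endpointEvent x₀ x₁ ∩ ({w | eval t w = x} ∩ {w | eval u w = y})
      = {w | eval 0 w = x₀} ∩ {w | eval t w = x} ∩ {w | eval u w = y} ∩ {w | eval 1 w = x₁} := by
    rw [endpointEvent_eq]
    ext w
    simp only [mem_inter_iff]
    tauto
  rw [he, h2, h1]
  rw [univ_inter] at h0
  rw [h0]
  simp

lemma IsMarkovWith.measureReal_endpointEvent_inter (hq : IsRateMatrix q)
    (h : IsMarkovWith (fun s t => heat q (t - s)) Q) (t : unitInterval) (x₀ x₁ x : E) :
    Q.real (endpointEvent x₀ x₁ ∩ {w | eval t w = x})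
      = Q.real {w | eval 0 w = x₀} * heat q t x₀ x * heat q (1 - t) x x₁ := by
  have h1 := h.measureReal_endpointEvent_inter_inter hq (le_refl t) x₀ x₁ x x
  rw [inter_self, sub_self, heat_zero, Matrix.one_apply_eq, mul_one] at h1
  exact h1

lemma IsMarkovWith.measureReal_endpointEvent (hq : IsRateMatrix q)
    (h : IsMarkovWith (fun s t => heat q (t - s)) Q) (x₀ x₁ : E) :
    Q.real (endpointEvent x₀ x₁) = Q.real {w | eval 0 w = x₀} * heat q 1 x₀ x₁ := by
  have h1 := h.measureReal_inter (s := 0) (t := 1) zero_le_one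
    (@MeasurableSet.univ _ (past E 0)) (x := x₀) (y := x₁) (hq.heat_nonneg (by simp) _ _)
  rw [univ_inter] at h1
  rw [endpointEvent_eq, h1]
  simp

/-- The chain with a homogeneous generator exists for every initial law. -/
lemma IsRateMatrix.exists_isMarkovWith_heat (hq : IsRateMatrix q) (μ : Measure E)
    [IsProbabilityMeasure μ] : ∃ Q : Measure (PathSpace E), IsProbabilityMeasure Q ∧
      (∀ x, Q {w | eval 0 w = x} = μ {x}) ∧ IsMarkovWith (fun s t => heat q (t - s)) Q := by
  refine (isTransitionFunction_heat hq).exists_isMarkovWith μ (rateBound_nonneg q) ?_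
  intro s t hs hst _
  have h1 : ∀ x ∈ Finset.univ, (∑ z, μ.real {z} * heat q (s - 0) z x) * (1 - heat q (t - s) x x)
      ≤ (∑ z, μ.real {z} * heat q (s - 0) z x) * (rateBound q * (t - s)) := by
    intro x _
    refine mul_le_mul_of_nonneg_left ?_ (Finset.sum_nonneg fun z _ =>
      mul_nonneg measureReal_nonneg (hq.heat_nonneg (by simpa using hs) z x))
    linarith [hq.heat_diag_ge (sub_nonneg.2 hst) x,
      Real.add_one_le_exp (-(rateBound q * (t - s)))]
  refine (Finset.sum_le_sum h1).trans (le_of_eq ?_)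
  rw [← Finset.sum_mul, Finset.sum_comm]
  simp only [← Finset.mul_sum, hq.heat_row_sum, mul_one]
  rw [sum_measureReal_singleton]
  simp

end Homogeneous

end Chains

/-! ### Bridges and interpolants -/

section Interpolant

variable {E : Type} [Fintype E] [DecidableEq E] [MeasurableSpace E] [MeasurableSingletonClass E]
variable {q : Matrix E E ℝ} {π : Measure (E × E)}

lemma measureReal_cond_apply {Ω : Type*} [MeasurableSpace Ω] {s : Set Ω} (hs : MeasurableSet s)
    (μ : Measure Ω) (t : Set Ω) : (μ[|s]).real t = (μ.real s)⁻¹ * μ.real (s ∩ t) := by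
  rw [measureReal_def, cond_apply hs, ENNReal.toReal_mul, ENNReal.toReal_inv, measureReal_def,
    measureReal_def]

lemma bridge_real_apply (P : Measure (PathSpace E)) (x₀ x₁ : E) (S : Set (PathSpace E)) :
    (bridge P x₀ x₁).real S
      = (P.real (endpointEvent x₀ x₁))⁻¹ * P.real (endpointEvent x₀ x₁ ∩ S) :=
  measureReal_cond_apply (measurableSet_endpointEvent x₀ x₁) P S

lemma IsCoupling.isProbabilityMeasure {μ₀ μ₁ : Measure E} [IsProbabilityMeasure μ₀]
    (hπ : IsCoupling π μ₀ μ₁) : IsProbabilityMeasure π := by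
  refine ⟨?_⟩
  have h : (π.map Prod.fst) univ = 1 := by
    rw [hπ.1]
    exact measure_univ
  rwa [Measure.map_apply measurable_fst MeasurableSet.univ, preimage_univ] at h

/-- The mixture of the bridges of a chain according to the coupling is an interpolant. -/
lemma IsRateMatrix.exists_isInterpolant (hq : IsRateMatrix q) {μ₀ μ₁ : Measure E}
    [IsProbabilityMeasure μ₀] (hπ : IsCoupling π μ₀ μ₁)
    (hsupp : ∀ x₀ x₁, π {(x₀, x₁)} ≠ 0 → transProb q 0 1 x₁ x₀ ≠ 0) :
    ∃ P, IsInterpolant q π P := by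
  have hπp := hπ.isProbabilityMeasure
  obtain ⟨Q, hQ, h0, hM⟩ := hq.exists_isMarkovWith_heat μ₀
  have hpos : ∀ x₀ x₁, π {(x₀, x₁)} ≠ 0 → Q (endpointEvent x₀ x₁) ≠ 0 := by
    intro x₀ x₁ h
    have h1 : μ₀ {x₀} ≠ 0 := by
      rw [← hπ.1, Measure.map_apply measurable_fst (measurableSet_singleton x₀)]
      exact fun h2 => h (measure_mono_null (by rintro _ rfl; rfl) h2)
    have h2 := hM.measureReal_endpointEvent hq x₀ x₁
    rw [measureReal_def, measureReal_def, h0] at h2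
    have h3 : (μ₀ {x₀}).toReal * heat q 1 x₀ x₁ ≠ 0 := by
      refine mul_ne_zero (ENNReal.toReal_ne_zero.2 ⟨h1, measure_ne_top _ _⟩) ?_
      have := hsupp x₀ x₁ h
      rwa [transProb_eq_heat, sub_zero] at this
    intro h4
    rw [h4, ENNReal.toReal_zero] at h2
    exact h3 h2.symm
  let P : Measure (PathSpace E) := ∑ e : E × E, π {e} • bridge Q e.1 e.2
  have hP : ∀ x₀ x₁ (S : Set (PathSpace E)), MeasurableSet S →
      P (endpointEvent x₀ x₁ ∩ S) = π {(x₀, x₁)} * bridge Q x₀ x₁ S := by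
    intro x₀ x₁ S hS
    simp only [P, Measure.finsetSum_apply, Measure.smul_apply, smul_eq_mul]
    rw [Finset.sum_eq_single (x₀, x₁)]
    · congr 1
      rw [bridge]
      change Q[| endpointEvent x₀ x₁] _ = Q[| endpointEvent x₀ x₁] _
      rw [cond_apply (measurableSet_endpointEvent x₀ x₁),
        cond_apply (measurableSet_endpointEvent x₀ x₁), ← inter_assoc, inter_self]
    · rintro ⟨y₀, y₁⟩ _ hne
      have h1 : bridge Q y₀ y₁ (endpointEvent x₀ x₁ ∩ S) = 0 := by
        change Q[| endpointEvent y₀ y₁] _ = 0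
        rw [cond_apply (measurableSet_endpointEvent y₀ y₁)]
        have : endpointEvent y₀ y₁ ∩ (endpointEvent x₀ x₁ ∩ S) = ∅ := by
          ext w
          simp only [endpointEvent, mem_inter_iff, mem_ofPred_eq, mem_empty_iff_false, iff_false]
          rintro ⟨h2, h3, -⟩
          exact hne (h2.symm.trans h3)
        rw [this]
        simp
      rw [h1, mul_zero]
    · simp
  have hPe : ∀ x₀ x₁, P (endpointEvent x₀ x₁) = π {(x₀, x₁)} := by
    intro x₀ x₁
    have h1 := hP x₀ x₁ univ MeasurableSet.univ
    rw [inter_univ] at h1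
    rw [h1]
    by_cases h : π {(x₀, x₁)} = 0
    · simp [h]
    · have : IsProbabilityMeasure (bridge Q x₀ x₁) := cond_isProbabilityMeasure (hpos x₀ x₁ h)
      rw [measure_univ, mul_one]
  refine ⟨P, Q, (isCTMC_iff (isGenerator_const hq) (isTransitionFunction_heat hq) Q).2 ⟨hQ, hM⟩,
    hpos, ?_, ?_⟩
  · refine Measure.ext_of_singleton fun e => ?_
    rw [Measure.map_apply measurable_endpoints (measurableSet_singleton e)]
    exact hPe e.1 e.2
  · intro x₀ x₁ h
    refine Measure.ext fun S hS => ?_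
    change P[| endpointEvent x₀ x₁] S = _
    rw [cond_apply (measurableSet_endpointEvent x₀ x₁), hP x₀ x₁ S hS, hPe, ← mul_assoc,
      ENNReal.inv_mul_cancel h (measure_ne_top _ _), one_mul]

variable {P : Measure (PathSpace E)}

lemma IsInterpolant.isProbabilityMeasure [IsProbabilityMeasure π] (h : IsInterpolant q π P) :
    IsProbabilityMeasure P := by
  obtain ⟨Q, -, -, hmap, -⟩ := h
  refine ⟨?_⟩
  have h1 : (P.map endpoints) univ = 1 := by
    rw [hmap]
    exact measure_univ
  rwa [Measure.map_apply measurable_endpoints MeasurableSet.univ, preimage_univ] at h1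

lemma IsInterpolant.measure_endpointEvent (h : IsInterpolant q π P) (x₀ x₁ : E) :
    P (endpointEvent x₀ x₁) = π {(x₀, x₁)} := by
  obtain ⟨Q, -, -, hmap, -⟩ := h
  rw [← hmap, Measure.map_apply measurable_endpoints (measurableSet_singleton _)]
  rfl

/-- The bridges of an interpolant are those of a chain that charges the endpoints. -/
lemma IsInterpolant.exists_chain (hq : IsRateMatrix q) (h : IsInterpolant q π P) :
    ∃ Q, IsProbabilityMeasure Q ∧ IsMarkovWith (fun s t => heat q (t - s)) Q ∧
      ∀ x₀ x₁, π {(x₀, x₁)} ≠ 0 →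
        Q.real {w | eval 0 w = x₀} * heat q 1 x₀ x₁ ≠ 0 ∧ bridge P x₀ x₁ = bridge Q x₀ x₁ := by
  obtain ⟨Q, hQ, hpos, -, hb⟩ := h
  obtain ⟨hQp, hM⟩ := (isCTMC_iff (isGenerator_const hq) (isTransitionFunction_heat hq) Q).1 hQ
  refine ⟨Q, hQp, hM, fun x₀ x₁ h => ⟨?_, hb x₀ x₁ h⟩⟩
  rw [← hM.measureReal_endpointEvent hq, measureReal_def]
  exact ENNReal.toReal_ne_zero.2 ⟨hpos x₀ x₁ h, measure_ne_top _ _⟩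

/-- The joint law of the endpoints and of the state at time `t`. -/
lemma IsInterpolant.joint_law [IsProbabilityMeasure π] (hq : IsRateMatrix q)
    (h : IsInterpolant q π P) (t : unitInterval) (x₀ x₁ x : E) :
    P.real (endpointEvent x₀ x₁ ∩ {w | eval t w = x})
      = heat q (1 - t) x x₁ * heat q t x₀ x * tildeCoupling q π x₀ x₁ := by
  have hP := h.isProbabilityMeasure
  have he := h.measure_endpointEvent x₀ x₁
  obtain ⟨Q, hQ, hM, hb⟩ := h.exists_chain hq
  rw [tildeCoupling, transProb_eq_heat, sub_zero]
  by_cases h0 : π {(x₀, x₁)} = 0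
  · have h1 : P (endpointEvent x₀ x₁ ∩ {w | eval t w = x}) = 0 :=
      measure_mono_null inter_subset_left (he.trans h0)
    rw [measureReal_def, measureReal_def, h1, h0]
    simp
  · obtain ⟨h1, h2⟩ := hb x₀ x₁ h0
    have h3 := bridge_real_apply P x₀ x₁ {w | eval t w = x}
    rw [h2, bridge_real_apply, hM.measureReal_endpointEvent hq,
      hM.measureReal_endpointEvent_inter hq, measureReal_def P, he,
      ← measureReal_def π] at h3
    have h4 : π.real {(x₀, x₁)} ≠ 0 := ENNReal.toReal_ne_zero.2 ⟨h0, measure_ne_top _ _⟩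
    obtain ⟨h5, h6⟩ := mul_ne_zero_iff.1 h1
    field_simp at h3 ⊢
    linarith

/-- The one-dimensional marginals of an interpolant. -/
lemma IsInterpolant.measureReal_eval [IsProbabilityMeasure π] (hq : IsRateMatrix q)
    (h : IsInterpolant q π P) (t : unitInterval) (x : E) :
    P.real {w | eval t w = x} = interpolantDensity q π t x := by
  have hP := h.isProbabilityMeasure
  rw [← sum_measureReal_endpointEvent_inter P, ← crossDensity_self]
  exact Finset.sum_congr rfl fun x₀ _ => Finset.sum_congr rfl fun x₁ _ =>
    h.joint_law hq t x₀ x₁ x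

lemma nhdsGT_neBot_unitInterval {t : unitInterval} (ht : t < 1) : (𝓝[>] t).NeBot :=
  nhdsGT_neBot_of_exists_gt ⟨1, ht⟩

/-- The jump rate of the bridge is the Doob transform of the rate of the chain. -/
lemma IsInterpolant.hasJumpRate_bridge [IsProbabilityMeasure π] (hq : IsRateMatrix q)
    (h : IsInterpolant q π P) {t : unitInterval} {x₀ x₁ x y : E} (hxy : x ≠ y)
    (hne : P {w | endpoints w = (x₀, x₁) ∧ eval t w = x} ≠ 0) :
    HasJumpRate (bridge P x₀ x₁) t x y
      (q x y * heat q (1 - t) y x₁ / heat q (1 - t) x x₁) := by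
  have hP := h.isProbabilityMeasure
  have hπ0 : π {(x₀, x₁)} ≠ 0 := by
    rw [← h.measure_endpointEvent]
    exact fun h0 => hne (measure_mono_null (fun w hw => hw.1) h0)
  have hjoint := h.joint_law hq t x₀ x₁ x
  have hj0 : P.real (endpointEvent x₀ x₁ ∩ {w | eval t w = x}) ≠ 0 :=
    ENNReal.toReal_ne_zero.2 ⟨hne, measure_ne_top _ _⟩
  rw [hjoint, mul_ne_zero_iff, mul_ne_zero_iff] at hj0
  obtain ⟨⟨h1, h2⟩, -⟩ := hj0
  obtain ⟨Q, hQ, hM, hb⟩ := h.exists_chain hq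
  obtain ⟨h3, h4⟩ := hb x₀ x₁ hπ0
  obtain ⟨h5, h6⟩ := mul_ne_zero_iff.1 h3
  rw [HasJumpRate, h4]
  have hval : ∀ u : unitInterval, t < u →
      ((bridge Q x₀ x₁)[| {w | eval t w = x}]).real {w | eval u w = y} / ((u : ℝ) - (t : ℝ))
        = heat q (u - t) x y / (u - t) * heat q (1 - u) y x₁ / heat q (1 - t) x x₁ := by
    intro u hu
    rw [measureReal_cond_apply (measurableSet_eval_eq t x), bridge_real_apply, bridge_real_apply,
      hM.measureReal_endpointEvent_inter_inter hq hu.le, hM.measureReal_endpointEvent_inter hq,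
      hM.measureReal_endpointEvent hq]
    field_simp
  have hsub : Tendsto (fun u : unitInterval => (u : ℝ) - (t : ℝ)) (𝓝[>] t) (𝓝[≠] 0) := by
    refine tendsto_nhdsWithin_iff.2 ⟨?_, ?_⟩
    · have : Tendsto (fun u : unitInterval => (u : ℝ) - (t : ℝ)) (𝓝 t) (𝓝 ((t : ℝ) - t)) :=
        (continuous_subtype_val.sub continuous_const).tendsto t
      rw [sub_self] at this
      exact this.mono_left nhdsWithin_le_nhds
    · filter_upwards [self_mem_nhdsWithin] with u hu
      exact (sub_pos.2 (show (t : ℝ) < u from hu)).ne'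
  have hlim2 : Tendsto (fun u : unitInterval => heat q (1 - u) y x₁) (𝓝[>] t)
      (𝓝 (heat q (1 - t) y x₁)) :=
    (((continuous_heat q y x₁).comp (continuous_const.sub continuous_subtype_val)).tendsto
      t).mono_left nhdsWithin_le_nhds
  refine ((((tendsto_heat_div q hxy).comp hsub).mul hlim2).div_const _).congr' ?_
  filter_upwards [self_mem_nhdsWithin] with u hu
  exact (hval u hu).symm

/-- Averaging the jump rates of the bridges over the endpoints, given the current state, yields the
projected generator. -/
lemma IsInterpolant.sum_cond_mul_rate [IsProbabilityMeasure π] (hq : IsRateMatrix q)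
    (h : IsInterpolant q π P) {b : E → E → unitInterval → E → E → ℝ} {t : unitInterval} (ht : t < 1)
    {x y : E} (hxy : x ≠ y)
    (hb : ∀ x₀ x₁, P {w | endpoints w = (x₀, x₁) ∧ eval t w = x} ≠ 0 →
      HasJumpRate (bridge P x₀ x₁) t x y (b x₀ x₁ t x y)) :
    ∑ x₀, ∑ x₁, (P[| {w | eval t w = x}]).real {w | endpoints w = (x₀, x₁)} * b x₀ x₁ t x y
      = projGenerator q π t x y := by
  have hP := h.isProbabilityMeasure
  have ht1 : (0 : ℝ) < 1 - t := sub_pos.2 (show (t : ℝ) < 1 from ht)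
  rw [projGenerator_of_ne π q t hxy, score_eq, crossDensity, ← mul_div_assoc, Finset.mul_sum,
    Finset.sum_div]
  refine Finset.sum_congr rfl fun x₀ _ => ?_
  rw [Finset.mul_sum, Finset.sum_div]
  refine Finset.sum_congr rfl fun x₁ _ => ?_
  have hc : (P[| {w | eval t w = x}]).real {w | endpoints w = (x₀, x₁)}
      = (interpolantDensity q π t x)⁻¹
        * (heat q (1 - t) x x₁ * heat q t x₀ x * tildeCoupling q π x₀ x₁) := by
    rw [measureReal_cond_apply (measurableSet_eval_eq t x), h.measureReal_eval hq, inter_comm]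
    congr 1
    exact h.joint_law hq t x₀ x₁ x
  rw [hc]
  -- Endpoints that are incompatible with the state `x`, where `b` is arbitrary, do not contribute
  -- to the score either: if `x` cannot reach `x₁`, then `y` cannot, or `x` does not jump to `y`.
  by_cases h0 : heat q (1 - t) x x₁ * heat q t x₀ x * tildeCoupling q π x₀ x₁ = 0
  · rw [h0, mul_zero, zero_mul]
    have h1 : q x y * (heat q (1 - t) y x₁ * heat q t x₀ x * tildeCoupling q π x₀ x₁) = 0 := by
      rw [mul_eq_zero, mul_eq_zero] at h0
      rcases h0 with (h0 | h0) | h0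
      · rw [← mul_assoc, ← mul_assoc, hq.rate_mul_heat_eq_zero ht1 hxy h0]
        simp
      · simp [h0]
      · simp [h0]
    rw [h1, zero_div]
  · have hne : P {w | endpoints w = (x₀, x₁) ∧ eval t w = x} ≠ 0 := by
      intro h1
      refine h0 ?_
      rw [← h.joint_law hq t x₀ x₁ x, measureReal_def]
      have : P (endpointEvent x₀ x₁ ∩ {w | eval t w = x}) = 0 := h1
      rw [this, ENNReal.toReal_zero]
    have := nhdsGT_neBot_unitInterval ht
    have hbe : b x₀ x₁ t x y = q x y * heat q (1 - t) y x₁ / heat q (1 - t) x x₁ :=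
      tendsto_nhds_unique (hb x₀ x₁ hne) (h.hasJumpRate_bridge hq hxy hne)
    have h1 : heat q (1 - t) x x₁ ≠ 0 := fun h1 => h0 (by simp [h1])
    rw [hbe]
    field_simp

lemma IsInterpolant.map_eval_zero {μ₀ μ₁ : Measure E} (hπ : IsCoupling π μ₀ μ₁)
    (h : IsInterpolant q π P) : P.map (eval 0) = μ₀ := by
  obtain ⟨Q, -, -, hmap, -⟩ := h
  rw [← hπ.1, ← hmap, Measure.map_map measurable_fst measurable_endpoints]
  rfl

end Interpolant

/-! ### The Markovian projections of an interpolant -/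

section Projection

variable {E : Type} [Fintype E] [DecidableEq E] [MeasurableSpace E] [MeasurableSingletonClass E]
variable {q : Matrix E E ℝ} {π : Measure (E × E)} {P PM : Measure (PathSpace E)}
variable {p : ℝ → ℝ → Matrix E E ℝ}

/-- Only the rates out of states charged by the interpolant matter to a chain started from such a
state: the chain never visits the others. -/
lemma IsRateMatrix.transition_eq_of_charged (hq : IsRateMatrix q)
    (hp : IsTransitionFunction (projGenerator q π) p) {g : ℝ → Matrix E E ℝ} (hg : IsGenerator g)
    {p' : ℝ → ℝ → Matrix E E ℝ} (hp' : IsTransitionFunction g p')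
    (hgq : ∀ r ∈ Ioo (0 : ℝ) 1, ∀ x y, interpolantDensity q π r x ≠ 0 →
      g r x y = projGenerator q π r x y)
    {s t : ℝ} (hs : 0 ≤ s) (hst : s ≤ t) (ht : t ≤ 1) {x : E}
    (hx : interpolantDensity q π s x ≠ 0) (y : E) : p' s t x y = p s t x y := by
  have hs1 := hst.trans ht
  have hsol := hp.isForwardSol hs hs1 x
  have h1 : IsForwardSol g s 1 ((1 : Matrix E E ℝ) x) (fun t => p s t x) := by
    refine hsol.congr_gen hs1 fun r hr z y => ?_
    have hr0 : r ∈ Ioo (0 : ℝ) 1 := ⟨hs.trans_lt hr.1, hr.2⟩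
    by_cases hz : interpolantDensity q π r z = 0
    · have h2 := hq.density_mul_le π hs le_rfl hsol ⟨hr.1.le, hr.2.le⟩ z
      have h3 := hp.nonneg s r hs hr.1.le hr.2.le x z
      have h4 := (hq.interpolantDensity_nonneg π ⟨hs, hs1⟩ x).lt_of_ne' hx
      have h5 : p s r x z = 0 := by
        rw [hz] at h2
        exact le_antisymm (nonpos_of_mul_nonpos_right h2 h4) h3
      simp only [h5, zero_mul]
    · rw [hgq r hr0 z y hz]
  exact (hp'.isForwardSol hs hs1 x).unique hg hs le_rfl h1 t ⟨hst, ht⟩ y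

/-- The chain with the projected generator, started from the initial law of the interpolant, has
the density of the interpolant as time marginals. -/
lemma IsRateMatrix.sum_density_mul_transition (hq : IsRateMatrix q)
    (hp : IsTransitionFunction (projGenerator q π) p) {t : ℝ} (ht : t ∈ Icc (0 : ℝ) 1) (y : E) :
    ∑ x, interpolantDensity q π 0 x * p 0 t x y = interpolantDensity q π t y :=
  hp.sum_mul_eq (hq.isGenerator_projGenerator π) le_rfl le_rfl
    (hq.isForwardSol_interpolantDensity π) ht y

lemma IsMarkovWith.measureReal_eval [IsProbabilityMeasure P]
    {g : ℝ → Matrix E E ℝ} (hp : IsTransitionFunction g p) (h : IsMarkovWith p P)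
    (t : unitInterval) (y : E) :
    P.real {w | eval t w = y} = ∑ x, P.real {w | eval 0 w = x} * p 0 t x y := by
  rw [measureReal_def, h.measure_eval, ENNReal.toReal_sum fun x _ =>
    ENNReal.mul_ne_top (measure_ne_top _ _) ENNReal.ofReal_ne_top]
  refine Finset.sum_congr rfl fun x _ => ?_
  rw [ENNReal.toReal_mul, ENNReal.toReal_ofReal (hp.nonneg 0 t le_rfl t.2.1 t.2.2 x y),
    measureReal_def]

lemma map_eval_apply_singleton (P : Measure (PathSpace E)) (t : unitInterval) (x : E) :
    P.map (eval t) {x} = P {w | eval t w = x} :=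
  Measure.map_apply (measurable_eval t) (measurableSet_singleton x)

/-- A Markovian projection of the interpolant is the Markov law of the projected generator. -/
lemma IsInterpolant.isCTMC_of_isMarkovianProjection [IsProbabilityMeasure π]
    (hq : IsRateMatrix q) (h : IsInterpolant q π P) (hPM : IsMarkovianProjection P PM) :
    IsCTMC (projGenerator q π) PM := by
  have hP := h.isProbabilityMeasure
  obtain ⟨hinit, g, b, hC, hb, hgb⟩ := hPM
  have hPM := hC.prob
  obtain ⟨p, hp⟩ := hq.exists_isTransitionFunction π
  obtain ⟨p', hp', -⟩ := hC.markov
  have hM' := ((isCTMC_iff hC.generator hp' PM).1 hC).2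
  -- Out of charged states, the generator of a Markovian projection has the averaged bridge rates.
  have hoff : ∀ r ∈ Ioo (0 : ℝ) 1, ∀ x y, x ≠ y → interpolantDensity q π r x ≠ 0 →
      g r x y = projGenerator q π r x y := by
    intro r hr x y hxy hx
    let t : unitInterval := ⟨r, hr.1.le, hr.2.le⟩
    have ht : t < 1 := hr.2
    have hne : P {w | eval t w = x} ≠ 0 := by
      intro h0
      refine hx ?_
      rw [← h.measureReal_eval hq t x, measureReal_def, h0, ENNReal.toReal_zero]
    rw [← h.sum_cond_mul_rate hq (t := t) ht hxy fun x₀ x₁ => hb x₀ x₁ t x y ht hxy]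
    exact hgb t x y ht hxy hne
  have hgq : ∀ r ∈ Ioo (0 : ℝ) 1, ∀ x y, interpolantDensity q π r x ≠ 0 →
      g r x y = projGenerator q π r x y := by
    intro r hr x y hx
    by_cases hxy : x = y
    · subst hxy
      have h1 := (hC.generator.rate r (Ioo_subset_Icc_self hr)).row_sum x
      have h2 := (hq.isRateMatrix_projGenerator π (Ioo_subset_Icc_self hr)).row_sum x
      rw [← Finset.add_sum_erase _ _ (Finset.mem_univ x)] at h1 h2
      rw [Finset.sum_congr rfl fun z hz =>
        hoff r hr x z (Finset.ne_of_mem_erase hz).symm hx] at h1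
      linarith
    · exact hoff r hr x y hxy hx
  have h0 : ∀ x, PM.real {w | eval 0 w = x} = interpolantDensity q π 0 x := by
    intro x
    rw [measureReal_def, ← map_eval_apply_singleton, hinit, map_eval_apply_singleton,
      ← measureReal_def, h.measureReal_eval hq]
    rfl
  have hrow := fun (s t : unitInterval) (hst : s ≤ t) x =>
    hq.transition_eq_of_charged hp hC.generator hp' hgq s.2.1 hst t.2.2 (x := x)
  have hmarg : ∀ (t : unitInterval) x, PM.real {w | eval t w = x} = interpolantDensity q π t x := by
    intro t x
    rw [hM'.measureReal_eval hp', ← hq.sum_density_mul_transition hp t.2]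
    refine Finset.sum_congr rfl fun z _ => ?_
    rw [h0]
    by_cases hz : interpolantDensity q π 0 z = 0
    · rw [hz, zero_mul, zero_mul]
    · exact congrArg _ (hrow 0 t t.2.1 z hz x)
  refine (isCTMC_iff (hq.isGenerator_projGenerator π) hp PM).2 ⟨hPM, fun s t hst A hA x y => ?_⟩
  rw [hM' s t hst A hA x y]
  by_cases hx : interpolantDensity q π s x = 0
  · have h1 : PM {w | eval s w = x} = 0 := by
      rw [← hmarg, measureReal_eq_zero_iff] at hx
      exact hx
    rw [measure_mono_null inter_subset_right h1, zero_mul, zero_mul]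
  · rw [hrow s t hst x hx y]

/-- The Markovian projections of the interpolant are the chains with the projected generator and
the right initial law. -/
lemma IsInterpolant.isMarkovianProjection_iff {μ₀ μ₁ : Measure E} (hπ : IsCoupling π μ₀ μ₁)
    [IsProbabilityMeasure π] (hq : IsRateMatrix q) (h : IsInterpolant q π P) :
    IsMarkovianProjection P PM ↔ IsCTMC (projGenerator q π) PM ∧ PM.map (eval 0) = μ₀ := by
  constructor
  · intro hPM
    exact ⟨h.isCTMC_of_isMarkovianProjection hq hPM, hPM.1.trans (h.map_eval_zero hπ)⟩
  · rintro ⟨hC, h0⟩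
    have hrate : ∀ x₀ x₁ (t : unitInterval) (x y : E), t < 1 → x ≠ y →
        P {w | endpoints w = (x₀, x₁) ∧ eval t w = x} ≠ 0 → HasJumpRate (bridge P x₀ x₁) t x y
          (q x y * heat q (1 - t) y x₁ / heat q (1 - t) x x₁) :=
      fun x₀ x₁ t x y _ hxy hne => h.hasJumpRate_bridge hq hxy hne
    refine ⟨h0.trans (h.map_eval_zero hπ).symm, projGenerator q π,
      fun x₀ x₁ t x y => q x y * heat q (1 - t) y x₁ / heat q (1 - t) x x₁, hC, hrate,
      fun t x y ht hxy _ => ?_⟩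
    exact (h.sum_cond_mul_rate hq (b := fun x₀ x₁ t x y =>
      q x y * heat q (1 - t) y x₁ / heat q (1 - t) x x₁) ht hxy fun x₀ x₁ hne =>
        hrate x₀ x₁ t x y ht hxy hne).symm

/-- The chain with the projected generator has càdlàg paths up to time `1`, although its rates may
be unbounded there. -/
lemma IsRateMatrix.exists_isCTMC_projGenerator (hq : IsRateMatrix q) (μ : Measure E)
    [IsProbabilityMeasure μ] (hμ : ∀ x, μ.real {x} = interpolantDensity q π 0 x) :
    ∃ PM : Measure (PathSpace E), IsCTMC (projGenerator q π) PM ∧ PM.map (eval 0) = μ := by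
  obtain ⟨p, hp⟩ := hq.exists_isTransitionFunction π
  obtain ⟨C, hC, hb⟩ := hq.exists_density_mul_one_sub_le π hp
  obtain ⟨PM, hPM, h0, hM⟩ := hp.exists_isMarkovWith μ
    (C := Fintype.card E * C) (by positivity) fun s t hs hst ht => by
      simp only [hμ, hq.sum_density_mul_transition hp ⟨hs, hst.trans ht⟩]
      refine (Finset.sum_le_sum fun x _ => hb s t hs hst ht x).trans_eq ?_
      rw [Finset.sum_const, Finset.card_univ, nsmul_eq_mul, mul_assoc]
  refine ⟨PM, (isCTMC_iff (hq.isGenerator_projGenerator π) hp PM).2 ⟨hPM, hM⟩, ?_⟩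
  refine Measure.ext_of_singleton fun x => ?_
  rw [map_eval_apply_singleton, h0]

lemma IsRateMatrix.isCTMC_projGenerator_unique (hq : IsRateMatrix q) {PM' : Measure (PathSpace E)}
    (h : IsCTMC (projGenerator q π) PM) (h' : IsCTMC (projGenerator q π) PM')
    (h0 : PM.map (eval 0) = PM'.map (eval 0)) : PM = PM' := by
  obtain ⟨p, hp⟩ := hq.exists_isTransitionFunction π
  have hg := hq.isGenerator_projGenerator π
  obtain ⟨hP, hM⟩ := (isCTMC_iff hg hp PM).1 h
  obtain ⟨hP', hM'⟩ := (isCTMC_iff hg hp PM').1 h'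
  refine hM.ext hM' fun x => ?_
  rw [← map_eval_apply_singleton, h0, map_eval_apply_singleton]

lemma IsRateMatrix.measureReal_eval_projGenerator (hq : IsRateMatrix q)
    (h : IsCTMC (projGenerator q π) PM)
    (h0 : ∀ x, PM.real {w | eval 0 w = x} = interpolantDensity q π 0 x)
    (t : unitInterval) (x : E) : PM.real {w | eval t w = x} = interpolantDensity q π t x := by
  obtain ⟨p, hp⟩ := hq.exists_isTransitionFunction π
  obtain ⟨hP, hM⟩ := (isCTMC_iff (hq.isGenerator_projGenerator π) hp PM).1 h
  rw [hM.measureReal_eval hp, ← hq.sum_density_mul_transition hp t.2]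
  simp only [h0]

end Projection

end MarkovBridge

end

theorem mainTheorem3 (d m : ℕ)
    (μ₀ μ₁ : Measure (StateSpace d m)) [IsProbabilityMeasure μ₀] [IsProbabilityMeasure μ₁]
    (π : Measure (StateSpace d m × StateSpace d m)) (hπ : IsCoupling π μ₀ μ₁)
    (q : Matrix (StateSpace d m) (StateSpace d m) ℝ) (hq : IsRateMatrix q)
    (hsupp : ∀ x₀ x₁, π {(x₀, x₁)} ≠ 0 → transProb q 0 1 x₁ x₀ ≠ 0) :
    (∃ PI : Measure (PathSpace (StateSpace d m)), IsInterpolant q π PI) ∧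
    ∀ PI : Measure (PathSpace (StateSpace d m)), IsInterpolant q π PI →
      (∀ (t : unitInterval) (x : StateSpace d m),
        PI.real {w | eval t w = x} = interpolantDensity q π t x) ∧
      (∃ PM, IsMarkovianProjection PI PM) ∧
      (∀ PM, IsMarkovianProjection PI PM ↔
        IsCTMC (projGenerator q π) PM ∧ PM.map (eval 0) = μ₀) ∧
      (∀ PM PM', IsMarkovianProjection PI PM → IsMarkovianProjection PI PM' → PM = PM') ∧
      (∀ PM, IsMarkovianProjection PI PM →
        ∀ t : unitInterval, PM.map (eval t) = PI.map (eval t)) := by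
  have hπP := hπ.isProbabilityMeasure
  refine ⟨hq.exists_isInterpolant hπ hsupp, fun PI hPI => ?_⟩
  have hP := hPI.isProbabilityMeasure
  have hmarg := fun t x => hPI.measureReal_eval hq t x
  have hiff := fun PM => hPI.isMarkovianProjection_iff (PM := PM) hπ hq
  have h0 : ∀ PM : Measure (PathSpace (StateSpace d m)), PM.map (eval 0) = μ₀ →
      ∀ x, PM.real {w | eval 0 w = x} = interpolantDensity q π 0 x := by
    intro PM h x
    rw [measureReal_def, ← map_eval_apply_singleton, h, ← hPI.map_eval_zero hπ,
      map_eval_apply_singleton, ← measureReal_def]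
    exact hmarg 0 x
  have hμ : ∀ x, μ₀.real {x} = interpolantDensity q π 0 x := by
    intro x
    rw [← h0 PI (hPI.map_eval_zero hπ), measureReal_def, measureReal_def,
      ← map_eval_apply_singleton, hPI.map_eval_zero hπ]
  refine ⟨hmarg, ?_, hiff, fun PM PM' h h' => ?_, fun PM h t => ?_⟩
  · obtain ⟨PM, hPM⟩ := hq.exists_isCTMC_projGenerator μ₀ hμ
    exact ⟨PM, (hiff PM).2 hPM⟩
  · exact hq.isCTMC_projGenerator_unique ((hiff PM).1 h).1 ((hiff PM').1 h').1 (h.1.trans h'.1.symm)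
  · obtain ⟨hC, hC0⟩ := (hiff PM).1 h
    have hPM := hC.prob
    refine Measure.ext_of_singleton fun x => ?_
    rw [map_eval_apply_singleton, map_eval_apply_singleton]
    refine (measureReal_eq_measureReal_iff).1 ?_
    rw [hmarg, hq.measureReal_eval_projGenerator hC (h0 PM hC0)]
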